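/- **The fiducial pair.** There is a function $\psi:(0,\infty)\to\mathbb R$, and it is the only one, that is twice differentiable, monotonically decreasing and satisfies $$(\rho\partial_\rho)^2\psi=\tfrac12\rho^2\sinh(2\psi),\qquad \psi(\rho)=O(e^{-\rho})\ (\rho\to\infty),\qquad \psi(\rho)+\log(a_0\rho^{1/3})\to0\ (\rho\searrow0)\ \text{ for some } a_0>0 .$$ For $t>0$ and $z=re^{i\theta}$ in the open unit disc $D\subset\mathbb C$ put $h_t(r)=\psi(\tfrac83tr^{3/2})$, $f_t(r)=\tfrac18+\tfrac14r\,\partial_rh_t(r)$ and $$A_t=f_t(r)\begin{pmatrix}1&0\\0&-1\end{pmatrix}\Big(\frac{dz}{z}-\frac{d\bar z}{\bar z}\Big),\qquad \Phi_t=\varphi_t\,dz,\quad \varphi_t=\begin{pmatrix}0&r^{1/2}e^{h_t(r)}\\ r^{1/2}e^{i\theta}e^{-h_t(r)}&0\end{pmatrix}.$$ **The linearization.** For sections $\gamma:D\to i\,\mathfrak{su}(2)$ (traceless Hermitian $2\times2$ matrices) let $\nabla_j\gamma=\partial_j\gamma+[(A_t)_j,\gamma]$ for $j=x,y$, let $\Delta_{A_t}\gamma=-(\nabla_x\nabla_x+\nabla_y\nabla_y)\gamma$,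 let $M_{\varphi_t}\gamma=2\big([\varphi_t^*,[\varphi_t,\gamma]]+[\varphi_t,[\varphi_t^*,\gamma]]\big)$, and let $$L_t=\Delta_{A_t}+t^2M_{\varphi_t}$$ with domain $H^2(D)\cap H^1_0(D)$ (Dirichlet boundary conditions), derivatives being understood in the weak sense. **Proposition.** For every $t>0$ the operator $L_t:H^2(D)\cap H^1_0(D)\to L^2(D)$ is well defined and bijective. Let $G_t=L_t^{-1}:L^2(D)\to H^2(D)\cap H^1_0(D)$. There is a constant $C>0$, independent of $t$, such that 1. $\|G_t\|_{\mathcal L(L^2,L^2)}\le C$ for all $t>0$; 2. $\|G_t\|_{\mathcal L(L^2,H^2)}\le Ct^2$ for all $t\ge1$. -/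

import Mathlib

open scoped Distributions ContDiff Topology ENNReal
open MeasureTheory Filter Set

noncomputable section

namespace Hitchin

/-! ### The fiducial solution -/

/-- The profile of the fiducial solutions: a monotonically decreasing solution on `(0, ∞)` of the
Painlevé III type equation `(ρ ∂_ρ)² ψ = ½ ρ² sinh (2 ψ)` that decays exponentially at infinity
and behaves like `-log (a₀ ρ^{1/3})` for some `a₀ > 0` at the origin. -/
structure IsPainleveProfile (ψ : ℝ → ℝ) : Prop where
  differentiableAt : ∀ ρ, 0 < ρ → DifferentiableAt ℝ ψ ρ
  differentiableAt_deriv : ∀ ρ, 0 < ρ → DifferentiableAt ℝ (fun x => x * deriv ψ x) ρ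
  ode : ∀ ρ, 0 < ρ →
    ρ * deriv (fun x => x * deriv ψ x) ρ = (1 / 2 : ℝ) * ρ ^ 2 * Real.sinh (2 * ψ ρ)
  near_zero : ∃ a₀ : ℝ, 0 < a₀ ∧
    Tendsto (fun ρ => ψ ρ + Real.log (a₀ * ρ ^ (1 / 3 : ℝ))) (𝓝[>] (0 : ℝ)) (𝓝 0)
  decay : ψ =O[atTop] fun ρ => Real.exp (-ρ)
  antitone : AntitoneOn ψ (Ioi 0)

/-- `h_t(r) = ψ((8/3) t r^{3/2})`. -/
def hFid (ψ : ℝ → ℝ) (t r : ℝ) : ℝ := ψ (8 / 3 * t * r ^ (3 / 2 : ℝ))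

/-- `f_t(r) = 1/8 + (1/4) r ∂_r h_t(r)`. -/
def fFid (ψ : ℝ → ℝ) (t r : ℝ) : ℝ := 1 / 8 + 1 / 4 * (r * deriv (hFid ψ t) r)

/-- The fiducial connection `A_t = f_t(r) diag(1, -1) (dz/z - dz̄/z̄)`: the value at the point `z`
of this matrix valued one-form on the tangent vector `e`. -/
def connFid (ψ : ℝ → ℝ) (t : ℝ) (z e : ℂ) : Matrix (Fin 2) (Fin 2) ℂ :=
  ((fFid ψ t ‖z‖ : ℂ) * (e / z - star e / star z)) • !![1, 0; 0, -1]

/-- The coefficient `φ_t` of the fiducial Higgs field `Φ_t = φ_t dz`, with rows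
`(0, r^{1/2} e^{h_t(r)})` and `(r^{1/2} e^{iθ} e^{-h_t(r)}, 0)`. -/
def higgsFid (ψ : ℝ → ℝ) (t : ℝ) (z : ℂ) : Matrix (Fin 2) (Fin 2) ℂ :=
  !![0, (Real.sqrt ‖z‖ * Real.exp (hFid ψ t ‖z‖) : ℂ);
    (Real.sqrt ‖z‖ : ℂ) * (z / ‖z‖) * (Real.exp (-hFid ψ t ‖z‖) : ℂ), 0]

/-- `M_φ γ = 2 ([φ*, [φ, γ]] + [φ, [φ*, γ]])`. -/
def higgsPotential (φ γ : Matrix (Fin 2) (Fin 2) ℂ) : Matrix (Fin 2) (Fin 2) ℂ :=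
  (2 : ℂ) • (⁅φ.conjTranspose, ⁅φ, γ⁆⁆ + ⁅φ, ⁅φ.conjTranspose, γ⁆⁆)

/-! ### Sections of `i su(E)` over the unit disc -/

/-- The coefficient space of the trivialized bundle `i su(E)`. -/
abbrev Fiber : Type := EuclideanSpace ℝ (Fin 3)

/-- The matrix `a₁ σ₁ + a₂ σ₂ + a₃ σ₃` in `i su(2)`, where `σ_j = i τ_j` with
`τ₁ = diag(i, -i)`, `τ₂ = (0, 1; -1, 0)`, `τ₃ = (0, i; i, 0)`.
One has `tr (γ²) = 2 (a₁² + a₂² + a₃²)`. -/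
def toMat (a : Fiber) : Matrix (Fin 2) (Fin 2) ℂ :=
  (a 0 : ℂ) • (Complex.I • !![Complex.I, 0; 0, -Complex.I]) +
  (a 1 : ℂ) • (Complex.I • !![0, 1; -1, 0]) +
  (a 2 : ℂ) • (Complex.I • !![0, Complex.I; Complex.I, 0])

/-- The open unit disc `D`. -/
def disc : TopologicalSpace.Opens ℂ := ⟨Metric.ball 0 1, Metric.isOpen_ball⟩

/-- Lebesgue measure on the disc. -/
abbrev discMeasure : Measure ℂ := volume.restrict (disc : Set ℂ)

/-- `L²(D; i su(E))` in the trivialization by `σ₁, σ₂, σ₃`. -/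
abbrev L2Disc : Type := Lp Fiber 2 discMeasure

/-- The coordinate vectors `∂_x` and `∂_y`. -/
def dir : Fin 2 → ℂ := ![1, Complex.I]

/-- `g` is the weak partial derivative of `u` in the `i`-th coordinate direction. -/
def HasWeakDeriv (i : Fin 2) (u g : L2Disc) : Prop :=
  ∀ χ : 𝓓(disc, ℝ),
    ∫ z, fderiv ℝ χ z (dir i) • u z ∂discMeasure = -∫ z, χ z • g z ∂discMeasure

open scoped Classical in
/-- The weak partial derivative, as an element of `L²` (zero if there is none). -/
def weakDeriv (i : Fin 2) (u : L2Disc) : L2Disc :=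
  if h : ∃ g, HasWeakDeriv i u g then h.choose else 0

/-- `H¹(D)`. -/
def MemH1 (u : L2Disc) : Prop := ∀ i, ∃ g, HasWeakDeriv i u g

/-- `H²(D)`. -/
def MemH2 (u : L2Disc) : Prop := MemH1 u ∧ ∀ i, MemH1 (weakDeriv i u)

/-- `H¹₀(D)`, the closure of the test sections in `H¹(D)`. -/
def MemH10 (u : L2Disc) : Prop :=
  MemH1 u ∧ ∀ ε : ℝ≥0∞, 0 < ε → ∃ χ : 𝓓(disc, Fiber),
    eLpNorm (fun z => u z - χ z) 2 discMeasure < ε ∧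
    ∀ i, eLpNorm (fun z => weakDeriv i u z - fderiv ℝ χ z (dir i)) 2 discMeasure < ε

/-- The `H²(D)` norm. -/
def h2Norm (u : L2Disc) : ℝ :=
  Real.sqrt (‖u‖ ^ 2 + ∑ i, ‖weakDeriv i u‖ ^ 2 + ∑ i, ∑ j, ‖weakDeriv j (weakDeriv i u)‖ ^ 2)

/-- The common domain `H²(D) ∩ H¹₀(D)` (Dirichlet boundary conditions). -/
def MemDirichletDomain (u : L2Disc) : Prop := MemH2 u ∧ MemH10 u

/-! ### The linearization -/

/-- `p` is the `i`-th component `∂_i u + [A_i, u]` of `d_A u`, where `A` is the fiducial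
connection and the derivative is taken in the weak sense. -/
def HasCovDeriv (ψ : ℝ → ℝ) (t : ℝ) (i : Fin 2) (u p : L2Disc) : Prop :=
  ∃ g : L2Disc, HasWeakDeriv i u g ∧
    ∀ᵐ z ∂discMeasure, toMat (p z) = toMat (g z) + ⁅connFid ψ t z (dir i), toMat (u z)⁆

/-- `v = Δ_A u` where `Δ_A = d_A^* d_A = -(∇_x ∇_x + ∇_y ∇_y)` for the fiducial connection. -/
def HasConnLaplacian (ψ : ℝ → ℝ) (t : ℝ) (u v : L2Disc) : Prop :=
  ∃ p q : Fin 2 → L2Disc,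
    (∀ i, HasCovDeriv ψ t i u (p i) ∧ HasCovDeriv ψ t i (p i) (q i)) ∧ v = -∑ i, q i

/-- `v = L_t u = Δ_A u + t² M_φ u`, for the fiducial pair. -/
def HasLinearization (ψ : ℝ → ℝ) (t : ℝ) (u v : L2Disc) : Prop :=
  ∃ w : L2Disc, HasConnLaplacian ψ t u w ∧
    ∀ᵐ z ∂discMeasure,
      toMat (v z) = toMat (w z) + ((t ^ 2 : ℝ) : ℂ) • higgsPotential (higgsFid ψ t z) (toMat (u z))

/-- `G` is the inverse `L²(D) → H²(D) ∩ H¹₀(D)` of `L_t : H²(D) ∩ H¹₀(D) → L²(D)`; this includes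
that `L_t` is defined on all of `H²(D) ∩ H¹₀(D)`. -/
structure IsDirichletInverse (ψ : ℝ → ℝ) (t : ℝ) (G : L2Disc →L[ℝ] L2Disc) : Prop where
  defined : ∀ u, MemDirichletDomain u → ∃! v, HasLinearization ψ t u v
  mem : ∀ v, MemDirichletDomain (G v)
  right_inv : ∀ v, HasLinearization ψ t (G v) v
  left_inv : ∀ u v, MemDirichletDomain u → HasLinearization ψ t u v → G v = u

end Hitchin

end

open scoped InnerProductSpace

noncomputable section

namespace Hitchin

/-! ### The Painlevé III boundary value problem on a bounded interval -/

/-! The profile. With `s = log ρ` the equation becomes `y'' = ½ e^{2s} sinh (2y)`, and the boundary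
behaviour becomes a finite limit of `y + s/3` at `-∞` and decay at `+∞`. On `[-N, N]` the problem
`y'(-N) = -1/3`, `y(N) = 0` is solved by shooting (`exists_mixed_bvp`). Convexity gives `y ≥ 0` and
`-1/3 ≤ y' ≤ 0`, which leads to bounds that do not depend on `N`. Since `sinh` is increasing, the
difference `d` of two solutions has `d d'` nondecreasing. This one fact makes the solutions Cauchy
as `N → ∞` (`IsProfileOn.sq_sub_le`) and gives uniqueness of the limit
(`eq_zero_of_monotone_mul_deriv`).

The operator. In the basis `σ₁, σ₂, σ₃` the bracket with `A_i` is a scalar function times one fixed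
skew rotation of the fibre, and `M_φ` is a nonnegative symmetric matrix. The slope `-1/3` at `-∞` is
exactly what cancels the `1/8` in `f_t`. Hence `f_t = O(r²)`, the connection coefficients vanish to
first order at the origin, and their derivatives stay bounded
(`IsProfileOn.isConicField_connCoeff`). The singularity `e^{2h} ~ 1/r` is cancelled by the factor
`r` in `|φ_t|²`. So for each `t` the operator `L_t` is a perturbation of the flat Laplacian by
bounded terms of order at most one.

The bound on `L²`. Integrating `∂_x (x u)` against `u` gives `‖u‖² = -2⟨x u, ∂_x u⟩`. As `[A_x, u]`
is pointwise orthogonal to `u`, the derivative may be replaced by `∇_x u`, so `‖u‖ ≤ 2 ‖∇_x u‖` for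
every skew connection (`poincare_of_mem_H10`). Lax–Milgram and testing the equation with its
solution then give `‖G_t‖ ≤ 4`.

The bound on `H²`. On the disc a function vanishing on the circle satisfies `∑ ‖u_ij‖² ≤ ‖Δu‖²`, by
convexity of the boundary (`integral_hessian_le`). Laplacians of polynomials vanishing on the circle
are dense in `L²`, so the flat Dirichlet problem is solvable in `H²` with this bound
(`exists_dirichlet_solution`). Moving the lower order terms of `L_t` to the right hand side costs a
factor controlled by `|A|²`, `|∂A|` and `t²|M|`; the first two are `O(t^{4/3})`, the last is
`O(t²)`. -/

lemma monotoneOn_of_hasDerivAt_nonneg {f f' : ℝ → ℝ} {a b : ℝ}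
    (hf : ∀ x ∈ Icc a b, HasDerivAt f (f' x) x) (h : ∀ x ∈ Icc a b, 0 ≤ f' x) :
    MonotoneOn f (Icc a b) :=
  monotoneOn_of_hasDerivWithinAt_nonneg (convex_Icc a b)
    (fun x hx => (hf x hx).continuousAt.continuousWithinAt)
    (fun x hx => (hf x (interior_subset hx)).hasDerivWithinAt)
    (fun x hx => h x (interior_subset hx))

lemma antitoneOn_of_hasDerivAt_nonpos {f f' : ℝ → ℝ} {a b : ℝ}
    (hf : ∀ x ∈ Icc a b, HasDerivAt f (f' x) x) (h : ∀ x ∈ Icc a b, f' x ≤ 0) :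
    AntitoneOn f (Icc a b) :=
  antitoneOn_of_hasDerivWithinAt_nonpos (convex_Icc a b)
    (fun x hx => (hf x hx).continuousAt.continuousWithinAt)
    (fun x hx => (hf x (interior_subset hx)).hasDerivWithinAt)
    (fun x hx => h x (interior_subset hx))

/-- `sinh (2 x)` with the argument `x` truncated to `[0, K]`. -/
def truncSinh (K x : ℝ) : ℝ := Real.sinh (2 * max 0 (min x K))

lemma truncSinh_nonneg (K x : ℝ) : 0 ≤ truncSinh K x :=
  Real.sinh_nonneg_iff.2 (by positivity)

lemma truncSinh_of_nonpos {K x : ℝ} (hx : x ≤ 0) : truncSinh K x = 0 := by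
  rw [truncSinh, max_eq_left ((min_le_left _ _).trans hx)]; simp

lemma truncSinh_of_mem {K x : ℝ} (h0 : 0 ≤ x) (hx : x ≤ K) :
    truncSinh K x = Real.sinh (2 * x) := by
  rw [truncSinh, min_eq_left hx, max_eq_right h0]

lemma truncSinh_le {K : ℝ} (hK : 0 ≤ K) (x : ℝ) : truncSinh K x ≤ Real.sinh (2 * K) :=
  Real.sinh_le_sinh.2 (by gcongr; exact max_le hK (min_le_right _ _))

lemma abs_sinh_sub_sinh_le {R x y : ℝ} (hx : |x| ≤ R) (hy : |y| ≤ R) :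
    |Real.sinh x - Real.sinh y| ≤ Real.cosh R * |x - y| := by
  have := (convex_Icc (-R) R).norm_image_sub_le_of_norm_hasDerivWithin_le (f := Real.sinh)
    (f' := Real.cosh) (C := Real.cosh R)
    (fun z _ => (Real.hasDerivAt_sinh z).hasDerivWithinAt)
    (fun z hz => by
      rw [Real.norm_eq_abs, abs_of_pos (Real.cosh_pos z), Real.cosh_le_cosh]
      exact (abs_le.2 hz).trans (le_abs_self R)) (abs_le.1 hy) (abs_le.1 hx)
  simpa [Real.norm_eq_abs] using this

lemma abs_max_min_sub_le (a b x y : ℝ) :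
    |max a (min x b) - max a (min y b)| ≤ |x - y| := by
  refine (abs_max_sub_max_le_max a (min x b) a (min y b)).trans ?_
  simp only [sub_self, abs_zero]
  refine max_le (abs_nonneg _) ((abs_min_sub_min_le_max x b y b).trans ?_)
  simp

lemma abs_truncSinh_sub_le {K : ℝ} (hK : 0 ≤ K) (x y : ℝ) :
    |truncSinh K x - truncSinh K y| ≤ Real.cosh (2 * K) * 2 * |x - y| := by
  have hb : ∀ z : ℝ, |2 * max 0 (min z K)| ≤ 2 * K := fun z => by
    rw [abs_of_nonneg (by positivity)]
    gcongr; exact max_le hK (min_le_right _ _)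
  refine (abs_sinh_sub_sinh_le (hb x) (hb y)).trans ?_
  rw [← mul_sub, abs_mul, abs_two, mul_assoc]
  have := (Real.cosh_pos (2 * K)).le
  exact mul_le_mul_of_nonneg_left (mul_le_mul_of_nonneg_left (abs_max_min_sub_le _ _ _ _)
    zero_le_two) this

/-- The first order system for the truncated equation, with truncated velocity. -/
def truncField (K M s : ℝ) (y : ℝ × ℝ) : ℝ × ℝ :=
  (max (-M) (min y.2 M), 1 / 2 * Real.exp (2 * s) * truncSinh K y.1)

/-- Truncation makes the vector field bounded and Lipschitz, so Picard–Lindelöf gives a flow on the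
whole interval, continuous in the shooting parameter `a`. The velocity cutoff `M` is an a priori
bound on the slope and hence never active; only the cutoff of `sinh` remains in the conclusion. -/
lemma exists_truncated_flow {N K : ℝ} (hN : 0 ≤ N) (hK : 0 ≤ K) :
    ∃ Y P : ℝ → ℝ → ℝ, (∀ a ∈ Icc (-1) K, Y a (-N) = a ∧ P a (-N) = -(1 / 3) ∧
      ∀ s ∈ Icc (-N) N, HasDerivAt (Y a) (P a s) s ∧
        HasDerivAt (P a) (1 / 2 * Real.exp (2 * s) * truncSinh K (Y a s)) s) ∧
      ContinuousOn (fun a => Y a N) (Icc (-1) K) := by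
  set E := 1 / 2 * Real.exp (2 * (N + 1)) with hE
  have hE0 : 0 < E := by positivity
  set B := E * Real.sinh (2 * K) with hB
  have hB0 : 0 ≤ B := mul_nonneg hE0.le (Real.sinh_nonneg_iff.2 (by positivity))
  set M := 1 / 3 + B * (2 * N) with hM
  have hM0 : 0 ≤ M := by positivity
  set Kl := max 1 (E * (Real.cosh (2 * K) * 2)) with hKl
  have hKl0 : 0 ≤ Kl := le_trans zero_le_one (le_max_left _ _)
  set L := max M B with hL
  have hL0 : 0 ≤ L := le_trans hM0 (le_max_left _ _)
  set r := K + 1 with hr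
  have hr0 : 0 ≤ r := by positivity
  -- The time interval is enlarged by one on both sides, so that derivatives at `±N` are two-sided.
  -- Then `2N + 1` is the longest time travelled from `-N`, and `A` is the room needed at speed `L`.
  set A := r + L * (2 * N + 1) with hA
  have hA0 : 0 ≤ A := by positivity
  have hexp : ∀ s ∈ Icc (-N - 1) (N + 1), 1 / 2 * Real.exp (2 * s) ≤ E := fun s hs => by
    rw [hE]; gcongr; exact hs.2
  have hmem : -N ∈ Icc (-N - 1) (N + 1) := ⟨by linarith, by linarith⟩
  have hPL : IsPicardLindelof (truncField K M) (⟨-N, hmem⟩ : Icc (-N - 1) (N + 1))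
      ((0 : ℝ), (-(1 / 3) : ℝ)) A.toNNReal r.toNNReal L.toNNReal Kl.toNNReal := by
    refine ⟨fun s hs => ?_, fun x _ => ?_, fun s hs x _ => ?_, ?_⟩
    · refine LipschitzWith.lipschitzOnWith (LipschitzWith.of_dist_le_mul fun x y => ?_)
      simp only [truncField, Prod.dist_eq, Real.dist_eq, Real.coe_toNNReal Kl hKl0]
      refine max_le ?_ ?_
      · refine (abs_max_min_sub_le _ _ _ _).trans ((le_max_right |x.1 - y.1| _).trans ?_)
        exact le_mul_of_one_le_left (by positivity) (le_max_left _ _)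
      · rw [← mul_sub, abs_mul, abs_of_pos (by positivity)]
        calc 1 / 2 * Real.exp (2 * s) * |truncSinh K x.1 - truncSinh K y.1|
            ≤ E * (Real.cosh (2 * K) * 2 * |x.1 - y.1|) := by
              gcongr
              · exact hexp s hs
              · exact abs_truncSinh_sub_le hK _ _
          _ = E * (Real.cosh (2 * K) * 2) * |x.1 - y.1| := by ring
          _ ≤ _ := by
              gcongr
              · exact le_max_right _ _
              · exact le_max_left _ _
    · unfold truncField
      fun_prop
    · simp only [truncField, Prod.norm_def, Real.norm_eq_abs, Real.coe_toNNReal L hL0]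
      refine max_le ?_ ?_
      · refine le_trans ?_ (le_max_left _ _)
        exact abs_le.2 ⟨le_max_left _ _, max_le (by linarith) (min_le_right _ _)⟩
      · refine le_trans ?_ (le_max_right _ _)
        rw [abs_of_nonneg (mul_nonneg (by positivity) (truncSinh_nonneg _ _))]
        exact mul_le_mul (hexp s hs) (truncSinh_le hK _) (truncSinh_nonneg _ _) hE0.le
    · rw [Real.coe_toNNReal L hL0, Real.coe_toNNReal A hA0, Real.coe_toNNReal r hr0,
        max_eq_left (by simp only; linarith), hA]
      exact le_of_eq (by ring)
  obtain ⟨α, hα, hcont⟩ :=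
    hPL.exists_forall_mem_closedBall_eq_hasDerivWithinAt_continuousOn
  have hball : ∀ a ∈ Icc (-1) K, ((a, -(1 / 3)) : ℝ × ℝ) ∈
      Metric.closedBall ((0 : ℝ), (-(1 / 3) : ℝ)) r.toNNReal := fun a ha => by
    simp only [Metric.mem_closedBall, Prod.dist_eq, Real.dist_eq, Real.coe_toNNReal r hr0]
    refine max_le ?_ (by simpa using hr0)
    rw [sub_zero]; exact abs_le.2 ⟨by linarith [ha.1], by linarith [ha.2]⟩
  refine ⟨fun a s => (α ((a, -(1 / 3)), s)).1, fun a s => (α ((a, -(1 / 3)), s)).2,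
    fun a ha => ?_, ?_⟩
  · obtain ⟨h0, hd⟩ := hα _ (hball a ha)
    have hsub : ∀ s ∈ Icc (-N) N, HasDerivAt (fun s => α ((a, -(1 / 3)), s))
        (truncField K M s (α ((a, -(1 / 3)), s))) s := fun s hs =>
      (hd s ⟨by linarith [hs.1], by linarith [hs.2]⟩).hasDerivAt
        (Icc_mem_nhds (by linarith [hs.1]) (by linarith [hs.2]))
    have h1 := fun s hs => hasFDerivAt_fst.comp_hasDerivAt s (hsub s hs)
    have h2 := fun s hs => hasFDerivAt_snd.comp_hasDerivAt s (hsub s hs)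
    simp only [truncField, ContinuousLinearMap.coe_fst', ContinuousLinearMap.coe_snd',
      Function.comp_def] at h1 h2
    have h0' : α ((a, -(1 / 3)), -N) = (a, -(1 / 3)) := h0
    have hP0 : (α ((a, -(1 / 3)), -N)).2 = -(1 / 3) := by rw [h0']
    have hbd : ∀ s ∈ Icc (-N) N, |(α ((a, -(1 / 3)), s)).2| ≤ M := fun s hs => by
      have := norm_image_sub_le_of_norm_deriv_le_segment' (a := -N) (b := N) (C := B)
        (fun x hx => (h2 x hx).hasDerivWithinAt) (fun x hx => by
          rw [Real.norm_eq_abs,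
            abs_of_nonneg (mul_nonneg (by positivity) (truncSinh_nonneg _ _))]
          exact mul_le_mul (hexp x ⟨by linarith [hx.1], by linarith [hx.2]⟩)
            (truncSinh_le hK _) (truncSinh_nonneg _ _) hE0.le) s hs
      rw [Real.norm_eq_abs, hP0] at this
      have h3 : B * (s - -N) ≤ B * (2 * N) := by gcongr; linarith [hs.2]
      have := abs_le.1 (this.trans h3)
      exact abs_le.2 ⟨by linarith, by linarith⟩
    refine ⟨congrArg Prod.fst h0', hP0, fun s hs => ⟨?_, h2 s hs⟩⟩
    have := h1 s hs
    rwa [min_eq_left (abs_le.1 (hbd s hs)).2, max_eq_right (abs_le.1 (hbd s hs)).1] at this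
  · refine continuous_fst.comp_continuousOn (hcont.comp (by fun_prop) fun a ha => ?_)
    exact ⟨hball a ha, by constructor <;> dsimp <;> linarith⟩

/-- Existence for the mixed boundary value problem `y'' = ½ e^{2s} sinh (2 y)`,
`y'(-N) = -1/3`, `y(N) = 0`. -/
lemma exists_mixed_bvp {N : ℝ} (hN : 1 ≤ N) :
    ∃ y p : ℝ → ℝ, y N = 0 ∧ p (-N) = -(1 / 3) ∧ (∀ s ∈ Icc (-N) N, 0 ≤ y s) ∧
      AntitoneOn y (Icc (-N) N) ∧
      ∀ s ∈ Icc (-N) N, HasDerivAt y (p s) s ∧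
        HasDerivAt p (1 / 2 * Real.exp (2 * s) * Real.sinh (2 * y s)) s := by
  -- A solution with slope at least `-1/3` loses at most `2N/3` over the interval, so starting at
  -- height `K` it ends at a nonnegative height.
  set K := 2 * N / 3 with hK
  have hK0 : 0 ≤ K := by positivity
  obtain ⟨Y, P, hYP, hc⟩ := exists_truncated_flow (N := N) (by linarith) hK0
  have hl : -N ∈ Icc (-N) N := ⟨le_rfl, by linarith⟩
  have hr : N ∈ Icc (-N) N := ⟨by linarith, le_rfl⟩
  have hprod : ∀ a ∈ Icc (-1) K, ∀ s ∈ Icc (-N) N,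
      HasDerivAt (fun s => Y a s * P a s)
        (P a s * P a s + Y a s * (1 / 2 * Real.exp (2 * s) * truncSinh K (Y a s))) s :=
    fun a ha s hs => ((hYP a ha).2.2 s hs).1.mul ((hYP a ha).2.2 s hs).2
  have hpos : ∀ x s : ℝ, 0 ≤ x * (1 / 2 * Real.exp (2 * s) * truncSinh K x) := fun x s => by
    rcases le_total x 0 with h | h
    · simp [truncSinh_of_nonpos h]
    · exact mul_nonneg h (mul_nonneg (by positivity) (truncSinh_nonneg _ _))
  -- The basic monotone quantity: `(y y')' = y'² + y y'' ≥ 0`.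
  have hmono : ∀ a ∈ Icc (-1) K, MonotoneOn (fun s => Y a s * P a s) (Icc (-N) N) :=
    fun a ha => monotoneOn_of_hasDerivAt_nonneg (hprod a ha)
      fun s _ => add_nonneg (mul_self_nonneg _) (hpos _ _)
  have hsq : ∀ a ∈ Icc (-1) K, ∀ s ∈ Icc (-N) N,
      HasDerivAt (fun s => Y a s ^ 2) (2 * (Y a s * P a s)) s := fun a ha s hs => by
    simpa [mul_assoc, Pi.pow_def] using ((hYP a ha).2.2 s hs).1.pow 2
  have hcontY : ∀ a ∈ Icc (-1) K, ContinuousOn (Y a) (Icc (-N) N) := fun a ha s hs =>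
    ((hYP a ha).2.2 s hs).1.continuousAt.continuousWithinAt
  have hm1 : (-1 : ℝ) ∈ Icc (-1) K := ⟨le_rfl, by linarith⟩
  have hKm : K ∈ Icc (-1) K := ⟨by linarith, le_rfl⟩
  -- Starting at `-1` one has `y y' = 1/3 > 0`, so `y²` grows from `1` and `y` can never reach `0`.
  have hneg : Y (-1) N ≤ 0 := by
    by_contra! hcon
    have h0 : Y (-1) (-N) = -1 := (hYP _ hm1).1
    obtain ⟨s, hs, hs0⟩ := intermediate_value_Icc (by linarith : -N ≤ N) (hcontY _ hm1)
      (show (0 : ℝ) ∈ Icc (Y (-1) (-N)) (Y (-1) N) from ⟨by rw [h0]; norm_num, hcon.le⟩)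
    have := monotoneOn_of_hasDerivAt_nonneg (hsq _ hm1) (fun x hx => by
      have h1 := hmono _ hm1 hl hx hx.1
      simp only [h0, (hYP _ hm1).2.1] at h1
      linarith) hl hs hs.1
    simp only [h0, hs0] at this
    norm_num at this
  have hposN : 0 ≤ Y K N := by
    have hPm : MonotoneOn (P K) (Icc (-N) N) :=
      monotoneOn_of_hasDerivAt_nonneg (fun s hs => ((hYP _ hKm).2.2 s hs).2)
        fun s _ => mul_nonneg (by positivity) (truncSinh_nonneg _ _)
    have := monotoneOn_of_hasDerivAt_nonneg (a := -N) (b := N)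
      (f := fun s => Y K s + 1 / 3 * s) (f' := fun s => P K s + 1 / 3 * 1)
      (fun s hs => ((hYP _ hKm).2.2 s hs).1.add ((hasDerivAt_id s).const_mul _))
      (fun s hs => by
        have := hPm hl hs hs.1
        rw [(hYP _ hKm).2.1] at this
        linarith) hl hr hr.1
    simp only [(hYP _ hKm).1] at this
    linarith
  obtain ⟨a, ha, haN⟩ := intermediate_value_Icc (by linarith : (-1 : ℝ) ≤ K) hc
    (show (0 : ℝ) ∈ Icc _ _ from ⟨hneg, hposN⟩)
  simp only at haN
  obtain ⟨h0, hp0, hd⟩ := hYP a ha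
  -- For the chosen parameter `y y'` vanishes at the right end and is nondecreasing, so `y²` is
  -- nonincreasing.
  have hle : ∀ s ∈ Icc (-N) N, Y a s * P a s ≤ 0 := fun s hs => by
    have := hmono a ha hs hr hs.2
    simpa [haN] using this
  have ha0 : 0 ≤ a := by
    have := hle _ hl
    rw [h0, hp0] at this; linarith
  have hanti : AntitoneOn (fun s => Y a s ^ 2) (Icc (-N) N) :=
    antitoneOn_of_hasDerivAt_nonpos (hsq a ha) fun s hs => by linarith [hle s hs]
  -- A negative value would be preceded by a zero, after which the nonincreasing `y²` has to stay
  -- zero.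
  have hnn : ∀ s ∈ Icc (-N) N, 0 ≤ Y a s := fun s hs => by
    by_contra! hcon
    obtain ⟨s', hs', hs0⟩ := intermediate_value_Icc' hs.1
      ((hcontY a ha).mono (Icc_subset_Icc_right hs.2))
      (show (0 : ℝ) ∈ Icc (Y a s) (Y a (-N)) from ⟨hcon.le, by rw [h0]; exact ha0⟩)
    have := hanti ⟨hs'.1, hs'.2.trans hs.2⟩ hs hs'.2
    simp only [hs0] at this
    nlinarith
  have hanti' : AntitoneOn (Y a) (Icc (-N) N) := fun x hx y hy hxy =>
    (pow_le_pow_iff_left₀ (hnn y hy) (hnn x hx) two_ne_zero).1 (hanti hx hy hxy)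
  refine ⟨Y a, P a, haN, hp0, hnn, hanti', fun s hs => ⟨(hd s hs).1, ?_⟩⟩
  have hyK : Y a s ≤ K := (hanti' hl hs hs.1).trans (by rw [h0]; exact ha.2)
  simpa only [truncSinh_of_mem (hnn s hs) hyK] using (hd s hs).2

/-! ### A priori bounds for profiles, independent of the interval -/

/-- `(y, p)` solves `y' = p`, `p' = ½ e^{2s} sinh (2 y)` on `S`, with the sign and slope conditions
of the fiducial profile. -/
structure IsProfileOn (S : Set ℝ) (y p : ℝ → ℝ) : Prop where
  hasDerivAt : ∀ s ∈ S, HasDerivAt y (p s) s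
  hasDerivAt_slope : ∀ s ∈ S,
    HasDerivAt p (1 / 2 * Real.exp (2 * s) * Real.sinh (2 * y s)) s
  nonneg : ∀ s ∈ S, 0 ≤ y s
  slope_ge : ∀ s ∈ S, -(1 / 3) ≤ p s
  slope_nonpos : ∀ s ∈ S, p s ≤ 0

lemma le_sinh {x : ℝ} (hx : 0 ≤ x) : x ≤ Real.sinh x := Real.self_le_sinh_iff.2 hx

lemma sinh_le_exp (x : ℝ) : Real.sinh x ≤ Real.exp x / 2 := by
  rw [Real.sinh_eq]; linarith [Real.exp_pos (-x)]

/-- Convexity pins the slope. It increases from `-1/3`, and a positive slope before `N` would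
persist and make `y N > 0`. At `N` itself the sign follows by continuity. -/
lemma exists_profileOn {N : ℝ} (hN : 1 ≤ N) :
    ∃ y p : ℝ → ℝ, IsProfileOn (Icc (-N) N) y p ∧ y N = 0 ∧ p (-N) = -(1 / 3) := by
  obtain ⟨y, p, hyN, hpN, hnn, hanti, hd⟩ := exists_mixed_bvp hN
  have hl : -N ∈ Icc (-N) N := ⟨le_rfl, by linarith⟩
  have hr : N ∈ Icc (-N) N := ⟨by linarith, le_rfl⟩
  have hpm : MonotoneOn p (Icc (-N) N) :=
    monotoneOn_of_hasDerivAt_nonneg (fun s hs => (hd s hs).2) fun s hs =>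
      mul_nonneg (by positivity) (Real.sinh_nonneg_iff.2 (by linarith [hnn s hs]))
  have hlt : ∀ s ∈ Icc (-N) N, s < N → p s ≤ 0 := fun s hs hsN => by
    have := monotoneOn_of_hasDerivAt_nonneg (a := s) (b := N)
      (f := fun x => y x - p s * x) (f' := fun x => p x - p s * 1)
      (fun x hx => (hd x ⟨hs.1.trans hx.1, hx.2⟩).1.sub ((hasDerivAt_id x).const_mul _))
      (fun x hx => by
        have := hpm hs ⟨hs.1.trans hx.1, hx.2⟩ hx.1
        linarith) ⟨le_rfl, hsN.le⟩ ⟨hsN.le, le_rfl⟩ hsN.le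
    simp only [hyN] at this
    have h2 := hnn s hs
    by_contra! hcon
    nlinarith [mul_pos hcon (sub_pos.2 hsN)]
  have hpN0 : p N ≤ 0 := by
    have hc : Tendsto p (𝓝[<] N) (𝓝 (p N)) :=
      (hd N hr).2.continuousAt.tendsto.mono_left nhdsWithin_le_nhds
    refine le_of_tendsto hc ?_
    filter_upwards [Ioo_mem_nhdsLT (show -N < N by linarith)] with s hs
    exact hlt s ⟨hs.1.le, hs.2.le⟩ hs.2
  refine ⟨y, p, ⟨fun s hs => (hd s hs).1, fun s hs => (hd s hs).2, hnn, fun s hs => ?_,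
    fun s hs => ?_⟩, hyN, hpN⟩
  · rw [← hpN]; exact hpm hl hs hs.1
  · exact (hpm hs hr hs.2).trans hpN0

namespace IsProfileOn

variable {a b : ℝ} {y p : ℝ → ℝ}

lemma antitoneOn (h : IsProfileOn (Icc a b) y p) : AntitoneOn y (Icc a b) :=
  antitoneOn_of_hasDerivAt_nonpos h.hasDerivAt h.slope_nonpos

lemma mono {S T : Set ℝ} (h : IsProfileOn T y p) (hST : S ⊆ T) : IsProfileOn S y p :=
  ⟨fun s hs => h.1 s (hST hs), fun s hs => h.2 s (hST hs), fun s hs => h.3 s (hST hs),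
    fun s hs => h.4 s (hST hs), fun s hs => h.5 s (hST hs)⟩

/-- On the unit interval `p' ≥ e^{2s} y(s+1)`, because `sinh x ≥ x` and `y` decreases, while `p` can
gain at most `1/3` in total. -/
lemma apply_add_one_le {s : ℝ} (h : IsProfileOn (Icc s (s + 1)) y p) :
    y (s + 1) ≤ Real.exp (-2 * s) / 3 := by
  have hl : s ∈ Icc s (s + 1) := ⟨le_rfl, by linarith⟩
  have hr : s + 1 ∈ Icc s (s + 1) := ⟨by linarith, le_rfl⟩
  have := monotoneOn_of_hasDerivAt_nonneg (a := s) (b := s + 1)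
    (f := fun x => p x - Real.exp (2 * s) * y (s + 1) * x)
    (f' := fun x => 1 / 2 * Real.exp (2 * x) * Real.sinh (2 * y x)
      - Real.exp (2 * s) * y (s + 1) * 1)
    (fun x hx => (h.2 x hx).sub ((hasDerivAt_id x).const_mul _)) (fun x hx => by
      have h1 : y (s + 1) ≤ y x := h.antitoneOn hx hr hx.2
      have h2 := le_sinh (x := 2 * y x) (by linarith [h.nonneg x hx])
      have h3 : Real.exp (2 * s) ≤ Real.exp (2 * x) := Real.exp_le_exp.2 (by linarith [hx.1])
      have h4 : Real.exp (2 * s) * y (s + 1) ≤ Real.exp (2 * x) * (1 / 2 * Real.sinh (2 * y x)) :=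
        mul_le_mul h3 (by linarith) (h.nonneg _ hr) (Real.exp_pos _).le
      linarith) hl hr hl.2
  simp only at this
  have h1 := h.slope_ge s hl
  have h2 := h.slope_nonpos _ hr
  have h3 : Real.exp (2 * s) * y (s + 1) ≤ 1 / 3 := by linarith
  have h4 : Real.exp (-2 * s) * Real.exp (2 * s) = 1 := by rw [← Real.exp_add]; simp
  calc y (s + 1) = Real.exp (-2 * s) * (Real.exp (2 * s) * y (s + 1)) := by
        rw [← mul_assoc, h4, one_mul]
    _ ≤ Real.exp (-2 * s) * (1 / 3) := by gcongr
    _ = _ := by ring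

/-- Integrate the slope bound `p ≥ -1/3` backwards from `y 1 ≤ 1/3`. The latter needs the interval
`[0, 1]`, whence the minimum with `0`. -/
lemma apply_le {s : ℝ} (hs : s ≤ 1) (h : IsProfileOn (Icc (min s 0) 1) y p) :
    y s ≤ 2 / 3 - s / 3 := by
  have h1 : y 1 ≤ 1 / 3 := by
    have := apply_add_one_le (s := 0) (h.mono (by
      rw [zero_add]; exact Icc_subset_Icc_left (min_le_right _ _)))
    simpa using this
  have hsub : Icc s 1 ⊆ Icc (min s 0) 1 := Icc_subset_Icc_left (min_le_left _ _)
  have := monotoneOn_of_hasDerivAt_nonneg (a := s) (b := 1)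
    (f := fun x => y x + 1 / 3 * x) (f' := fun x => p x + 1 / 3 * 1)
    (fun x hx => (h.1 x (hsub hx)).add ((hasDerivAt_id x).const_mul _))
    (fun x hx => by linarith [h.slope_ge x (hsub hx)]) ⟨le_rfl, hs⟩ ⟨hs, le_rfl⟩ hs
  simp only at this
  linarith

/-- The linear bound on `y` gives `p' ≤ const · e^{2s} e^{-2s/3}`, which is integrable at `-∞`. The
constant does not involve the left end `a`, so the estimate survives the limit; it later yields both
the asymptotics at `ρ = 0` and `f_t = O(r²)`. -/
lemma slope_le {s : ℝ} (ha : a ≤ s) (ha0 : a ≤ 0) (hs : s ≤ 1) (h : IsProfileOn (Icc a 1) y p)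
    (hpa : p a = -(1 / 3)) : p s ≤ -(1 / 3) + Real.exp 2 * Real.exp (4 / 3 * s) := by
  have hd : ∀ x : ℝ, HasDerivAt (fun x => Real.exp 2 * Real.exp (4 / 3 * x))
      (Real.exp 2 * (Real.exp (4 / 3 * x) * (4 / 3 * 1))) x := fun x =>
    (((hasDerivAt_id x).const_mul (4 / 3)).exp).const_mul _
  have hsub : Icc a s ⊆ Icc a 1 := Icc_subset_Icc_right hs
  have := monotoneOn_of_hasDerivAt_nonneg (a := a) (b := s)
    (fun x hx => (hd x).sub (h.2 x (hsub hx))) (fun x hx => by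
      have hy := apply_le (hx.2.trans hs) (h.mono (Icc_subset_Icc_left (le_min hx.1 ha0)))
      have h1 : Real.sinh (2 * y x) ≤ Real.exp (4 / 3 - 2 * x / 3) / 2 :=
        (sinh_le_exp _).trans (by gcongr; linarith)
      have h2 : Real.exp (2 * x) * Real.exp (4 / 3 - 2 * x / 3)
          = Real.exp (4 / 3) * Real.exp (4 / 3 * x) := by
        rw [← Real.exp_add, ← Real.exp_add]; ring_nf
      have h3 : Real.exp (4 / 3) ≤ Real.exp 2 := Real.exp_le_exp.2 (by norm_num)
      have h4 : Real.exp (2 * x) * Real.sinh (2 * y x)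
          ≤ Real.exp (2 * x) * (Real.exp (4 / 3 - 2 * x / 3) / 2) := by gcongr
      have h5 : Real.exp (4 / 3) * Real.exp (4 / 3 * x) ≤ Real.exp 2 * Real.exp (4 / 3 * x) := by
        gcongr
      have h6 : 0 < Real.exp 2 * Real.exp (4 / 3 * x) := by positivity
      linarith) ⟨le_rfl, ha⟩ ⟨ha, le_rfl⟩ ha
  simp only [Pi.sub_apply, hpa] at this
  have : 0 < Real.exp 2 * Real.exp (4 / 3 * a) := by positivity
  linarith

/-- Two solutions on an interval are close if they are close at the right end and have close
slopes at the left end. -/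
lemma sq_sub_le {a b : ℝ} {y₁ p₁ y₂ p₂ : ℝ → ℝ} (h₁ : IsProfileOn (Icc a b) y₁ p₁)
    (h₂ : IsProfileOn (Icc a b) y₂ p₂) {s : ℝ} (hs : s ∈ Icc a b) :
    (y₁ s - y₂ s) ^ 2 ≤ (y₁ b - y₂ b) ^ 2 + 2 * |y₁ a - y₂ a| * |p₁ a - p₂ a| * (b - a) := by
  have hprod : ∀ x ∈ Icc a b, HasDerivAt (fun x => (y₁ x - y₂ x) * (p₁ x - p₂ x)) _ x :=
    fun x hx => ((h₁.1 x hx).sub (h₂.1 x hx)).mul ((h₁.2 x hx).sub (h₂.2 x hx))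
  -- For the difference `d`, monotonicity of `sinh` gives `(d d')' ≥ 0`. Thus `(d²)' ≥ -2 |d(a)|
  -- |d'(a)|` on the interval, and integrating from `s` to `b` proves the claim.
  have hmono := monotoneOn_of_hasDerivAt_nonneg hprod (fun x hx => by
    have key : 0 ≤ (y₁ x - y₂ x) * (Real.sinh (2 * y₁ x) - Real.sinh (2 * y₂ x)) := by
      rcases le_total (y₁ x) (y₂ x) with h | h
      · exact mul_nonneg_of_nonpos_of_nonpos (sub_nonpos.2 h)
          (sub_nonpos.2 (Real.sinh_le_sinh.2 (by linarith)))
      · exact mul_nonneg (sub_nonneg.2 h) (sub_nonneg.2 (Real.sinh_le_sinh.2 (by linarith)))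
    have : 0 ≤ 1 / 2 * Real.exp (2 * x) := by positivity
    simp only [Pi.sub_apply]
    nlinarith [mul_nonneg this key, mul_self_nonneg (p₁ x - p₂ x)])
  have hab : a ≤ b := hs.1.trans hs.2
  have := monotoneOn_of_hasDerivAt_nonneg (a := a) (b := b)
    (f := fun x => (y₁ x - y₂ x) ^ 2 + 2 * |y₁ a - y₂ a| * |p₁ a - p₂ a| * x)
    (fun x hx => (((h₁.1 x hx).sub (h₂.1 x hx)).pow 2).add ((hasDerivAt_id x).const_mul _))
    (fun x hx => by
      have h1 := hmono ⟨le_rfl, hab⟩ hx hx.1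
      simp only at h1
      have h2 := neg_abs_le ((y₁ a - y₂ a) * (p₁ a - p₂ a))
      rw [abs_mul] at h2
      simp only [Pi.sub_apply, Nat.cast_ofNat, Nat.add_one_sub_one, pow_one]
      linarith) hs ⟨hab, le_rfl⟩ hs.2
  simp only at this
  have h3 : 0 ≤ 2 * |y₁ a - y₂ a| * |p₁ a - p₂ a| * (s - a) := by
    have := sub_nonneg.2 hs.1
    positivity
  linarith

/-- Closeness of two solutions controls their slopes. -/
lemma abs_slope_sub_le {s R ε : ℝ} {y₁ p₁ y₂ p₂ : ℝ → ℝ}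
    (h₁ : IsProfileOn (Icc s (s + 1)) y₁ p₁) (h₂ : IsProfileOn (Icc s (s + 1)) y₂ p₂)
    (hR₁ : ∀ x ∈ Icc s (s + 1), y₁ x ≤ R) (hR₂ : ∀ x ∈ Icc s (s + 1), y₂ x ≤ R)
    (hε : ∀ x ∈ Icc s (s + 1), |y₁ x - y₂ x| ≤ ε) :
    |p₁ s - p₂ s| ≤ (2 + Real.exp (2 * (s + 1)) * Real.cosh (2 * R)) * ε := by
  have hl : s ∈ Icc s (s + 1) := ⟨le_rfl, by linarith⟩
  have hr : s + 1 ∈ Icc s (s + 1) := ⟨by linarith, le_rfl⟩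
  -- At some `c` the slopes differ by at most `2 ε`, by the mean value theorem; the equation then
  -- controls the change of that difference between `s` and `c`.
  obtain ⟨c, hc, hce⟩ := exists_hasDerivAt_eq_slope (fun x => y₁ x - y₂ x)
    (fun x => p₁ x - p₂ x) (lt_add_one s)
    (fun x hx => ((h₁.1 x hx).sub (h₂.1 x hx)).continuousAt.continuousWithinAt)
    (fun x hx => (h₁.1 x ⟨hx.1.le, hx.2.le⟩).sub (h₂.1 x ⟨hx.1.le, hx.2.le⟩))
  have hc' : c ∈ Icc s (s + 1) := ⟨hc.1.le, hc.2.le⟩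
  have h1 : |p₁ c - p₂ c| ≤ 2 * ε := by
    rw [hce, add_sub_cancel_left, div_one]
    exact (abs_sub _ _).trans (by linarith [hε _ hl, hε _ hr])
  have hε0 : 0 ≤ ε := (abs_nonneg _).trans (hε s hl)
  set B := Real.exp (2 * (s + 1)) * Real.cosh (2 * R) with hB
  have hB0 : 0 ≤ B := mul_nonneg (Real.exp_pos _).le (Real.cosh_pos _).le
  have h2 := norm_image_sub_le_of_norm_deriv_le_segment' (a := s) (b := s + 1)
    (f := fun x => p₁ x - p₂ x) (C := B * ε)
    (fun x hx => ((h₁.2 x hx).sub (h₂.2 x hx)).hasDerivWithinAt) (fun x hx => by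
      have hx' : x ∈ Icc s (s + 1) := ⟨hx.1, hx.2.le⟩
      rw [← mul_sub, Real.norm_eq_abs, abs_mul, abs_of_pos (by positivity)]
      have h3 := abs_sinh_sub_sinh_le (R := 2 * R) (x := 2 * y₁ x) (y := 2 * y₂ x)
        (by rw [abs_of_nonneg (by linarith [h₁.nonneg x hx'])]; linarith [hR₁ x hx'])
        (by rw [abs_of_nonneg (by linarith [h₂.nonneg x hx'])]; linarith [hR₂ x hx'])
      rw [← mul_sub, abs_mul, abs_two] at h3
      have h4 : Real.exp (2 * x) ≤ Real.exp (2 * (s + 1)) :=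
        Real.exp_le_exp.2 (by linarith [hx.2])
      have h5 := (Real.cosh_pos (2 * R)).le
      calc _ ≤ 1 / 2 * Real.exp (2 * (s + 1)) * (Real.cosh (2 * R) * (2 * ε)) := by
            gcongr
            exact h3.trans (by have := hε x hx'; gcongr)
        _ = B * ε := by rw [hB]; ring) c hc'
  simp only [Real.norm_eq_abs] at h2
  have h3 : B * ε * (c - s) ≤ B * ε := by
    have : 0 ≤ B * ε := by positivity
    nlinarith [hc.2]
  have h4 : |p₁ s - p₂ s| ≤ |p₁ c - p₂ c| + |p₁ c - p₂ c - (p₁ s - p₂ s)| := by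
    have := abs_sub (p₁ c - p₂ c) (p₁ c - p₂ c - (p₁ s - p₂ s))
    rwa [sub_sub_cancel] at this
  linarith

end IsProfileOn

/-! ### Passage to the limit of infinite intervals -/

lemma exists_tendstoUniformlyOn_Icc {u : ℕ → ℝ → ℝ} {ε : ℕ → ℝ} (hε : Tendsto ε atTop (𝓝 0))
    (h : ∀ A : ℝ, ∃ C : ℝ, ∃ n₀ : ℕ, ∀ n ≥ n₀, ∀ m ≥ n, ∀ s ∈ Icc (-A) A,
      |u n s - u m s| ≤ C * ε n) :
    ∃ v : ℝ → ℝ, ∀ A : ℝ, TendstoUniformlyOn u v atTop (Icc (-A) A) := by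
  have hlim : ∀ s : ℝ, ∃ l, Tendsto (fun n => u n s) atTop (𝓝 l) := fun s => by
    obtain ⟨C, n₀, hC⟩ := h |s|
    have hb : Tendsto (fun n => C * ε (n + n₀)) atTop (𝓝 0) := by
      simpa using (hε.comp (tendsto_add_atTop_nat n₀)).const_mul C
    have hcs : CauchySeq fun n => u (n + n₀) s :=
      cauchySeq_of_le_tendsto_0' _ (fun n m hnm => hC (n + n₀) (by lia) (m + n₀) (by lia) s
        ⟨neg_abs_le s, le_abs_self s⟩) hb
    obtain ⟨l, hl⟩ := cauchySeq_tendsto_of_complete hcs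
    exact ⟨l, (tendsto_add_atTop_iff_nat n₀).1 hl⟩
  choose v hv using hlim
  refine ⟨v, fun A => Metric.tendstoUniformlyOn_iff.2 fun δ hδ => ?_⟩
  obtain ⟨C, n₀, hC⟩ := h A
  have hb : Tendsto (fun n => C * ε n) atTop (𝓝 0) := by simpa using hε.const_mul C
  filter_upwards [hb.eventually (gt_mem_nhds hδ), eventually_ge_atTop n₀] with n hn hn₀ s hs
  rw [dist_comm]
  refine lt_of_le_of_lt (le_of_tendsto ((tendsto_const_nhds (x := u n s)).dist (hv s)) ?_) hn
  filter_upwards [eventually_ge_atTop n] with m hm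
  exact hC n hn₀ m hm s hs

/-- The square of the distance between the solutions of two boundary value problems on intervals
containing `[-N, N]`. -/
def profileGap (N : ℝ) : ℝ :=
  Real.exp (-N) + 2 * (2 / 3 + N / 3) * (Real.exp 2 * Real.exp (-N)) * (2 * N)

lemma tendsto_profileGap : Tendsto profileGap atTop (𝓝 0) := by
  have h := fun k => Real.tendsto_pow_mul_exp_neg_atTop_nhds_zero k
  have := ((h 0).add (((h 1).const_mul (8 / 3 * Real.exp 2)).add
    ((h 2).const_mul (4 / 3 * Real.exp 2))))
  simp only [mul_zero, add_zero] at this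
  refine this.congr fun N => ?_
  rw [profileGap]; ring

/-- In `sq_sub_le` on `[-N, N]` the right end contributes `e^{-N}`, by `apply_add_one_le` (here `2 ≤
N` is needed). At the left end the heights are only bounded linearly in `N`, but by `slope_le` the
slopes differ by at most `e² e^{-N}`, and this wins. -/
lemma IsProfileOn.abs_sub_le_sqrt_profileGap {N M : ℝ} (hN : 2 ≤ N) (hNM : N ≤ M)
    {y₁ p₁ y₂ p₂ : ℝ → ℝ} (h₁ : IsProfileOn (Icc (-N) N) y₁ p₁)
    (h₂ : IsProfileOn (Icc (-M) M) y₂ p₂) (hy : y₁ N = 0) (hp₁ : p₁ (-N) = -(1 / 3))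
    (hp₂ : p₂ (-M) = -(1 / 3)) {s : ℝ} (hs : s ∈ Icc (-N) N) :
    |y₁ s - y₂ s| ≤ √(profileGap N) := by
  have hsub : Icc (-N) N ⊆ Icc (-M) M := Icc_subset_Icc (by linarith) hNM
  have hl : -N ∈ Icc (-N) N := ⟨le_rfl, by linarith⟩
  have hr : N ∈ Icc (-N) N := ⟨by linarith, le_rfl⟩
  rw [← Real.sqrt_sq_eq_abs]
  refine Real.sqrt_le_sqrt (((h₁.sq_sub_le (h₂.mono hsub) hs)).trans ?_)
  have e1 : y₂ N ≤ Real.exp (-N) := by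
    have := IsProfileOn.apply_add_one_le (s := N - 1) (y := y₂) (p := p₂) (h₂.mono (by
      rw [sub_add_cancel]; exact Icc_subset_Icc (by linarith) hNM))
    rw [sub_add_cancel] at this
    have h3 : Real.exp (-2 * (N - 1)) ≤ Real.exp (-N) := Real.exp_le_exp.2 (by linarith)
    linarith [Real.exp_pos (-N)]
  have e2 : (y₁ N - y₂ N) ^ 2 ≤ Real.exp (-N) := by
    have h0 := h₂.nonneg N (hsub hr)
    have h1 : Real.exp (-N) ≤ 1 := Real.exp_le_one_iff.2 (by linarith)
    rw [hy]; nlinarith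
  have hb : ∀ {y p : ℝ → ℝ}, IsProfileOn (Icc (-N) N) y p → y (-N) ≤ 2 / 3 + N / 3 :=
    fun {y p} h => by
      have := IsProfileOn.apply_le (s := -N) (by linarith)
        (h.mono (Icc_subset_Icc (le_min le_rfl (by linarith)) (by linarith)))
      linarith
  have e3 : |y₁ (-N) - y₂ (-N)| ≤ 2 / 3 + N / 3 := by
    have a1 := hb h₁
    have a2 := hb (h₂.mono hsub)
    have a3 := h₁.nonneg _ hl
    have a4 := h₂.nonneg _ (hsub hl)
    exact abs_le.2 ⟨by linarith, by linarith⟩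
  have e4 : |p₁ (-N) - p₂ (-N)| ≤ Real.exp 2 * Real.exp (-N) := by
    have a1 := h₂.slope_ge _ (hsub hl)
    have a2 := IsProfileOn.slope_le (a := -M) (s := -N) (by linarith) (by linarith) (by linarith)
      (h₂.mono (Icc_subset_Icc_right (by linarith))) hp₂
    have a3 : Real.exp (4 / 3 * -N) ≤ Real.exp (-N) := Real.exp_le_exp.2 (by linarith)
    have a4 : Real.exp 2 * Real.exp (4 / 3 * -N) ≤ Real.exp 2 * Real.exp (-N) := by gcongr
    have a5 : 0 < Real.exp 2 * Real.exp (-N) := by positivity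
    rw [hp₁]; exact abs_le.2 ⟨by linarith, by linarith⟩
  rw [profileGap, show N - -N = 2 * N by ring]
  gcongr

lemma IsProfileOn.apply_le_of_mem {A N : ℝ} (hA : 0 ≤ A) (hN : 1 ≤ N) (hAN : A ≤ N)
    {y p : ℝ → ℝ} (h : IsProfileOn (Icc (-N) N) y p) {s : ℝ} (hs : s ∈ Icc (-A) A) :
    y s ≤ 2 / 3 + A / 3 := by
  have h1 := IsProfileOn.apply_le (s := -A) (by linarith)
    (h.mono (Icc_subset_Icc (le_min (by linarith) (by linarith)) hN))
  have h2 := h.antitoneOn ⟨by linarith, by linarith⟩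
    ⟨by linarith [hs.1], by linarith [hs.2]⟩ hs.1
  linarith

/-- The fiducial profile as a function of `s = log ρ`. -/
lemma exists_profileOn_univ : ∃ y p : ℝ → ℝ, IsProfileOn univ y p ∧
    ∀ s ≤ 1, p s ≤ -(1 / 3) + Real.exp 2 * Real.exp (4 / 3 * s) := by
  choose y p h hyN hpN using fun n : ℕ =>
    exists_profileOn (N := (n : ℝ) + 2) (by linarith [(Nat.cast_nonneg n : (0 : ℝ) ≤ n)])
  have hn0 : ∀ n : ℕ, (0 : ℝ) ≤ n := fun n => n.cast_nonneg
  set ε : ℕ → ℝ := fun n => √(profileGap ((n : ℝ) + 2)) with hεdef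
  have hε : Tendsto ε atTop (𝓝 0) := by
    have h1 : Tendsto (fun n : ℕ => profileGap ((n : ℝ) + 2)) atTop (𝓝 0) :=
      tendsto_profileGap.comp (tendsto_atTop_add_const_right _ _ tendsto_natCast_atTop_atTop)
    simpa using h1.sqrt
  have hsub : ∀ {n m : ℕ}, n ≤ m →
      Icc (-((n : ℝ) + 2)) ((n : ℝ) + 2) ⊆ Icc (-((m : ℝ) + 2)) ((m : ℝ) + 2) := fun {n m} hnm => by
    have : (n : ℝ) ≤ m := Nat.cast_le.2 hnm
    exact Icc_subset_Icc (by linarith) (by linarith)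
  have hgap : ∀ n m : ℕ, n ≤ m → ∀ s ∈ Icc (-((n : ℝ) + 2)) ((n : ℝ) + 2), |y n s - y m s| ≤ ε n :=
    fun n m hnm s hs => IsProfileOn.abs_sub_le_sqrt_profileGap (by linarith [hn0 n])
      (by linarith [(Nat.cast_le.2 hnm : (n : ℝ) ≤ m)]) (h n) (h m) (hyN n) (hpN n) (hpN m) hs
  have hmem : ∀ {A s : ℝ} {n : ℕ}, ⌈A⌉₊ ≤ n → s ∈ Icc (-A - 1) (A + 1) →
      s ∈ Icc (-((n : ℝ) + 2)) ((n : ℝ) + 2) := fun {A s n} hn hs => by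
    have := Nat.ceil_le.1 hn
    exact ⟨by linarith [hs.1], by linarith [hs.2]⟩
  have hbd : ∀ {A s : ℝ} {n : ℕ}, ⌈A⌉₊ ≤ n → s ∈ Icc (-A - 1) (A + 1) →
      y n s ≤ 2 / 3 + (A + 1) / 3 := fun {A s n} hn hs => by
    have := Nat.ceil_le.1 hn
    exact (h n).apply_le_of_mem (by linarith [hs.1.trans hs.2]) (by linarith [hn0 n])
      (by linarith) ⟨by linarith [hs.1], hs.2⟩
  obtain ⟨Y, hY⟩ := exists_tendstoUniformlyOn_Icc (u := y) hε fun A => ⟨1, ⌈A⌉₊,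
    fun n hn m hm s hs => by
      rw [one_mul]
      exact hgap n m hm s (hmem hn ⟨by linarith [hs.1], by linarith [hs.2]⟩)⟩
  -- The slope comparison looks at `[s, s + 1]`, hence bounds on the larger interval up to `A + 1`.
  obtain ⟨P, hP⟩ := exists_tendstoUniformlyOn_Icc (u := p) hε fun A =>
    ⟨2 + Real.exp (2 * (A + 1)) * Real.cosh (2 * (2 / 3 + (A + 1) / 3)), ⌈A⌉₊,
    fun n hn m hm s hs => by
      have hI : Icc s (s + 1) ⊆ Icc (-A - 1) (A + 1) :=
        Icc_subset_Icc (by linarith [hs.1]) (by linarith [hs.2])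
      have hIn : Icc s (s + 1) ⊆ Icc (-((n : ℝ) + 2)) ((n : ℝ) + 2) := fun x hx => hmem hn (hI hx)
      refine (IsProfileOn.abs_slope_sub_le ((h n).mono hIn) ((h m).mono (hIn.trans (hsub hm)))
        (fun x hx => hbd hn (hI hx)) (fun x hx => hbd (hn.trans hm) (hI hx))
        (fun x hx => hgap n m hm x (hIn hx))).trans ?_
      have : 0 ≤ ε n := Real.sqrt_nonneg _
      have := (Real.cosh_pos (2 * (2 / 3 + (A + 1) / 3))).le
      gcongr
      exact hs.2⟩
  -- Locally uniform convergence of the second derivatives lets the equation for the slope pass to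
  -- the limit.
  obtain ⟨G, hG⟩ := exists_tendstoUniformlyOn_Icc
    (u := fun n s => 1 / 2 * Real.exp (2 * s) * Real.sinh (2 * y n s)) hε fun A =>
    ⟨Real.exp (2 * A) * Real.cosh (2 * (2 / 3 + (A + 1) / 3)), ⌈A⌉₊,
    fun n hn m hm s hs => by
      have hs' : s ∈ Icc (-A - 1) (A + 1) := ⟨by linarith [hs.1], by linarith [hs.2]⟩
      have h1 := hgap n m hm s (hmem hn hs')
      have h2 := (h n).nonneg s (hmem hn hs')
      have h3 := (h m).nonneg s (hmem (hn.trans hm) hs')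
      have h4 := hbd hn hs'
      have h5 := hbd (hn.trans hm) hs'
      have h6 := abs_sinh_sub_sinh_le (R := 2 * (2 / 3 + (A + 1) / 3)) (x := 2 * y n s)
        (y := 2 * y m s) (by rw [abs_of_nonneg (by linarith)]; linarith)
        (by rw [abs_of_nonneg (by linarith)]; linarith)
      rw [← mul_sub (2 : ℝ), abs_mul, abs_two] at h6
      rw [← mul_sub, abs_mul, abs_of_pos (by positivity)]
      have h7 := (Real.cosh_pos (2 * (2 / 3 + (A + 1) / 3))).le
      calc _ ≤ 1 / 2 * Real.exp (2 * A) *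
            (Real.cosh (2 * (2 / 3 + (A + 1) / 3)) * (2 * ε n)) := by
            gcongr
            · exact hs.2
            · exact h6.trans (by gcongr)
        _ = _ := by ring⟩
  have hself : ∀ s : ℝ, s ∈ Icc (-|s|) |s| := fun s => ⟨neg_abs_le s, le_abs_self s⟩
  have tY : ∀ s, Tendsto (fun n => y n s) atTop (𝓝 (Y s)) := fun s => (hY _).tendsto_at (hself s)
  have tP : ∀ s, Tendsto (fun n => p n s) atTop (𝓝 (P s)) := fun s => (hP _).tendsto_at (hself s)
  have hGeq : ∀ s, G s = 1 / 2 * Real.exp (2 * s) * Real.sinh (2 * Y s) := fun s =>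
    tendsto_nhds_unique ((hG _).tendsto_at (hself s))
      ((Real.continuous_sinh.continuousAt.tendsto.comp ((tY s).const_mul 2)).const_mul _)
  have hev : ∀ A : ℝ, ∀ᶠ n : ℕ in atTop, ∀ s ∈ Icc (-A) A,
      s ∈ Icc (-((n : ℝ) + 2)) ((n : ℝ) + 2) := fun A => by
    filter_upwards [eventually_ge_atTop ⌈A⌉₊] with n hn s hs
    exact hmem hn ⟨by linarith [hs.1], by linarith [hs.2]⟩
  have hIoo : ∀ s : ℝ, s ∈ Ioo (-(|s| + 1)) (|s| + 1) := fun s =>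
    ⟨by linarith [neg_abs_le s], by linarith [le_abs_self s]⟩
  refine ⟨Y, P, ⟨fun s _ => ?_, fun s _ => ?_, fun s _ => ?_, fun s _ => ?_, fun s _ => ?_⟩,
    fun s hs => ?_⟩
  · exact hasDerivAt_of_tendstoUniformlyOn isOpen_Ioo ((hP (|s| + 1)).mono Ioo_subset_Icc_self)
      ((hev (|s| + 1)).mono fun n hn x hx => (h n).1 x (hn x (Ioo_subset_Icc_self hx)))
      (fun x _ => tY x) (hIoo s)
  · rw [← hGeq]
    exact hasDerivAt_of_tendstoUniformlyOn isOpen_Ioo ((hG (|s| + 1)).mono Ioo_subset_Icc_self)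
      ((hev (|s| + 1)).mono fun n hn x hx => (h n).2 x (hn x (Ioo_subset_Icc_self hx)))
      (fun x _ => tP x) (hIoo s)
  · exact ge_of_tendsto (tY s) ((hev |s|).mono fun n hn => (h n).nonneg s (hn s (hself s)))
  · exact ge_of_tendsto (tP s) ((hev |s|).mono fun n hn => (h n).slope_ge s (hn s (hself s)))
  · exact le_of_tendsto (tP s) ((hev |s|).mono fun n hn => (h n).slope_nonpos s (hn s (hself s)))
  · refine le_of_tendsto (tP s) ((hev |s|).mono fun n hn => ?_)
    exact IsProfileOn.slope_le (hn s (hself s)).1 (by linarith [hn0 n]) hs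
      ((h n).mono (Icc_subset_Icc_right (by linarith [hn0 n]))) (hpN n)

/-! ### Asymptotics at both ends -/

/-- Comparison with `k = e^{-ρ}`, for which `k'' = (e^{2s} - e^s) k`. The Wronskian `y' k - y k'` is
nondecreasing and bounded above by a function tending to `0` at `+∞`, hence nonpositive; so `y / k`
decreases. -/
lemma IsProfileOn.isBigO_exp {y p : ℝ → ℝ} (h : IsProfileOn univ y p) :
    y =O[atTop] fun s => Real.exp (-Real.exp s) := by
  set k : ℝ → ℝ := fun s => Real.exp (-Real.exp s) with hk
  have hk0 : ∀ s, 0 < k s := fun s => Real.exp_pos _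
  have hdk : ∀ s, HasDerivAt k (k s * -Real.exp s) s := fun s =>
    ((Real.hasDerivAt_exp s).neg).exp
  have hdk2 : ∀ s, HasDerivAt (fun s => k s * -Real.exp s)
      (k s * -Real.exp s * -Real.exp s + k s * -Real.exp s) s := fun s =>
    (hdk s).mul (Real.hasDerivAt_exp s).neg
  have hdW : ∀ s, HasDerivAt (fun s => p s * k s - y s * (k s * -Real.exp s)) _ s := fun s =>
    ((h.2 s trivial).mul (hdk s)).sub ((h.1 s trivial).mul (hdk2 s))
  have hWm : Monotone fun s => p s * k s - y s * (k s * -Real.exp s) :=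
    monotone_of_hasDerivAt_nonneg hdW fun s => by
      have h1 := le_sinh (x := 2 * y s) (by linarith [h.nonneg s trivial])
      have h2 : Real.exp (2 * s) = Real.exp s * Real.exp s := by rw [← Real.exp_add]; ring_nf
      have h3 : 0 ≤ Real.exp s * Real.exp s * k s * (1 / 2 * Real.sinh (2 * y s) - y s) :=
        mul_nonneg (mul_nonneg (by positivity) (hk0 s).le) (by linarith)
      have h4 : 0 ≤ y s * (k s * Real.exp s) :=
        mul_nonneg (h.nonneg s trivial) (mul_nonneg (hk0 s).le (Real.exp_pos s).le)
      simp only [Pi.zero_apply]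
      rw [h2]; linarith
  have hy_anti : AntitoneOn y (Ici 0) := fun a ha b hb hab =>
    (h.mono (subset_univ (Icc a b))).antitoneOn ⟨le_rfl, hab⟩ ⟨hab, le_rfl⟩ hab
  have hk_lim : Tendsto k atTop (𝓝 0) :=
    Real.tendsto_exp_atBot.comp (tendsto_neg_atTop_atBot.comp Real.tendsto_exp_atTop)
  have hk'_lim : Tendsto (fun s => Real.exp s * k s) atTop (𝓝 0) := by
    have := (Real.tendsto_pow_mul_exp_neg_atTop_nhds_zero 1).comp Real.tendsto_exp_atTop
    simpa [Function.comp_def] using this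
  have hW_le : ∀ s, p s * k s - y s * (k s * -Real.exp s) ≤ 0 := fun s => by
    have hlim : Tendsto (fun s => y 0 * (Real.exp s * k s)) atTop (𝓝 0) := by
      simpa using hk'_lim.const_mul (y 0)
    refine ge_of_tendsto hlim ?_
    filter_upwards [eventually_ge_atTop s, eventually_ge_atTop 0] with x hx hx0
    refine (hWm hx).trans ?_
    have h1 : y x ≤ y 0 := hy_anti (mem_Ici.2 le_rfl) hx0 hx0
    have h2 : p x * k x ≤ 0 := mul_nonpos_of_nonpos_of_nonneg (h.slope_nonpos x trivial) (hk0 x).le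
    have h3 : y x * (Real.exp x * k x) ≤ y 0 * (Real.exp x * k x) := by
      have := (hk0 x).le
      gcongr
    simp only at h2 h3 ⊢
    linarith
  have hratio : Antitone fun s => y s / k s :=
    antitone_of_hasDerivAt_nonpos (fun s => (h.1 s trivial).div (hdk s) (hk0 s).ne')
      fun s => div_nonpos_of_nonpos_of_nonneg (hW_le s) (sq_nonneg _)
  refine Asymptotics.IsBigO.of_bound (y 0 / k 0) ?_
  filter_upwards [eventually_ge_atTop 0] with s hs
  rw [Real.norm_eq_abs, Real.norm_eq_abs, abs_of_nonneg (h.nonneg s trivial), abs_of_pos (hk0 s)]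
  exact (div_le_iff₀ (hk0 s)).1 (hratio hs)

/-- The function `y + s/3` is nondecreasing as the slope is at least `-1/3`, and it is bounded below
because its derivative is at most `C e^{4s/3}`, which is integrable at `-∞`. -/
lemma IsProfileOn.exists_tendsto_atBot {y p : ℝ → ℝ} (h : IsProfileOn univ y p) {C : ℝ}
    (hp : ∀ s ≤ 1, p s ≤ -(1 / 3) + C * Real.exp (4 / 3 * s)) :
    ∃ b, Tendsto (fun s => y s + s / 3) atBot (𝓝 b) := by
  have hd : ∀ s, HasDerivAt (fun s => y s + s / 3) (p s + 1 / 3) s := fun s =>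
    (h.1 s trivial).add ((hasDerivAt_id s).div_const 3)
  have hmono : Monotone fun s => y s + s / 3 := monotone_of_hasDerivAt_nonneg hd fun s => by
    simp only [Pi.zero_apply]; linarith [h.slope_ge s trivial]
  have he : ∀ x : ℝ, HasDerivAt (fun x => C * (3 / 4) * Real.exp (4 / 3 * x))
      (C * (3 / 4) * (Real.exp (4 / 3 * x) * (4 / 3 * 1))) x := fun x =>
    (((hasDerivAt_id x).const_mul (4 / 3)).exp).const_mul _
  have hC : 0 ≤ C := by
    have h1 := hp 0 zero_le_one
    have h2 := h.slope_ge 0 trivial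
    simp only [mul_zero, Real.exp_zero] at h1; linarith
  refine ⟨_, tendsto_atBot_ciInf hmono ⟨y 0 - C * (3 / 4), ?_⟩⟩
  rintro _ ⟨s, rfl⟩
  rcases le_total s 0 with hs | hs
  · have := antitoneOn_of_hasDerivAt_nonpos (a := s) (b := 0)
      (fun x _ => (hd x).sub (he x)) (fun x hx => by linarith [hp x (hx.2.trans zero_le_one)])
      ⟨le_rfl, hs⟩ ⟨hs, le_rfl⟩ hs
    simp only [Pi.sub_apply, mul_zero, Real.exp_zero, zero_div] at this
    have : 0 ≤ C * (3 / 4) * Real.exp (4 / 3 * s) := by positivity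
    dsimp only; linarith
  · have := hmono hs
    dsimp only at this ⊢; linarith

lemma IsProfileOn.isPainleveProfile {y p : ℝ → ℝ} (h : IsProfileOn univ y p) {C : ℝ}
    (hp : ∀ s ≤ 1, p s ≤ -(1 / 3) + C * Real.exp (4 / 3 * s)) :
    IsPainleveProfile fun ρ => y (Real.log ρ) := by
  have hd : ∀ ρ : ℝ, 0 < ρ → HasDerivAt (fun ρ => y (Real.log ρ)) (p (Real.log ρ) * ρ⁻¹) ρ :=
    fun ρ hρ => (h.1 _ trivial).comp ρ (Real.hasDerivAt_log hρ.ne')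
  have hd2 : ∀ ρ : ℝ, 0 < ρ → HasDerivAt (fun x => x * deriv (fun ρ => y (Real.log ρ)) x)
      (1 / 2 * Real.exp (2 * Real.log ρ) * Real.sinh (2 * y (Real.log ρ)) * ρ⁻¹) ρ :=
    fun ρ hρ => by
      refine ((h.2 _ trivial).comp ρ (Real.hasDerivAt_log hρ.ne')).congr_of_eventuallyEq ?_
      filter_upwards [lt_mem_nhds hρ] with x hx
      rw [(hd x hx).deriv, Function.comp_apply]; field_simp
  refine ⟨fun ρ hρ => (hd ρ hρ).differentiableAt, fun ρ hρ => (hd2 ρ hρ).differentiableAt,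
    fun ρ hρ => ?_, ?_, ?_, ?_⟩
  · rw [(hd2 ρ hρ).deriv, mul_comm (2 : ℝ) (Real.log ρ), Real.exp_mul, Real.exp_log hρ]
    norm_cast
    field_simp
  · obtain ⟨b, hb⟩ := h.exists_tendsto_atBot hp
    -- With `a₀ = e^{-b}` one has `log (a₀ ρ^{1/3}) = s/3 - b`.
    refine ⟨Real.exp (-b), Real.exp_pos _, ?_⟩
    have h1 := (hb.comp Real.tendsto_log_nhdsGT_zero).sub_const b
    rw [sub_self] at h1
    refine h1.congr' ?_
    filter_upwards [self_mem_nhdsWithin] with ρ hρ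
    have hρ : 0 < ρ := hρ
    rw [Real.log_mul (Real.exp_pos _).ne' (Real.rpow_pos_of_pos hρ _).ne', Real.log_exp,
      Real.log_rpow hρ, Function.comp_apply]
    ring
  · have := h.isBigO_exp.comp_tendsto Real.tendsto_log_atTop
    refine this.congr' (EventuallyEq.rfl) ?_
    filter_upwards [eventually_gt_atTop 0] with ρ hρ
    rw [Function.comp_apply, Real.exp_log hρ]
  · intro a ha b hb hab
    have hl := Real.log_le_log ha hab
    exact (h.mono (subset_univ (Icc (Real.log a) (Real.log b)))).antitoneOn
      ⟨le_rfl, hl⟩ ⟨hl, le_rfl⟩ hl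

/-! ### Uniqueness of the profile -/

/-- A real function on the line whose product with its derivative is nondecreasing and which
converges at both ends is constant of square zero when the limit at `+∞` vanishes. -/
lemma eq_zero_of_monotone_mul_deriv {d e : ℝ → ℝ} (hd : ∀ s, HasDerivAt d (e s) s)
    (hm : Monotone fun s => d s * e s) {l : ℝ} (hl : Tendsto d atBot (𝓝 l))
    (hr : Tendsto d atTop (𝓝 0)) (s : ℝ) : d s = 0 := by
  have hsq : ∀ s, HasDerivAt (fun s => d s ^ 2) (2 * (d s * e s)) s := fun s => by
    simpa [mul_assoc, Pi.pow_def] using (hd s).pow 2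
  have hlin : ∀ c s, HasDerivAt (fun s => d s ^ 2 - 2 * c * s) (2 * (d s * e s) - 2 * c * 1) s :=
    fun c s => (hsq s).sub ((hasDerivAt_id s).const_mul _)
  have hr2 : Tendsto (fun s => d s ^ 2) atTop (𝓝 0) := by simpa using hr.pow 2
  -- A positive value of `d d'` would persist to the right and make `d²` grow at least linearly. The
  -- next step is its mirror image at `-∞`.
  have h1 : ∀ s, d s * e s ≤ 0 := fun s => by
    by_contra! hc
    have hle : ∀ x ≥ s, d s ^ 2 - 2 * (d s * e s) * s + 2 * (d s * e s) * x ≤ d x ^ 2 :=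
      fun x hx => by
        have := monotoneOn_of_hasDerivAt_nonneg (a := s) (b := x)
          (fun z _ => hlin (d s * e s) z) (fun z hz => by
            have := hm hz.1
            dsimp only at this; linarith) ⟨le_rfl, hx⟩ ⟨hx, le_rfl⟩ hx
        dsimp only at this; linarith
    have : Tendsto (fun x => d x ^ 2) atTop atTop := by
      refine tendsto_atTop_mono' _ ((eventually_ge_atTop s).mono hle) ?_
      exact tendsto_atTop_add_const_left _ _ (tendsto_id.const_mul_atTop (by linarith))
    exact not_tendsto_nhds_of_tendsto_atTop this _ hr2
  have h2 : ∀ s, 0 ≤ d s * e s := fun s => by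
    by_contra! hc
    have hle : ∀ x ≤ s, d s ^ 2 - 2 * (d s * e s) * s + 2 * (d s * e s) * x ≤ d x ^ 2 :=
      fun x hx => by
        have := antitoneOn_of_hasDerivAt_nonpos (a := x) (b := s)
          (fun z _ => hlin (d s * e s) z) (fun z hz => by
            have := hm hz.2
            dsimp only at this; linarith) ⟨le_rfl, hx⟩ ⟨hx, le_rfl⟩ hx
        dsimp only at this; linarith
    have : Tendsto (fun x => d x ^ 2) atBot atTop := by
      refine tendsto_atTop_mono' _ ((eventually_le_atBot s).mono hle) ?_
      exact tendsto_atTop_add_const_left _ _ (tendsto_id.const_mul_atBot_of_neg (by linarith))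
    exact not_tendsto_nhds_of_tendsto_atTop this _ (hl.pow 2)
  have hconst : ∀ x, d x ^ 2 = d s ^ 2 := fun x =>
    is_const_of_deriv_eq_zero (fun x => (hsq x).differentiableAt)
      (fun x => by rw [(hsq x).deriv, le_antisymm (h1 x) (h2 x), mul_zero]) x s
  have := tendsto_nhds_unique (tendsto_const_nhds.congr fun x => (hconst x).symm) hr2
  exact pow_eq_zero_iff two_ne_zero |>.1 this

/-- In the difference the singular parts `-s/3` cancel, so it has a finite limit at `-∞` even if the
two constants `a₀` are not known to agree. Monotonicity of `sinh` does the rest. -/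
lemma IsPainleveProfile.eqOn {ψ χ : ℝ → ℝ} (hψ : IsPainleveProfile ψ) (hχ : IsPainleveProfile χ) :
    EqOn χ ψ (Ioi 0) := by
  have key : ∀ {φ : ℝ → ℝ}, IsPainleveProfile φ →
      (∀ s, HasDerivAt (fun s => φ (Real.exp s)) (Real.exp s * deriv φ (Real.exp s)) s) ∧
      (∀ s, HasDerivAt (fun s => Real.exp s * deriv φ (Real.exp s))
        (1 / 2 * Real.exp s ^ 2 * Real.sinh (2 * φ (Real.exp s))) s) ∧
      (∃ b, Tendsto (fun s => φ (Real.exp s) + s / 3) atBot (𝓝 b)) ∧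
      Tendsto (fun s => φ (Real.exp s)) atTop (𝓝 0) := fun {φ} hφ => by
    refine ⟨fun s => ?_, fun s => ?_, ?_, ?_⟩
    · have := (hφ.differentiableAt _ (Real.exp_pos s)).hasDerivAt.comp s (Real.hasDerivAt_exp s)
      rwa [mul_comm] at this
    · have := (hφ.differentiableAt_deriv _ (Real.exp_pos s)).hasDerivAt.comp s
        (Real.hasDerivAt_exp s)
      rwa [mul_comm, hφ.ode _ (Real.exp_pos s)] at this
    · obtain ⟨a, ha, hlim⟩ := hφ.near_zero
      have he : Tendsto Real.exp atBot (𝓝[>] 0) := tendsto_nhdsWithin_iff.2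
        ⟨Real.tendsto_exp_atBot, Eventually.of_forall fun s => Real.exp_pos s⟩
      refine ⟨0 - Real.log a, ((hlim.comp he).sub_const (Real.log a)).congr fun s => ?_⟩
      rw [Function.comp_apply, Real.log_mul ha.ne' (Real.rpow_pos_of_pos (Real.exp_pos s) _).ne',
        Real.log_rpow (Real.exp_pos s), Real.log_exp]
      ring
    · have h0 : Tendsto φ atTop (𝓝 0) := hφ.decay.trans_tendsto
        (Real.tendsto_exp_atBot.comp tendsto_neg_atTop_atBot)
      exact h0.comp Real.tendsto_exp_atTop
  obtain ⟨a1, a2, ⟨b, a3⟩, a4⟩ := key hψ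
  obtain ⟨c1, c2, ⟨b', c3⟩, c4⟩ := key hχ
  intro ρ hρ
  have := eq_zero_of_monotone_mul_deriv (fun s => (c1 s).sub (a1 s))
    (monotone_of_hasDerivAt_nonneg
      (fun s => ((c1 s).sub (a1 s)).mul ((c2 s).sub (a2 s))) fun s => by
        simp only [Pi.zero_apply, Pi.sub_apply]
        have key : 0 ≤ (χ (Real.exp s) - ψ (Real.exp s)) *
            (Real.sinh (2 * χ (Real.exp s)) - Real.sinh (2 * ψ (Real.exp s))) := by
          rcases le_total (χ (Real.exp s)) (ψ (Real.exp s)) with h | h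
          · exact mul_nonneg_of_nonpos_of_nonpos (sub_nonpos.2 h)
              (sub_nonpos.2 (Real.sinh_le_sinh.2 (by linarith)))
          · exact mul_nonneg (sub_nonneg.2 h) (sub_nonneg.2 (Real.sinh_le_sinh.2 (by linarith)))
        nlinarith [mul_nonneg (show 0 ≤ 1 / 2 * Real.exp s ^ 2 by positivity) key,
          mul_self_nonneg (Real.exp s * deriv χ (Real.exp s) - Real.exp s * deriv ψ (Real.exp s))])
    (l := b' - b) ((c3.sub a3).congr fun s => by simp only [Pi.sub_apply]; ring)
    ((sub_zero (0 : ℝ)) ▸ c4.sub a4) (Real.log ρ)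
  simp only [Pi.sub_apply, Real.exp_log (show 0 < ρ from hρ)] at this
  linarith

/-! ### Square integrable sections and weak derivatives -/

instance : IsFiniteMeasure discMeasure :=
  ⟨by rw [Measure.restrict_apply_univ]; exact measure_ball_lt_top⟩

lemma ae_disc {P : ℂ → Prop} (h : ∀ z ∈ Metric.ball (0 : ℂ) 1, P z) : ∀ᵐ z ∂discMeasure, P z :=
  ae_restrict_of_forall_mem Metric.isOpen_ball.measurableSet h

lemma ae_disc_ne_zero {P : ℂ → Prop} (h : ∀ z ∈ Metric.ball (0 : ℂ) 1, z ≠ 0 → P z) :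
    ∀ᵐ z ∂discMeasure, P z := by
  have h0 : ∀ᵐ z ∂discMeasure, z ≠ 0 :=
    ae_restrict_of_ae (measure_eq_zero_iff_ae_notMem.1 (measure_singleton (0 : ℂ)))
  filter_upwards [h0, ae_disc (P := fun z => z ≠ 0 → P z) h] with z h1 h2 using h2 h1

lemma exists_bound_on_disc {E : Type*} [NormedAddCommGroup E] {F : ℂ → E} (hF : Continuous F) :
    ∃ C, 0 ≤ C ∧ ∀ z ∈ Metric.ball (0 : ℂ) 1, ‖F z‖ ≤ C := by
  obtain ⟨C, hC⟩ := (isCompact_closedBall (0 : ℂ) 1).exists_bound_of_continuousOn hF.continuousOn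
  exact ⟨C, (norm_nonneg _).trans (hC 0 (by simp)), fun z hz => hC z (Metric.ball_subset_closedBall hz)⟩

lemma memLp_of_continuous {E : Type*} [NormedAddCommGroup E] {F : ℂ → E}
    (hF : Continuous F) (p : ℝ≥0∞) : MemLp F p discMeasure := by
  obtain ⟨C, -, hC⟩ := exists_bound_on_disc hF
  have : SecondCountableTopologyEither ℂ E := inferInstance
  exact MemLp.of_bound hF.aestronglyMeasurable C (ae_disc hC)

lemma integrable_of_continuous {E : Type*} [NormedAddCommGroup E] {F : ℂ → E}
    (hF : Continuous F) : Integrable F discMeasure :=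
  memLp_one_iff_integrable.1 (memLp_of_continuous hF 1)

/-- The class in `L²` of a continuous section. -/
def toL2 (F : ℂ → Fiber) (hF : Continuous F) : L2Disc := (memLp_of_continuous hF 2).toLp F

lemma coe_toL2 (F : ℂ → Fiber) (hF : Continuous F) : toL2 F hF =ᵐ[discMeasure] F :=
  MemLp.coeFn_toLp _

lemma integrable_smul_L2 {θ : ℂ → ℝ} (hθ : MemLp θ 2 discMeasure) (u : L2Disc) :
    Integrable (fun z => θ z • u z) discMeasure :=
  memLp_one_iff_integrable.1 ((Lp.memLp u).smul (r := 1) hθ)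

/-- Weak derivatives are defined with scalar test functions and vector valued integrals; splitting
into coordinates turns this into an inner product with a test section. -/
lemma inner_eq_sum_integral {χ : ℂ → Fiber} (hχ : Continuous χ) (u : L2Disc) :
    ⟪toL2 χ hχ, u⟫_ℝ =
      ∑ k, ⟪EuclideanSpace.single k (1 : ℝ), ∫ z, χ z k • u z ∂discMeasure⟫_ℝ := by
  have hk : ∀ k, Continuous fun z => χ z k := fun k => by fun_prop
  rw [L2.inner_def]
  simp_rw [← integral_inner (integrable_smul_L2 (memLp_of_continuous (hk _) 2) u)]
  rw [← integral_finsetSum _ fun k _ =>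
    (integrable_smul_L2 (memLp_of_continuous (hk k) 2) u).const_inner _]
  refine integral_congr_ae ?_
  filter_upwards [coe_toL2 χ hχ] with z hz
  rw [hz, PiLp.inner_apply]
  refine Finset.sum_congr rfl fun k _ => ?_
  rw [EuclideanSpace.inner_single_left]
  simp [mul_comm]

lemma contDiff_test {E : Type*} [NormedAddCommGroup E] [NormedSpace ℝ E] (χ : 𝓓(disc, E)) :
    ContDiff ℝ ∞ χ := χ.contDiff

lemma contDiff_fderiv_dir {E : Type*} [NormedAddCommGroup E] [NormedSpace ℝ E] {F : ℂ → E}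
    (hF : ContDiff ℝ ∞ F) (i : Fin 2) : ContDiff ℝ ∞ fun z => fderiv ℝ F z (dir i) :=
  (hF.fderiv_right (m := ∞) (by simp)).clm_apply contDiff_const

lemma continuous_fderiv_dir {E : Type*} [NormedAddCommGroup E] [NormedSpace ℝ E] {F : ℂ → E}
    (hF : ContDiff ℝ ∞ F) (i : Fin 2) : Continuous fun z => fderiv ℝ F z (dir i) :=
  (contDiff_fderiv_dir hF i).continuous

/-- Triples `(u, u_x, u_y)` of square integrable sections. -/
abbrev Sob : Type := PiLp 2 fun _ : Fin 3 => L2Disc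

/-- The triple formed by a smooth section and its derivatives. -/
def jet (F : ℂ → Fiber) (hF : ContDiff ℝ ∞ F) : Sob :=
  WithLp.toLp 2 (Fin.cons (toL2 F hF.continuous) fun i => toL2 _ (continuous_fderiv_dir hF i))

@[simp] lemma jet_zero (F : ℂ → Fiber) (hF : ContDiff ℝ ∞ F) : jet F hF 0 = toL2 F hF.continuous :=
  rfl

@[simp] lemma jet_succ (F : ℂ → Fiber) (hF : ContDiff ℝ ∞ F) (i : Fin 2) :
    jet F hF i.succ = toL2 _ (continuous_fderiv_dir hF i) := rfl

lemma toL2_add {F G : ℂ → Fiber} (hF : Continuous F) (hG : Continuous G) :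
    toL2 (fun z => F z + G z) (hF.add hG) = toL2 F hF + toL2 G hG := rfl

lemma toL2_smul {F : ℂ → Fiber} (hF : Continuous F) (c : ℝ) :
    toL2 (fun z => c • F z) (hF.const_smul c) = c • toL2 F hF := rfl

lemma toL2_congr {F G : ℂ → Fiber} (hF : Continuous F) (hG : Continuous G) (h : ∀ z, F z = G z) :
    toL2 F hF = toL2 G hG := by
  obtain rfl : F = G := funext h
  rfl

lemma sob_ext {U W : Sob} (h0 : U 0 = W 0) (h1 : ∀ i : Fin 2, U i.succ = W i.succ) : U = W := by
  ext1 k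
  refine Fin.cases h0 h1 k

/-- The jets of test sections. -/
def testJet : 𝓓(disc, Fiber) →ₗ[ℝ] Sob where
  toFun χ := jet χ (contDiff_test χ)
  map_add' χ η := by
    have hd : ∀ {χ : 𝓓(disc, Fiber)} z, DifferentiableAt ℝ χ z := fun {χ} z =>
      (contDiff_test χ).differentiable (by simp) z
    refine sob_ext (toL2_add (contDiff_test χ).continuous (contDiff_test η).continuous) fun i => ?_
    simp only [jet_succ, PiLp.add_apply]
    rw [← toL2_add]
    refine toL2_congr _ _ fun z => ?_
    rw [show (⇑(χ + η) : ℂ → Fiber) = ⇑χ + ⇑η from rfl, fderiv_add (hd z) (hd z)]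
    rfl
  map_smul' c χ := by
    refine sob_ext (toL2_smul (contDiff_test χ).continuous c) fun i => ?_
    simp only [jet_succ, PiLp.smul_apply, RingHom.id_apply]
    rw [← toL2_smul]
    refine toL2_congr _ _ fun z => ?_
    rw [show (⇑(c • χ) : ℂ → Fiber) = c • ⇑χ from rfl,
      fderiv_const_smul ((contDiff_test χ).differentiable (by simp) z)]
    rfl

lemma testJet_apply (χ : 𝓓(disc, Fiber)) : testJet χ = jet χ (contDiff_test χ) := rfl

lemma fderiv_coord {F : ℂ → Fiber} (hF : ContDiff ℝ ∞ F) (k : Fin 3) (z e : ℂ) :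
    fderiv ℝ (fun z => F z k) z e = fderiv ℝ F z e k := by
  have := ((EuclideanSpace.proj k : Fiber →L[ℝ] ℝ).hasFDerivAt.comp z
    (hF.differentiable (by simp) z).hasFDerivAt).fderiv
  exact congrArg (fun L : ℂ →L[ℝ] ℝ => L e) this

/-- Weak derivatives can be tested against sections in the `L²` inner product. -/
lemma hasWeakDeriv_iff {i : Fin 2} {u g : L2Disc} :
    HasWeakDeriv i u g ↔
      ∀ χ : 𝓓(disc, Fiber), ⟪testJet χ i.succ, u⟫_ℝ = -⟪testJet χ 0, g⟫_ℝ := by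
  constructor
  · intro h χ
    simp only [testJet_apply, jet_succ, jet_zero, inner_eq_sum_integral]
    rw [← Finset.sum_neg_distrib]
    refine Finset.sum_congr rfl fun k _ => ?_
    have := h (TestFunction.postcompCLM (EuclideanSpace.proj k : Fiber →L[ℝ] ℝ) χ)
    have e : ⇑(TestFunction.postcompCLM (EuclideanSpace.proj k : Fiber →L[ℝ] ℝ) χ)
        = fun z => χ z k := rfl
    rw [e] at this
    simp only [fderiv_coord (contDiff_test χ)] at this
    rw [this, inner_neg_right]
  · intro h χ
    refine ext_inner_left ℝ fun c => ?_
    -- The test sections `χ c` with constant `c` recover the vector valued identity.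
    have := h (TestFunction.postcompCLM ((ContinuousLinearMap.id ℝ ℝ).smulRight c) χ)
    have e : ⇑(TestFunction.postcompCLM ((ContinuousLinearMap.id ℝ ℝ).smulRight c) χ)
        = fun z => χ z • c := rfl
    have hfd : ∀ z, fderiv ℝ (fun z => χ z • c) z (dir i) = fderiv ℝ χ z (dir i) • c := fun z => by
      rw [fderiv_smul_const ((contDiff_test χ).differentiable (by simp) z)]; rfl
    have hi : ∀ {θ : ℂ → ℝ} (hθ : Continuous θ) (hθc : Continuous fun z => θ z • c) (w : L2Disc),
        ⟪toL2 (fun z => θ z • c) hθc, w⟫_ℝ = ⟪c, ∫ z, θ z • w z ∂discMeasure⟫_ℝ :=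
      fun {θ} hθ hθc w => by
        rw [L2.inner_def, ← integral_inner (integrable_smul_L2 (memLp_of_continuous hθ 2) w)]
        refine integral_congr_ae ?_
        filter_upwards [coe_toL2 _ hθc] with z hz
        rw [hz, real_inner_smul_left, real_inner_smul_right]
    have h1 := hi (continuous_fderiv_dir (contDiff_test χ) i)
      ((continuous_fderiv_dir (contDiff_test χ) i).smul continuous_const) u
    have h2 := hi (contDiff_test χ).continuous
      ((contDiff_test χ).continuous.smul continuous_const) g
    rw [inner_neg_right, ← h1, ← h2]
    rw [testJet_apply, jet_succ, jet_zero] at this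
    rw [← toL2_congr _ _ hfd]
    exact this

/-- The class of a test section. -/
lemma eq_zero_of_forall_inner_test {g : L2Disc}
    (h : ∀ χ : 𝓓(disc, Fiber), ⟪testJet χ 0, g⟫_ℝ = 0) : g = 0 := by
  have hloc : LocallyIntegrableOn (g : ℂ → Fiber) (disc : Set ℂ) volume :=
    IntegrableOn.locallyIntegrableOn ((Lp.memLp g).integrable one_le_two)
  have := disc.isOpen.ae_eq_zero_of_integral_contDiff_smul_eq_zero hloc fun θ h1 h2 h3 => by
    have e : ∫ z, θ z • g z = ∫ z, θ z • g z ∂discMeasure := by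
      refine (setIntegral_eq_integral_of_forall_compl_eq_zero fun z hz => ?_).symm
      rw [image_eq_zero_of_notMem_tsupport fun hz' => hz (h3 hz'), zero_smul]
    rw [e]
    refine ext_inner_left ℝ fun c => ?_
    rw [inner_zero_right, ← integral_inner
      (integrable_smul_L2 (memLp_of_continuous h1.continuous 2) g)]
    let η : 𝓓(disc, ℝ) := ⟨θ, h1, h2, h3⟩
    have := h (TestFunction.postcompCLM ((ContinuousLinearMap.id ℝ ℝ).smulRight c) η)
    rw [testJet_apply, jet_zero, L2.inner_def] at this
    rw [← this]
    refine integral_congr_ae ?_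
    filter_upwards [coe_toL2 _ (contDiff_test
      (TestFunction.postcompCLM ((ContinuousLinearMap.id ℝ ℝ).smulRight c) η)).continuous] with z hz
    rw [hz, real_inner_smul_right, ← real_inner_smul_left]
    rfl
  rw [Lp.eq_zero_iff_ae_eq_zero]
  exact (ae_restrict_iff' disc.isOpen.measurableSet).2 this

lemma HasWeakDeriv.unique {i : Fin 2} {u g g' : L2Disc} (h : HasWeakDeriv i u g)
    (h' : HasWeakDeriv i u g') : g = g' := by
  refine sub_eq_zero.1 (eq_zero_of_forall_inner_test fun χ => ?_)
  rw [inner_sub_right]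
  linarith [hasWeakDeriv_iff.1 h χ, hasWeakDeriv_iff.1 h' χ]

lemma HasWeakDeriv.weakDeriv_eq {i : Fin 2} {u g : L2Disc} (h : HasWeakDeriv i u g) :
    weakDeriv i u = g := by
  have hex : ∃ g, HasWeakDeriv i u g := ⟨g, h⟩
  rw [weakDeriv, dif_pos hex]
  exact hex.choose_spec.unique h

lemma MemH1.hasWeakDeriv {u : L2Disc} (h : MemH1 u) (i : Fin 2) :
    HasWeakDeriv i u (weakDeriv i u) := by
  obtain ⟨g, hg⟩ := h i
  rwa [hg.weakDeriv_eq]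

lemma HasWeakDeriv.add {i : Fin 2} {u g v k : L2Disc} (h : HasWeakDeriv i u g)
    (h' : HasWeakDeriv i v k) : HasWeakDeriv i (u + v) (g + k) :=
  hasWeakDeriv_iff.2 fun χ => by
    rw [inner_add_right, inner_add_right, hasWeakDeriv_iff.1 h χ, hasWeakDeriv_iff.1 h' χ]; ring

/-- Weak differentiation is a closed operator, as both sides of the tested identity are continuous.
Derivatives of nonsmooth sections are obtained from smooth approximations through this. -/
lemma HasWeakDeriv.of_tendsto {i : Fin 2} {u g : L2Disc} {un gn : ℕ → L2Disc}
    (h : ∀ n, HasWeakDeriv i (un n) (gn n)) (hu : Tendsto un atTop (𝓝 u))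
    (hg : Tendsto gn atTop (𝓝 g)) : HasWeakDeriv i u g :=
  hasWeakDeriv_iff.2 fun χ => tendsto_nhds_unique
    ((tendsto_const_nhds (x := testJet χ i.succ)).inner hu)
    (((tendsto_const_nhds (x := testJet χ 0)).inner hg).neg.congr fun n =>
      (hasWeakDeriv_iff.1 (h n) χ).symm)

lemma hasWeakDeriv_toL2 {F : ℂ → Fiber} (hF : ContDiff ℝ ∞ F) (i : Fin 2) :
    HasWeakDeriv i (toL2 F hF.continuous) (toL2 _ (continuous_fderiv_dir hF i)) := by
  intro χ
  have hχ := contDiff_test χ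
  have hcont := continuous_fderiv_dir hχ i
  have hsupp : HasCompactSupport fun z => fderiv ℝ χ z (dir i) :=
    χ.hasCompactSupport.fderiv_apply (𝕜 := ℝ) (dir i)
  have h0 : ∀ z, z ∉ (disc : Set ℂ) → z ∉ tsupport χ := fun z hz hz' => hz (χ.tsupport_subset hz')
  have e1 : ∫ z, fderiv ℝ χ z (dir i) • toL2 F hF.continuous z ∂discMeasure
      = ∫ z, fderiv ℝ χ z (dir i) • F z := by
    rw [← setIntegral_eq_integral_of_forall_compl_eq_zero (s := (disc : Set ℂ))
      (f := fun z => fderiv ℝ χ z (dir i) • F z) fun z hz => ?_]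
    · refine integral_congr_ae ?_
      filter_upwards [coe_toL2 F hF.continuous] with z hz
      rw [hz]
    · have : fderiv ℝ χ z = 0 := image_eq_zero_of_notMem_tsupport fun h =>
        h0 z hz (tsupport_fderiv_subset ℝ h)
      simp [this]
  have e2 : ∫ z, χ z • toL2 _ (continuous_fderiv_dir hF i) z ∂discMeasure
      = ∫ z, χ z • fderiv ℝ F z (dir i) := by
    rw [← setIntegral_eq_integral_of_forall_compl_eq_zero (s := (disc : Set ℂ))
      (f := fun z => χ z • fderiv ℝ F z (dir i)) fun z hz => ?_]
    · refine integral_congr_ae ?_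
      filter_upwards [coe_toL2 _ (continuous_fderiv_dir hF i)] with z hz
      rw [hz]
    · simp [image_eq_zero_of_notMem_tsupport (h0 z hz)]
  rw [e1, e2, integral_smul_fderiv_eq_neg_fderiv_smul_of_integrable, neg_neg]
  · exact (hcont.smul hF.continuous).integrable_of_hasCompactSupport hsupp.smul_right
  · exact (hχ.continuous.smul (continuous_fderiv_dir hF i)).integrable_of_hasCompactSupport
      χ.hasCompactSupport.smul_right
  · exact (hχ.continuous.smul hF.continuous).integrable_of_hasCompactSupport
      χ.hasCompactSupport.smul_right
  · exact fun z _ => hχ.differentiable (by simp) z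
  · exact fun z _ => hF.differentiable (by simp) z

lemma norm_sq_eq_integral (f : L2Disc) : ‖f‖ ^ 2 = ∫ z, ‖f z‖ ^ 2 ∂discMeasure := by
  rw [← real_inner_self_eq_norm_sq, L2.inner_def]
  simp only [real_inner_self_eq_norm_sq]

lemma tendsto_L2_of_dominated {F : ℕ → L2Disc} {f : L2Disc} {B : ℂ → ℝ}
    (hB : Integrable (fun z => B z ^ 2) discMeasure)
    (hb : ∀ n, ∀ᵐ z ∂discMeasure, ‖F n z - f z‖ ≤ B z)
    (hl : ∀ᵐ z ∂discMeasure, Tendsto (fun n => F n z) atTop (𝓝 (f z))) :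
    Tendsto F atTop (𝓝 f) := by
  rw [tendsto_iff_norm_sub_tendsto_zero]
  have h : Tendsto (fun n => ‖F n - f‖ ^ 2) atTop (𝓝 0) := by
    simp_rw [norm_sq_eq_integral]
    rw [show (0 : ℝ) = ∫ _, (0 : ℝ) ∂discMeasure by simp]
    refine tendsto_integral_of_dominated_convergence (fun z => B z ^ 2)
      (fun n => ((Lp.aestronglyMeasurable _).norm.pow 2)) hB (fun n => ?_) ?_
    · filter_upwards [hb n, Lp.coeFn_sub (F n) f] with z h1 h2
      rw [h2, Pi.sub_apply, norm_pow, norm_norm]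
      gcongr
    · have h3 : ∀ᵐ z ∂discMeasure, ∀ n, (F n - f : L2Disc) z = F n z - f z :=
        ae_all_iff.2 fun n => Lp.coeFn_sub (F n) f
      filter_upwards [hl, h3] with z h1 h2
      simp_rw [h2]
      have := (tendsto_iff_norm_sub_tendsto_zero.1 h1).pow 2
      simpa using this
  have := h.sqrt
  simpa using this

/-! ### The space `H¹₀` -/

/-- The closure of the jets of test sections. -/
def H10 : Submodule ℝ Sob := (LinearMap.range testJet).topologicalClosure

lemma testJet_mem_H10 (χ : 𝓓(disc, Fiber)) : testJet χ ∈ H10 :=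
  Submodule.le_topologicalClosure _ (LinearMap.mem_range_self _ χ)

lemma isClosed_H10 : IsClosed (H10 : Set Sob) := Submodule.isClosed_topologicalClosure _

instance : CompleteSpace H10 := isClosed_H10.completeSpace_coe

lemma continuous_coord (k : Fin 3) : Continuous fun U : Sob => U k := PiLp.continuous_apply 2 _ k

lemma tendsto_sob {ι : Type*} {l : Filter ι} {F : ι → Sob} {U : Sob} (h0 : Tendsto (fun n => F n 0) l (𝓝 (U 0)))
    (h1 : ∀ i : Fin 2, Tendsto (fun n => F n i.succ) l (𝓝 (U i.succ))) : Tendsto F l (𝓝 U) := by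
  have : Tendsto (fun n => (WithLp.ofLp (F n) : Fin 3 → L2Disc)) l (𝓝 (WithLp.ofLp U)) :=
    tendsto_pi_nhds.2 fun k => Fin.cases h0 h1 k
  exact ((PiLp.continuous_toLp 2 fun _ : Fin 3 => L2Disc).tendsto _).comp this

lemma mem_H10_iff {U : Sob} :
    U ∈ H10 ↔ ∃ χ : ℕ → 𝓓(disc, Fiber), Tendsto (fun n => testJet (χ n)) atTop (𝓝 U) := by
  constructor
  · intro h
    obtain ⟨x, hx, hlim⟩ := mem_closure_iff_seq_limit.1 h
    choose χ hχ using hx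
    exact ⟨χ, by simpa only [hχ] using hlim⟩
  · rintro ⟨χ, hχ⟩
    exact isClosed_H10.mem_of_tendsto hχ (Eventually.of_forall fun n => testJet_mem_H10 _)

lemma hasWeakDeriv_of_mem_H10 {U : Sob} (h : U ∈ H10) (i : Fin 2) :
    HasWeakDeriv i (U 0) (U i.succ) := by
  obtain ⟨χ, hχ⟩ := mem_H10_iff.1 h
  exact HasWeakDeriv.of_tendsto (fun n => hasWeakDeriv_toL2 (contDiff_test (χ n)) i)
    (((continuous_coord 0).tendsto U).comp hχ) (((continuous_coord i.succ).tendsto U).comp hχ)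

/-- Integration by parts against `H¹₀`. -/
lemma HasWeakDeriv.inner_H10 {i : Fin 2} {u g : L2Disc} (h : HasWeakDeriv i u g) {W : Sob}
    (hW : W ∈ H10) : ⟪u, W i.succ⟫_ℝ = -⟪g, W 0⟫_ℝ := by
  obtain ⟨χ, hχ⟩ := mem_H10_iff.1 hW
  refine tendsto_nhds_unique
    ((tendsto_const_nhds (x := u)).inner (((continuous_coord i.succ).tendsto W).comp hχ))
    (((tendsto_const_nhds (x := g)).inner
      (((continuous_coord 0).tendsto W).comp hχ)).neg.congr fun n => ?_)
  have := hasWeakDeriv_iff.1 h (χ n)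
  rw [Function.comp_apply, Function.comp_apply, real_inner_comm, ← this, real_inner_comm]

lemma eLpNorm_sub_eq {u : L2Disc} {F : ℂ → Fiber} (hF : Continuous F) :
    eLpNorm (fun z => u z - F z) 2 discMeasure = ENNReal.ofReal ‖u - toL2 F hF‖ := by
  rw [ofReal_norm, Lp.enorm_def]
  refine eLpNorm_congr_ae ?_
  filter_upwards [Lp.coeFn_sub u (toL2 F hF), coe_toL2 F hF] with z h1 h2
  rw [h1, Pi.sub_apply, h2]

lemma memH1_of_mem_H10 {U : Sob} (h : U ∈ H10) : MemH1 (U 0) :=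
  fun i => ⟨_, hasWeakDeriv_of_mem_H10 h i⟩

lemma weakDeriv_of_mem_H10 {U : Sob} (h : U ∈ H10) (i : Fin 2) :
    weakDeriv i (U 0) = U i.succ := (hasWeakDeriv_of_mem_H10 h i).weakDeriv_eq

lemma memH10_of_mem_H10 {U : Sob} (h : U ∈ H10) : MemH10 (U 0) := by
  refine ⟨memH1_of_mem_H10 h, fun ε hε => ?_⟩
  obtain ⟨χ, hχ⟩ := mem_H10_iff.1 h
  have key : ∀ k : Fin 3, ∀ᶠ n in atTop,
      ENNReal.ofReal ‖U k - testJet (χ n) k‖ < ε := fun k => by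
    have h1 : Tendsto (fun n => ‖U k - testJet (χ n) k‖) atTop (𝓝 0) := by
      have := ((tendsto_const_nhds (x := U k)).sub
        (((continuous_coord k).tendsto U).comp hχ)).norm
      simpa using this
    have h2 := ENNReal.tendsto_ofReal h1
    rw [ENNReal.ofReal_zero] at h2
    exact h2.eventually (gt_mem_nhds hε)
  obtain ⟨n, h0, h1⟩ := ((key 0).and (eventually_all.2 fun i : Fin 2 => key i.succ)).exists
  refine ⟨χ n, ?_, fun i => ?_⟩
  · rwa [eLpNorm_sub_eq (contDiff_test (χ n)).continuous]
  · rw [eLpNorm_sub_eq (continuous_fderiv_dir (contDiff_test (χ n)) i), weakDeriv_of_mem_H10 h]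
    exact h1 i

/-- The triple `(u, u_x, u_y)` of weak derivatives. -/
def weakJet (u : L2Disc) : Sob := WithLp.toLp 2 (Fin.cons u fun i => weakDeriv i u)

/-- Approximation within `1/(n+1)` by test sections is convergence of their jets. Together with
`memH10_of_mem_H10` this identifies the defined `H¹₀` with a complete subspace of `Sob`, where
Hilbert space methods apply. -/
lemma MemH10.weakJet_mem {u : L2Disc} (h : MemH10 u) : weakJet u ∈ H10 := by
  choose χ h0 h1 using fun n : ℕ => h.2 (ENNReal.ofReal (1 / ((n : ℝ) + 1)))
    (ENNReal.ofReal_pos.2 (by positivity))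
  refine mem_H10_iff.2 ⟨χ, ?_⟩
  have key : ∀ {w : L2Disc} {v : ℕ → L2Disc},
      (∀ n : ℕ, ENNReal.ofReal ‖w - v n‖ < ENNReal.ofReal (1 / ((n : ℝ) + 1))) →
      Tendsto v atTop (𝓝 w) := fun {w v} hv => by
    rw [tendsto_iff_norm_sub_tendsto_zero]
    refine squeeze_zero (fun _ => norm_nonneg _) (fun n => ?_) tendsto_one_div_add_atTop_nhds_zero_nat
    rw [norm_sub_rev]
    exact ((ENNReal.ofReal_lt_ofReal_iff (by positivity)).1 (hv n)).le
  refine tendsto_sob (key fun n => ?_) fun i => key fun n => ?_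
  · have := h0 n
    rwa [eLpNorm_sub_eq (contDiff_test (χ n)).continuous] at this
  · have := h1 n i
    rwa [eLpNorm_sub_eq (continuous_fderiv_dir (contDiff_test (χ n)) i)] at this

/-! ### Multiplication operators -/

/-- Pointwise multiplication by an essentially bounded field of operators. -/
def mulOp (m : ℂ → Fiber →L[ℝ] Fiber) : L2Disc →L[ℝ] L2Disc :=
  open scoped Classical in
  if h : MemLp m ∞ discMeasure then
    ContinuousLinearMap.holderL discMeasure ∞ 2 2 (ContinuousLinearMap.id ℝ (Fiber →L[ℝ] Fiber))
      (h.toLp m)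
  else 0

lemma coe_mulOp {m : ℂ → Fiber →L[ℝ] Fiber} (h : MemLp m ∞ discMeasure) (u : L2Disc) :
    mulOp m u =ᵐ[discMeasure] fun z => m z (u z) := by
  rw [mulOp, dif_pos h]
  have := ContinuousLinearMap.coeFn_holder (r := 2) (ContinuousLinearMap.id ℝ (Fiber →L[ℝ] Fiber))
    (h.toLp m) u
  filter_upwards [this, h.coeFn_toLp] with z h1 h2
  rw [ContinuousLinearMap.holderL_apply_apply, h1, h2]; rfl

/-- No measurability is required: if the field is not in `L^∞` the operator is zero by definition.
-/
lemma norm_mulOp_le {m : ℂ → Fiber →L[ℝ] Fiber} {C : ℝ} (hC : 0 ≤ C)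
    (hm : ∀ᵐ z ∂discMeasure, ‖m z‖ ≤ C) (u : L2Disc) : ‖mulOp m u‖ ≤ C * ‖u‖ := by
  by_cases h : MemLp m ∞ discMeasure
  · refine Lp.norm_le_mul_norm_of_ae_le_mul ?_
    filter_upwards [coe_mulOp h u, hm] with z h1 h2
    rw [h1]
    exact (m z).le_of_opNorm_le h2 _
  · rw [mulOp, dif_neg h, zero_apply, norm_zero]
    positivity

lemma memLp_top_of_tendsto {m : ℂ → Fiber →L[ℝ] Fiber} {mn : ℕ → ℂ → Fiber →L[ℝ] Fiber}
    (hn : ∀ n, AEStronglyMeasurable (mn n) discMeasure) {K : ℝ}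
    (hK : ∀ n, ∀ᵐ z ∂discMeasure, ‖mn n z‖ ≤ K)
    (hl : ∀ᵐ z ∂discMeasure, Tendsto (fun n => mn n z) atTop (𝓝 (m z))) :
    MemLp m ∞ discMeasure := by
  refine memLp_top_of_bound (aestronglyMeasurable_of_tendsto_ae atTop hn hl) K ?_
  filter_upwards [ae_all_iff.2 hK, hl] with z h1 h2
  exact le_of_tendsto h2.norm (Eventually.of_forall h1)

/-- Strong convergence only, by dominated convergence; the approximations of a conic field in
general do not converge uniformly together with their derivatives. -/
lemma tendsto_mulOp {m : ℂ → Fiber →L[ℝ] Fiber} {mn : ℕ → ℂ → Fiber →L[ℝ] Fiber}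
    (hn : ∀ n, AEStronglyMeasurable (mn n) discMeasure) {K : ℝ}
    (hK : ∀ n, ∀ᵐ z ∂discMeasure, ‖mn n z‖ ≤ K)
    (hl : ∀ᵐ z ∂discMeasure, Tendsto (fun n => mn n z) atTop (𝓝 (m z))) (u : L2Disc) :
    Tendsto (fun n => mulOp (mn n) u) atTop (𝓝 (mulOp m u)) := by
  have hm := memLp_top_of_tendsto hn hK hl
  have hmn : ∀ n, MemLp (mn n) ∞ discMeasure := fun n => memLp_top_of_bound (hn n) K (hK n)
  have hmK : ∀ᵐ z ∂discMeasure, ‖m z‖ ≤ K := by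
    filter_upwards [ae_all_iff.2 hK, hl] with z h1 h2
    exact le_of_tendsto h2.norm (Eventually.of_forall h1)
  refine tendsto_L2_of_dominated (B := fun z => 2 * K * ‖u z‖) ?_ (fun n => ?_) ?_
  · simp_rw [mul_pow]
    exact ((Lp.memLp u).norm.integrable_sq).const_mul _
  · filter_upwards [coe_mulOp hm u, coe_mulOp (hmn n) u, hK n, hmK] with z h1 h2 h3 h4
    rw [h1, h2]
    have h5 := (mn n z).le_of_opNorm_le h3 (u z)
    have h6 := (m z).le_of_opNorm_le h4 (u z)
    exact (norm_sub_le _ _).trans (by linarith)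
  · have := ae_all_iff.2 fun n => coe_mulOp (hmn n) u
    filter_upwards [coe_mulOp hm u, this, hl] with z h1 h2 h3
    simp_rw [h1, h2]
    exact ((ContinuousLinearMap.apply ℝ Fiber (u z)).continuous.tendsto _).comp h3

lemma memLp_top_smul_const {a : ℂ → ℝ} (ha : Continuous a) (T : Fiber →L[ℝ] Fiber) :
    MemLp (fun z => a z • T) ∞ discMeasure :=
  memLp_of_continuous (ha.smul continuous_const) ∞

lemma integral_smul_mulOp {θ a : ℂ → ℝ} (hθ : Continuous θ) (ha : Continuous a)
    (T : Fiber →L[ℝ] Fiber) (u : L2Disc) :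
    ∫ z, θ z • mulOp (fun z => a z • T) u z ∂discMeasure
      = T (∫ z, (θ z * a z) • u z ∂discMeasure) := by
  have hint : Integrable (fun z => (θ z * a z) • u z) discMeasure :=
    integrable_smul_L2 (memLp_of_continuous (hθ.mul ha) 2) u
  rw [← T.integral_comp_comm hint]
  refine integral_congr_ae ?_
  filter_upwards [coe_mulOp (memLp_top_smul_const ha T) u] with z hz
  rw [hz, map_smul, mul_smul]; rfl

/-- The product rule for smooth coefficients. -/
lemma HasWeakDeriv.smul_smooth {i : Fin 2} {u g : L2Disc} (h : HasWeakDeriv i u g) {a : ℂ → ℝ}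
    (ha : ContDiff ℝ ∞ a) (T : Fiber →L[ℝ] Fiber) :
    HasWeakDeriv i (mulOp (fun z => a z • T) u)
      (mulOp (fun z => fderiv ℝ a z (dir i) • T) u + mulOp (fun z => a z • T) g) := by
  intro χ
  have hχ := contDiff_test χ
  have hda := continuous_fderiv_dir ha i
  have hdχ := continuous_fderiv_dir hχ i
  let η : 𝓓(disc, ℝ) := ⟨fun z => χ z * a z, hχ.mul ha, χ.hasCompactSupport.mul_right,
    (tsupport_mul_subset_left).trans χ.tsupport_subset⟩
  have hη := h η
  have e : ∀ z, fderiv ℝ η z (dir i)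
      = fderiv ℝ χ z (dir i) * a z + χ z * fderiv ℝ a z (dir i) := fun z => by
    have := fderiv_mul (hχ.differentiable (by simp) z) (ha.differentiable (by simp) z)
    change fderiv ℝ (⇑χ * a) z (dir i) = _
    rw [this]
    simp only [add_apply, smul_apply, smul_eq_mul]
    ring
  have e' : ∀ z, η z = χ z * a z := fun _ => rfl
  have i1 : Integrable (fun z => (fderiv ℝ χ z (dir i) * a z) • u z) discMeasure := integrable_smul_L2 (memLp_of_continuous (hdχ.mul ha.continuous) 2) u
  have i2 : Integrable (fun z => (χ z * fderiv ℝ a z (dir i)) • u z) discMeasure := integrable_smul_L2 (memLp_of_continuous (hχ.continuous.mul hda) 2) u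
  simp_rw [e, e', add_smul] at hη
  rw [integral_add i1 i2] at hη
  have hsum : ∫ z, χ z • (mulOp (fun z => fderiv ℝ a z (dir i) • T) u
      + mulOp (fun z => a z • T) g : L2Disc) z ∂discMeasure
      = T (∫ z, (χ z * fderiv ℝ a z (dir i)) • u z ∂discMeasure)
        + T (∫ z, (χ z * a z) • g z ∂discMeasure) := by
    rw [← integral_smul_mulOp hχ.continuous hda, ← integral_smul_mulOp hχ.continuous ha.continuous,
      ← integral_add (integrable_smul_L2 (memLp_of_continuous hχ.continuous 2) _)
        (integrable_smul_L2 (memLp_of_continuous hχ.continuous 2) _)]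
    refine integral_congr_ae ?_
    filter_upwards [Lp.coeFn_add (mulOp (fun z => fderiv ℝ a z (dir i) • T) u)
      (mulOp (fun z => a z • T) g)] with z hz
    rw [hz, Pi.add_apply, smul_add]
  rw [hsum, integral_smul_mulOp hdχ ha.continuous, ← map_add, ← map_neg]
  congr 1
  rw [neg_add, ← hη]
  abel

/-- A coefficient function that is smooth away from the origin, vanishes there to first order, and
has bounded derivatives. -/
structure IsConicField (a : ℂ → ℝ) (C : ℝ) : Prop where
  contDiffAt : ∀ z ≠ 0, ContDiffAt ℝ ∞ a z
  abs_le : ∀ z, |a z| ≤ C * ‖z‖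
  abs_fderiv_le : ∀ i, ∀ z ≠ 0, |fderiv ℝ a z (dir i)| ≤ C

lemma norm_dir (i : Fin 2) : ‖dir i‖ = 1 := by
  fin_cases i <;> simp [dir]

/-- Smooth functions vanishing near the origin that approximate a conic field. -/
lemma IsConicField.exists_approx {a : ℂ → ℝ} {C : ℝ} (ha : IsConicField a C) :
    ∃ (an : ℕ → ℂ → ℝ) (K : ℝ), (∀ n, ContDiff ℝ ∞ (an n)) ∧
      (∀ n, ∀ z ∈ Metric.ball (0 : ℂ) 1, |an n z| ≤ K) ∧
      (∀ n i, ∀ z ∈ Metric.ball (0 : ℂ) 1, |fderiv ℝ (an n) z (dir i)| ≤ K) ∧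
      ∀ z ≠ 0, ∀ᶠ n in atTop, an n =ᶠ[𝓝 z] a := by
  have hC : 0 ≤ C := by simpa using (abs_nonneg _).trans (ha.abs_le 1)
  let b : ContDiffBump (0 : ℂ) := ⟨1, 2, one_pos, one_lt_two⟩
  have hb : ContDiff ℝ ∞ (b : ℂ → ℝ) := b.contDiff
  obtain ⟨B, hB⟩ := (b.hasCompactSupport.fderiv (𝕜 := ℝ)).exists_bound_of_continuous
    (hb.continuous_fderiv (by simp))
  have hB0 : 0 ≤ B := (norm_nonneg _).trans (hB 0)
  have hscale : ∀ n : ℕ, ContDiff ℝ ∞ fun z : ℂ => ((n : ℝ) + 1) • z := fun n =>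
    contDiff_id.const_smul ((n : ℝ) + 1)
  have hbn : ∀ n : ℕ, ContDiff ℝ ∞ fun z : ℂ => 1 - b (((n : ℝ) + 1) • z) := fun n =>
    contDiff_const.sub (hb.comp (hscale n))
  have hn0 : ∀ n : ℕ, (0 : ℝ) < (n : ℝ) + 1 := fun n => by positivity
  have hnear : ∀ n : ℕ, (fun z : ℂ => (1 - b (((n : ℝ) + 1) • z)) * a z) =ᶠ[𝓝 0] fun _ => 0 :=
    fun n => by
      have : Tendsto (fun z : ℂ => ((n : ℝ) + 1) • z) (𝓝 0) (𝓝 0) := by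
        simpa using (hscale n).continuous.tendsto 0
      filter_upwards [this.eventually (Metric.closedBall_mem_nhds 0 one_pos)] with z hz
      rw [b.one_of_mem_closedBall hz, sub_self, zero_mul]
  have hsm : ∀ n : ℕ, ContDiff ℝ ∞ fun z : ℂ => (1 - b (((n : ℝ) + 1) • z)) * a z := fun n =>
    contDiff_iff_contDiffAt.2 fun z => by
      rcases eq_or_ne z 0 with rfl | hz
      · exact contDiffAt_const.congr_of_eventuallyEq (hnear n)
      · exact (hbn n).contDiffAt.mul (ha.contDiffAt z hz)
  refine ⟨fun n z => (1 - b (((n : ℝ) + 1) • z)) * a z, C + 2 * B * C, hsm, fun n z hz => ?_,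
    fun n i z hz => ?_, fun z hz => ?_⟩
  · have h1 := b.nonneg (x := ((n : ℝ) + 1) • z)
    have h2 := b.le_one (x := ((n : ℝ) + 1) • z)
    have h3 := ha.abs_le z
    have h4 : ‖z‖ ≤ 1 := by simpa using (Metric.mem_ball.1 hz).le
    rw [abs_mul, abs_of_nonneg (by linarith)]
    have h5 : C * ‖z‖ ≤ C := mul_le_of_le_one_right hC h4
    have h6 : (1 - b (((n : ℝ) + 1) • z)) * |a z| ≤ 1 * |a z| := by gcongr; linarith
    have h7 : 0 ≤ 2 * B * C := by positivity
    linarith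
  · rcases eq_or_ne z 0 with rfl | hz0
    · rw [(hnear n).fderiv_eq]; simp; positivity
    have hd1 : HasFDerivAt (fun z : ℂ => 1 - b (((n : ℝ) + 1) • z))
        (-((fderiv ℝ b (((n : ℝ) + 1) • z)).comp
          (((n : ℝ) + 1) • ContinuousLinearMap.id ℝ ℂ))) z := by
      have := ((hb.differentiable (by simp) (((n : ℝ) + 1) • z)).hasFDerivAt.comp z
        ((hasFDerivAt_id z).const_smul ((n : ℝ) + 1))).const_sub 1
      exact this
    have hd := hd1.mul ((ha.contDiffAt z hz0).differentiableAt (by simp)).hasFDerivAt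
    have hd' : fderiv ℝ (fun z : ℂ => (1 - b (((n : ℝ) + 1) • z)) * a z) z (dir i)
        = (1 - b (((n : ℝ) + 1) • z)) * fderiv ℝ a z (dir i)
          - a z * (((n : ℝ) + 1) * fderiv ℝ b (((n : ℝ) + 1) • z) (dir i)) := by
      change fderiv ℝ ((fun z : ℂ => 1 - b (((n : ℝ) + 1) • z)) * a) z (dir i) = _
      rw [hd.fderiv]
      simp only [add_apply, smul_apply, smul_eq_mul,
        neg_apply, ContinuousLinearMap.comp_apply,
        ContinuousLinearMap.id_apply, map_smul]
      ring
    rw [hd']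
    have h1 := b.nonneg (x := ((n : ℝ) + 1) • z)
    have h2 := b.le_one (x := ((n : ℝ) + 1) • z)
    have t1 : |(1 - b (((n : ℝ) + 1) • z)) * fderiv ℝ a z (dir i)| ≤ C := by
      rw [abs_mul, abs_of_nonneg (by linarith)]
      have := ha.abs_fderiv_le i z hz0
      have h6 : (1 - b (((n : ℝ) + 1) • z)) * |fderiv ℝ a z (dir i)|
        ≤ 1 * |fderiv ℝ a z (dir i)| := by gcongr; linarith
      linarith
    -- The scaled cutoff has gradient of size `(n+1) B`, but only where `(n+1) |z| ≤ 2`. There first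
    -- order vanishing gives `|a| ≤ C |z|`, which compensates the factor `n + 1`.
    have t2 : |a z * (((n : ℝ) + 1) * fderiv ℝ b (((n : ℝ) + 1) • z) (dir i))| ≤ 2 * B * C := by
      by_cases hz2 : ((n : ℝ) + 1) * ‖z‖ ≤ 2
      · have h5 : |fderiv ℝ b (((n : ℝ) + 1) • z) (dir i)| ≤ B := by
          have := (fderiv ℝ b (((n : ℝ) + 1) • z)).le_of_opNorm_le (hB _) (dir i)
          rwa [norm_dir, mul_one] at this
        rw [abs_mul, abs_mul, abs_of_pos (hn0 n)]
        calc |a z| * (((n : ℝ) + 1) * |fderiv ℝ b (((n : ℝ) + 1) • z) (dir i)|)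
            ≤ (C * ‖z‖) * (((n : ℝ) + 1) * B) := by
              gcongr
              exact ha.abs_le z
          _ = (((n : ℝ) + 1) * ‖z‖) * (B * C) := by ring
          _ ≤ 2 * (B * C) := by gcongr
          _ = _ := by ring
      · have : fderiv ℝ b (((n : ℝ) + 1) • z) = 0 := by
          refine image_eq_zero_of_notMem_tsupport fun h => hz2 ?_
          have := tsupport_fderiv_subset ℝ h
          rw [b.tsupport_eq, mem_closedBall_zero_iff, norm_smul, Real.norm_eq_abs,
            abs_of_pos (hn0 n)] at this
          exact this
        rw [this]; simp; positivity
    exact (abs_sub _ _).trans (add_le_add t1 t2)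
  · have hlim : Tendsto (fun n : ℕ => ((n : ℝ) + 1) * ‖z‖) atTop atTop :=
      (tendsto_atTop_add_const_right _ _ tendsto_natCast_atTop_atTop).atTop_mul_const
        (norm_pos_iff.2 hz)
    filter_upwards [hlim.eventually_gt_atTop 2] with n hn
    have : ∀ᶠ w in 𝓝 z, 2 < ((n : ℝ) + 1) * ‖w‖ :=
      (continuous_const.mul continuous_norm).continuousAt.eventually (lt_mem_nhds hn)
    filter_upwards [this] with w hw
    rw [b.zero_of_le_dist (by
      rw [dist_zero_right, norm_smul, Real.norm_eq_abs, abs_of_pos (hn0 n)]; exact hw.le),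
      sub_zero, one_mul]

lemma IsConicField.memLp {a : ℂ → ℝ} {C : ℝ} (ha : IsConicField a C) (T : Fiber →L[ℝ] Fiber) :
    MemLp (fun z => a z • T) ∞ discMeasure ∧
      ∀ i, MemLp (fun z => fderiv ℝ a z (dir i) • T) ∞ discMeasure := by
  obtain ⟨an, K, h1, h2, h3, h4⟩ := ha.exists_approx
  refine ⟨memLp_top_of_tendsto (mn := fun n z => an n z • T) (K := K * ‖T‖)
    (fun n => ((h1 n).continuous.smul continuous_const).aestronglyMeasurable)
    (fun n => ae_disc fun z hz => ?_) (ae_disc_ne_zero fun z _ hz => ?_), fun i =>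
    memLp_top_of_tendsto (mn := fun n z => fderiv ℝ (an n) z (dir i) • T) (K := K * ‖T‖)
    (fun n => ((continuous_fderiv_dir (h1 n) i).smul continuous_const).aestronglyMeasurable)
    (fun n => ae_disc fun z hz => ?_) (ae_disc_ne_zero fun z _ hz => ?_)⟩
  · rw [norm_smul]; gcongr; exact h2 n z hz
  · exact tendsto_const_nhds.congr' ((h4 z hz).mono fun n hn => by simp only [hn.eq_of_nhds])
  · rw [norm_smul]; gcongr; exact h3 n i z hz
  · exact tendsto_const_nhds.congr' ((h4 z hz).mono fun n hn => by simp only [hn.fderiv_eq])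

/-- The product rule for conic coefficients. -/
lemma HasWeakDeriv.smul_conic {i : Fin 2} {u g : L2Disc} (h : HasWeakDeriv i u g) {a : ℂ → ℝ}
    {C : ℝ} (ha : IsConicField a C) (T : Fiber →L[ℝ] Fiber) :
    HasWeakDeriv i (mulOp (fun z => a z • T) u)
      (mulOp (fun z => fderiv ℝ a z (dir i) • T) u + mulOp (fun z => a z • T) g) := by
  obtain ⟨an, K, h1, h2, h3, h4⟩ := ha.exists_approx
  have t1 := tendsto_mulOp (m := fun z => a z • T) (mn := fun n z => an n z • T) (K := K * ‖T‖)
    (fun n => ((h1 n).continuous.smul continuous_const).aestronglyMeasurable)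
    (fun n => ae_disc fun z hz => by rw [norm_smul]; gcongr; exact h2 n z hz)
    (ae_disc_ne_zero fun z _ hz =>
      tendsto_const_nhds.congr' ((h4 z hz).mono fun n hn => by simp only [hn.eq_of_nhds]))
  have t2 := tendsto_mulOp (m := fun z => fderiv ℝ a z (dir i) • T)
    (mn := fun n z => fderiv ℝ (an n) z (dir i) • T) (K := K * ‖T‖)
    (fun n => ((continuous_fderiv_dir (h1 n) i).smul continuous_const).aestronglyMeasurable)
    (fun n => ae_disc fun z hz => by rw [norm_smul]; gcongr; exact h3 n i z hz)
    (ae_disc_ne_zero fun z _ hz =>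
      tendsto_const_nhds.congr' ((h4 z hz).mono fun n hn => by simp only [hn.fderiv_eq]))
  exact HasWeakDeriv.of_tendsto (fun n => h.smul_smooth (h1 n) T) (t1 u) ((t2 u).add (t1 g))

/-! ### The Poincaré inequality -/

/-- Multiplication by the coordinate `x`. -/
def mulRe : L2Disc →L[ℝ] L2Disc :=
  mulOp fun z => z.re • ContinuousLinearMap.id ℝ Fiber

lemma coe_mulRe (u : L2Disc) : mulRe u =ᵐ[discMeasure] fun z => z.re • u z :=
  coe_mulOp (memLp_top_smul_const Complex.continuous_re _) u

lemma norm_mulRe_le (u : L2Disc) : ‖mulRe u‖ ≤ ‖u‖ := by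
  have := norm_mulOp_le (m := fun z => z.re • ContinuousLinearMap.id ℝ Fiber) zero_le_one
    (ae_disc fun z hz => ?_) u
  · simpa [mulRe] using this
  · have h1 : ‖z‖ ≤ 1 := by simpa using (Metric.mem_ball.1 hz).le
    rw [norm_smul]
    exact mul_le_one₀ ((Complex.abs_re_le_norm z).trans h1) (norm_nonneg _)
      ContinuousLinearMap.norm_id_le

lemma inner_mulRe (u v : L2Disc) : ⟪mulRe u, v⟫_ℝ = ⟪u, mulRe v⟫_ℝ := by
  rw [L2.inner_def, L2.inner_def]
  refine integral_congr_ae ?_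
  filter_upwards [coe_mulRe u, coe_mulRe v] with z h1 h2
  rw [h1, h2, real_inner_smul_left, real_inner_smul_right]

/-- Integrate `∂_x (x u) = u + x u_x` by parts against `u`. -/
lemma norm_sq_eq_of_mem_H10 {U : Sob} (hU : U ∈ H10) :
    ‖U 0‖ ^ 2 = -(2 * ⟪mulRe (U 0), U (Fin.succ 0)⟫_ℝ) := by
  have hre : ContDiff ℝ ∞ Complex.re := Complex.reCLM.contDiff
  have h1 := ((hasWeakDeriv_of_mem_H10 hU 0).smul_smooth hre
    (ContinuousLinearMap.id ℝ Fiber)).inner_H10 hU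
  have h2 : (mulOp fun z => fderiv ℝ Complex.re z (dir 0) • ContinuousLinearMap.id ℝ Fiber) (U 0)
      = U 0 := by
    have hone : ∀ z : ℂ, fderiv ℝ Complex.re z (dir 0) = 1 := fun z => by
      rw [show Complex.re = ⇑Complex.reCLM from rfl, ContinuousLinearMap.fderiv]; simp [dir]
    refine Lp.ext ?_
    filter_upwards [coe_mulOp (memLp_top_smul_const (continuous_fderiv_dir hre 0)
      (ContinuousLinearMap.id ℝ Fiber)) (U 0)] with z hz
    rw [hz, hone, one_smul]; rfl
  rw [h2, inner_add_left, real_inner_self_eq_norm_sq] at h1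
  change ⟪mulRe (U 0), _⟫_ℝ = -(_ + ⟪mulRe (U (Fin.succ 0)), _⟫_ℝ) at h1
  rw [inner_mulRe (U (Fin.succ 0)), real_inner_comm (mulRe (U 0))] at h1
  linarith

/-- The covariant Poincaré inequality: the error term is pointwise orthogonal to the section. -/
lemma poincare_of_mem_H10 {U : Sob} (hU : U ∈ H10) {w : L2Disc}
    (hw : ∀ᵐ z ∂discMeasure, ⟪U 0 z, w z⟫_ℝ = 0) : ‖U 0‖ ≤ 2 * ‖U (Fin.succ 0) + w‖ := by
  -- Multiplication by the scalar `x` keeps `u` pointwise parallel to itself, so `w` stays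
  -- orthogonal to it.
  have h0 : ⟪mulRe (U 0), w⟫_ℝ = 0 := by
    rw [L2.inner_def]
    refine integral_eq_zero_of_ae ?_
    filter_upwards [coe_mulRe (U 0), hw] with z h1 h2
    rw [h1, real_inner_smul_left, h2, mul_zero]; rfl
  have h1 := norm_sq_eq_of_mem_H10 hU
  have h2 : ⟪mulRe (U 0), U (Fin.succ 0) + w⟫_ℝ = ⟪mulRe (U 0), U (Fin.succ 0)⟫_ℝ := by
    rw [inner_add_right, h0, add_zero]
  have h3 := abs_real_inner_le_norm (mulRe (U 0)) (U (Fin.succ 0) + w)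
  rw [h2] at h3
  have h4 := norm_mulRe_le (U 0)
  have h5 : ‖U 0‖ ^ 2 ≤ 2 * (‖U 0‖ * ‖U (Fin.succ 0) + w‖) := by
    have h6 : ‖mulRe (U 0)‖ * ‖U (Fin.succ 0) + w‖ ≤ ‖U 0‖ * ‖U (Fin.succ 0) + w‖ := by gcongr
    have := (abs_le.1 h3).1
    linarith
  rcases (norm_nonneg (U 0)).eq_or_lt with h7 | h7
  · rw [← h7]; positivity
  · nlinarith

/-! ### Calculus of smooth functions on the disc -/

/-- The partial derivative in the `i`-th coordinate direction. -/
def pd {E : Type*} [NormedAddCommGroup E] [NormedSpace ℝ E] (i : Fin 2) (F : ℂ → E) : ℂ → E :=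
  fun z => fderiv ℝ F z (dir i)

section pd

variable {E : Type*} [NormedAddCommGroup E] [NormedSpace ℝ E] {F G : ℂ → E} {f g : ℂ → ℝ}

lemma contDiff_pd (hF : ContDiff ℝ ∞ F) (i : Fin 2) : ContDiff ℝ ∞ (pd i F) :=
  contDiff_fderiv_dir hF i

lemma pd_add (hF : ContDiff ℝ ∞ F) (hG : ContDiff ℝ ∞ G) (i : Fin 2) :
    pd i (F + G) = pd i F + pd i G := by
  funext z
  simp [pd, fderiv_add (hF.differentiable (by simp) z) (hG.differentiable (by simp) z)]

lemma pd_sub (hF : ContDiff ℝ ∞ F) (hG : ContDiff ℝ ∞ G) (i : Fin 2) :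
    pd i (F - G) = pd i F - pd i G := by
  funext z
  simp [pd, fderiv_sub (hF.differentiable (by simp) z) (hG.differentiable (by simp) z)]

lemma pd_const_smul (hF : ContDiff ℝ ∞ F) (c : ℝ) (i : Fin 2) : pd i (c • F) = c • pd i F := by
  funext z
  simp [pd, fderiv_const_smul (hF.differentiable (by simp) z)]

lemma pd_smul (hf : ContDiff ℝ ∞ f) (hF : ContDiff ℝ ∞ F) (i : Fin 2) :
    pd i (fun z => f z • F z) = fun z => f z • pd i F z + pd i f z • F z := by
  funext z
  simp [pd, fderiv_fun_smul (hf.differentiable (by simp) z) (hF.differentiable (by simp) z)]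

lemma pd_mul (hf : ContDiff ℝ ∞ f) (hg : ContDiff ℝ ∞ g) (i : Fin 2) :
    pd i (fun z => f z * g z) = fun z => f z * pd i g z + pd i f z * g z := pd_smul hf hg i

lemma pd_clm_comp {E' : Type*} [NormedAddCommGroup E'] [NormedSpace ℝ E'] (L : E →L[ℝ] E')
    (hF : ContDiff ℝ ∞ F) (i : Fin 2) : pd i (fun z => L (F z)) = fun z => L (pd i F z) := by
  funext z
  have := (L.hasFDerivAt.comp z (hF.differentiable (by simp) z).hasFDerivAt).fderiv
  exact congrArg (fun L : ℂ →L[ℝ] E' => L (dir i)) this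

lemma pd_comm (hF : ContDiff ℝ ∞ F) (i j : Fin 2) : pd i (pd j F) = pd j (pd i F) := by
  funext z
  have hd : DifferentiableAt ℝ (fderiv ℝ F) z :=
    (hF.fderiv_right (m := ∞) (by simp)).differentiable (by simp) z
  have h1 : ∀ i j, pd i (pd j F) z = fderiv ℝ (fderiv ℝ F) z (dir i) (dir j) := fun i j => by
    have := ((ContinuousLinearMap.apply ℝ E (dir j)).hasFDerivAt.comp z hd.hasFDerivAt).fderiv
    exact congrArg (fun L : ℂ →L[ℝ] E => L (dir i)) this
  rw [h1, h1]
  exact second_derivative_symmetric (fun y => (hF.differentiable (by simp) y).hasFDerivAt)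
    hd.hasFDerivAt _ _

end pd

/-- The `i`-th coordinate of a point. -/
def crd (i : Fin 2) : ℂ →L[ℝ] ℝ := ![Complex.reCLM, Complex.imCLM] i

lemma contDiff_crd (i : Fin 2) : ContDiff ℝ ∞ (crd i) := (crd i).contDiff

lemma pd_crd (i j : Fin 2) : pd i (crd j) = fun _ => if i = j then 1 else 0 := by
  funext z
  rw [pd, ContinuousLinearMap.fderiv]
  fin_cases i <;> fin_cases j <;> simp [crd, dir]

/-- The boundary defining function `1 - |z|²`. -/
def bdf (z : ℂ) : ℝ := 1 - (crd 0 z * crd 0 z + crd 1 z * crd 1 z)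

lemma bdf_eq (z : ℂ) : bdf z = 1 - ‖z‖ ^ 2 := by
  rw [bdf, Complex.sq_norm, Complex.normSq_apply]; simp [crd]

lemma contDiff_bdf : ContDiff ℝ ∞ bdf := by
  unfold bdf
  exact contDiff_const.sub (((contDiff_crd 0).mul (contDiff_crd 0)).add
    ((contDiff_crd 1).mul (contDiff_crd 1)))

lemma bdf_pos {z : ℂ} (hz : z ∈ Metric.ball (0 : ℂ) 1) : 0 < bdf z := by
  rw [bdf_eq]
  have : ‖z‖ < 1 := by simpa using hz
  nlinarith [norm_nonneg z]

lemma pd_bdf (i : Fin 2) : pd i bdf = fun z => -2 * crd i z := by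
  funext z
  have h := fun j => (crd j).hasFDerivAt (x := z)
  have := (((h 0).mul (h 0)).add ((h 1).mul (h 1))).const_sub 1
  have e : HasFDerivAt bdf _ z := this
  rw [pd, e.fderiv]
  fin_cases i <;> simp [crd, dir] <;> ring

/-! ### Cutoffs near the unit circle -/

lemma exists_bound_deriv_smoothTransition : ∃ B : ℝ, 0 ≤ B ∧ ∀ x,
    0 ≤ deriv Real.smoothTransition x ∧ deriv Real.smoothTransition x ≤ B ∧
      (1 < x → deriv Real.smoothTransition x = 0) := by
  have hc : Continuous (deriv Real.smoothTransition) :=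
    (Real.smoothTransition.contDiff (n := 1)).continuous_deriv le_rfl
  obtain ⟨B, hB⟩ := (isCompact_Icc (a := (0 : ℝ)) (b := 1)).exists_bound_of_continuousOn
    hc.continuousOn
  have hB0 : 0 ≤ B := (norm_nonneg _).trans (hB 0 (by simp))
  have h1 : ∀ x : ℝ, 1 < x → deriv Real.smoothTransition x = 0 := fun x hx => by
    have : Real.smoothTransition =ᶠ[𝓝 x] fun _ => 1 := by
      filter_upwards [lt_mem_nhds hx] with y hy using Real.smoothTransition.one_of_one_le hy.le
    rw [this.deriv_eq, deriv_const]
  refine ⟨B, hB0, fun x => ⟨Real.smoothTransition.monotone.deriv_nonneg, ?_, h1 x⟩⟩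
  rcases lt_or_ge x 0 with hx | hx
  · have : Real.smoothTransition =ᶠ[𝓝 x] fun _ => 0 := by
      filter_upwards [gt_mem_nhds hx] with y hy using Real.smoothTransition.zero_of_nonpos hy.le
    rw [this.deriv_eq, deriv_const]; exact hB0
  · rcases le_or_gt x 1 with hx1 | hx1
    · exact (le_abs_self _).trans (hB x ⟨hx, hx1⟩)
    · rw [h1 x hx1]; exact hB0

/-- Smooth cutoff functions with compact support in the disc that tend to one. -/
def cutoff (n : ℕ) (z : ℂ) : ℝ := Real.smoothTransition (((n : ℝ) + 1) * bdf z - 1)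

lemma contDiff_cutoff (n : ℕ) : ContDiff ℝ ∞ (cutoff n) :=
  Real.smoothTransition.contDiff.comp ((contDiff_const.mul contDiff_bdf).sub contDiff_const)

lemma tsupport_cutoff_subset (n : ℕ) :
    tsupport (cutoff n) ⊆ {z : ℂ | 1 ≤ ((n : ℝ) + 1) * bdf z} := by
  refine closure_minimal (fun z hz => ?_)
    (isClosed_le continuous_const (continuous_const.mul contDiff_bdf.continuous))
  by_contra h
  exact hz (Real.smoothTransition.zero_of_nonpos (by simp only [mem_ofPred_eq, not_le] at h; linarith))

lemma tsupport_cutoff_subset_disc (n : ℕ) : tsupport (cutoff n) ⊆ disc := fun z hz => by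
  have h := tsupport_cutoff_subset n hz
  rw [mem_ofPred_eq] at h
  have h1 : 0 < bdf z := by
    by_contra! hcon
    have : ((n : ℝ) + 1) * bdf z ≤ 0 := mul_nonpos_of_nonneg_of_nonpos (by positivity) hcon
    linarith
  rw [bdf_eq] at h1
  change z ∈ Metric.ball (0 : ℂ) 1
  rw [mem_ball_zero_iff]
  nlinarith [norm_nonneg z]

lemma hasCompactSupport_cutoff (n : ℕ) : HasCompactSupport (cutoff n) :=
  HasCompactSupport.of_support_subset_isCompact (isCompact_closedBall (0 : ℂ) 1)
    ((subset_tsupport _).trans ((tsupport_cutoff_subset_disc n).trans Metric.ball_subset_closedBall))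

lemma pd_cutoff (n : ℕ) (i : Fin 2) (z : ℂ) : pd i (cutoff n) z =
    -2 * (((n : ℝ) + 1) * deriv Real.smoothTransition (((n : ℝ) + 1) * bdf z - 1)) * crd i z := by
  have h1 := (contDiff_bdf.differentiable (by simp) z).hasFDerivAt
  have h2 := (Real.smoothTransition.contDiff (n := 1)).differentiable one_ne_zero
    (((n : ℝ) + 1) * bdf z - 1)
  have h3 := h2.hasDerivAt.comp_hasFDerivAt z ((h1.const_mul ((n : ℝ) + 1)).sub_const 1)
  have h4 := congrFun (pd_bdf i) z
  simp only [pd] at h4 ⊢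
  have e : HasFDerivAt (cutoff n) _ z := h3
  rw [e.fderiv]
  simp only [smul_apply, smul_eq_mul, h4]
  ring

lemma cutoff_mem (n : ℕ) (z : ℂ) : 0 ≤ cutoff n z ∧ cutoff n z ≤ 1 :=
  ⟨Real.smoothTransition.nonneg _, Real.smoothTransition.le_one _⟩

lemma eventually_two_lt {z : ℂ} (hz : z ∈ Metric.ball (0 : ℂ) 1) :
    ∀ᶠ n : ℕ in atTop, 2 < ((n : ℝ) + 1) * bdf z :=
  ((tendsto_atTop_add_const_right _ _ tendsto_natCast_atTop_atTop).atTop_mul_const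
    (bdf_pos hz)).eventually_gt_atTop 2

lemma eventually_cutoff_eq_one {z : ℂ} (hz : z ∈ Metric.ball (0 : ℂ) 1) :
    ∀ᶠ n : ℕ in atTop, cutoff n z = 1 := by
  filter_upwards [eventually_two_lt hz] with n hn
  exact Real.smoothTransition.one_of_one_le (by linarith)

/-- The slope of the cutoff is of order `n + 1`, but inside the disc it vanishes where `(n+1) bdf >
2`; the product with `bdf` is therefore bounded uniformly in `n`. -/
lemma exists_bound_cutoff_slope : ∃ B : ℝ, 0 ≤ B ∧ ∀ n : ℕ, ∀ z ∈ Metric.ball (0 : ℂ) 1,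
    0 ≤ ((n : ℝ) + 1) * deriv Real.smoothTransition (((n : ℝ) + 1) * bdf z - 1) ∧
    ((n : ℝ) + 1) * deriv Real.smoothTransition (((n : ℝ) + 1) * bdf z - 1) * bdf z ≤ B := by
  obtain ⟨B, hB0, hB⟩ := exists_bound_deriv_smoothTransition
  refine ⟨2 * B, by positivity, fun n z hz => ?_⟩
  obtain ⟨h1, h2, h3⟩ := hB (((n : ℝ) + 1) * bdf z - 1)
  have hb := bdf_pos hz
  refine ⟨by positivity, ?_⟩
  rcases le_or_gt (((n : ℝ) + 1) * bdf z) 2 with h | h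
  · calc _ = (((n : ℝ) + 1) * bdf z) * deriv Real.smoothTransition (((n : ℝ) + 1) * bdf z - 1) := by
          ring
      _ ≤ 2 * B := by gcongr
  · rw [h3 (by linarith)]; simp; positivity

lemma eventually_cutoff_slope_eq_zero {z : ℂ} (hz : z ∈ Metric.ball (0 : ℂ) 1) :
    ∀ᶠ n : ℕ in atTop,
      ((n : ℝ) + 1) * deriv Real.smoothTransition (((n : ℝ) + 1) * bdf z - 1) = 0 := by
  obtain ⟨B, -, hB⟩ := exists_bound_deriv_smoothTransition
  filter_upwards [eventually_two_lt hz] with n hn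
  rw [(hB _).2.2 (by linarith), mul_zero]

lemma norm_crd_le (i : Fin 2) {z : ℂ} (hz : z ∈ Metric.ball (0 : ℂ) 1) : |crd i z| ≤ 1 := by
  have h : ‖z‖ ≤ 1 := by simpa using (mem_ball_zero_iff.1 hz).le
  fin_cases i
  · exact (Complex.abs_re_le_norm z).trans h
  · exact (Complex.abs_im_le_norm z).trans h

/-- Smooth sections vanishing on the unit circle belong to `H¹₀`. -/
lemma jet_bdf_smul_mem_H10 {p : ℂ → Fiber} (hp : ContDiff ℝ ∞ p) :
    jet (fun z => bdf z • p z) (contDiff_bdf.smul hp) ∈ H10 := by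
  set F : ℂ → Fiber := fun z => bdf z • p z with hFdef
  have hF : ContDiff ℝ ∞ F := contDiff_bdf.smul hp
  let χ : ℕ → 𝓓(disc, Fiber) := fun n => ⟨fun z => cutoff n z • F z, (contDiff_cutoff n).smul hF,
    (hasCompactSupport_cutoff n).smul_right,
    (tsupport_smul_subset_left _ _).trans (tsupport_cutoff_subset_disc n)⟩
  have hχ : ∀ n z, χ n z = cutoff n z • F z := fun _ _ => rfl
  have hdχ : ∀ n i z, fderiv ℝ (χ n) z (dir i) = cutoff n z • pd i F z + pd i (cutoff n) z • F z :=
    fun n i z => congrFun (pd_smul (contDiff_cutoff n) hF i) z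
  obtain ⟨B, hB0, hB⟩ := exists_bound_cutoff_slope
  refine mem_H10_iff.2 ⟨χ, tendsto_sob ?_ fun i => ?_⟩
  · refine tendsto_L2_of_dominated (B := fun z => ‖F z‖)
      (integrable_of_continuous (hF.continuous.norm.pow 2)) (fun n => ?_) ?_
    · filter_upwards [coe_toL2 _ hF.continuous, coe_toL2 _ (contDiff_test (χ n)).continuous]
        with z h1 h2
      rw [testJet_apply, jet_zero, jet_zero, h1, h2, hχ]
      have := cutoff_mem n z
      calc ‖cutoff n z • F z - F z‖ = ‖(cutoff n z - 1) • F z‖ := by rw [sub_smul, one_smul]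
        _ = |cutoff n z - 1| * ‖F z‖ := by rw [norm_smul, Real.norm_eq_abs]
        _ ≤ 1 * ‖F z‖ := by
            gcongr
            exact abs_le.2 ⟨by linarith, by linarith⟩
        _ = ‖F z‖ := one_mul _
    · have h3 := ae_all_iff.2 fun n => coe_toL2 _ (contDiff_test (χ n)).continuous
      filter_upwards [coe_toL2 _ hF.continuous, h3, ae_disc fun z hz => eventually_cutoff_eq_one hz]
        with z h1 h2 h3
      refine Tendsto.congr (fun n => ((h2 n).trans (hχ n z)).symm) ?_
      rw [jet_zero, h1]
      exact tendsto_const_nhds.congr' (h3.mono fun n hn => by simp only [hn, one_smul])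
  · have hpd := continuous_fderiv_dir hF i
    refine tendsto_L2_of_dominated (B := fun z => ‖pd i F z‖ + 2 * B * ‖p z‖)
      (integrable_of_continuous
        ((hpd.norm.add (continuous_const.mul hp.continuous.norm)).pow 2)) (fun n => ?_) ?_
    · filter_upwards [coe_toL2 _ hpd, coe_toL2 _ (continuous_fderiv_dir (contDiff_test (χ n)) i),
        ae_disc fun z hz => hB n z hz, ae_disc fun z hz => norm_crd_le i hz,
        ae_disc fun z hz => bdf_pos hz] with z h1 h2 h3 h4 h5
      rw [testJet_apply, jet_succ, jet_succ, h1, h2, hdχ]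
      have := cutoff_mem n z
      -- The gradient of the cutoff appears only multiplied by `bdf`, where it is uniformly bounded.
      have e : cutoff n z • pd i F z + pd i (cutoff n) z • F z - fderiv ℝ F z (dir i)
          = (cutoff n z - 1) • pd i F z + (pd i (cutoff n) z * bdf z) • p z := by
        rw [sub_smul, one_smul, mul_smul]; simp only [hFdef, pd]; abel
      rw [e]
      refine (norm_add_le _ _).trans (add_le_add ?_ ?_)
      · rw [norm_smul, Real.norm_eq_abs]
        exact mul_le_of_le_one_left (norm_nonneg _) (abs_le.2 ⟨by linarith, by linarith⟩)
      · rw [norm_smul, Real.norm_eq_abs, pd_cutoff]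
        gcongr
        set m := ((n : ℝ) + 1) * deriv Real.smoothTransition (((n : ℝ) + 1) * bdf z - 1)
        rw [show -2 * m * crd i z * bdf z = -(2 * (m * bdf z) * crd i z) by ring, abs_neg, abs_mul,
          abs_of_nonneg (mul_nonneg zero_le_two (mul_nonneg h3.1 h5.le))]
        calc 2 * (m * bdf z) * |crd i z| ≤ 2 * B * 1 := by
              gcongr
              exact h3.2
          _ = 2 * B := mul_one _
    · have h3 := ae_all_iff.2 fun n => coe_toL2 _ (continuous_fderiv_dir (contDiff_test (χ n)) i)
      filter_upwards [coe_toL2 _ hpd, h3, ae_disc fun z hz => eventually_cutoff_eq_one hz,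
        ae_disc fun z hz => eventually_cutoff_slope_eq_zero hz] with z h1 h2 h3 h4
      refine Tendsto.congr (fun n => ((h2 n).trans (hdχ n i z)).symm) ?_
      rw [jet_succ, h1]
      refine tendsto_const_nhds.congr' ?_
      filter_upwards [h3, h4] with n h5 h6
      simp only [pd_cutoff, h5, h6]; simp [pd]

/-! ### The sharp Hessian estimate -/

/-- The divergence of a smooth vector field that points outward along the unit circle has
nonnegative integral over the disc. -/
lemma integral_div_nonneg {P₀ P₁ Q : ℂ → ℝ} (h₀ : ContDiff ℝ ∞ P₀) (h₁ : ContDiff ℝ ∞ P₁)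
    (hQ : Continuous Q) (hb : ∀ z, bdf z * Q z ≤ crd 0 z * P₀ z + crd 1 z * P₁ z) :
    0 ≤ ∫ z, (pd 0 P₀ z + pd 1 P₁ z) ∂discMeasure := by
  obtain ⟨B, hB0, hB⟩ := exists_bound_cutoff_slope
  set m : ℕ → ℂ → ℝ := fun n z =>
    ((n : ℝ) + 1) * deriv Real.smoothTransition (((n : ℝ) + 1) * bdf z - 1) with hm
  have hcm : ∀ n, Continuous (m n) := fun n => continuous_const.mul
    (((Real.smoothTransition.contDiff (n := 1)).continuous_deriv le_rfl).comp
      ((continuous_const.mul contDiff_bdf.continuous).sub continuous_const))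
  have hcd : Continuous fun z => pd 0 P₀ z + pd 1 P₁ z :=
    (contDiff_pd h₀ 0).continuous.add (contDiff_pd h₁ 1).continuous
  have hdisc : ∀ (n : ℕ) {f : ℂ → ℝ} , (∀ z ∉ tsupport (cutoff n), f z = 0) →
      ∫ z, f z ∂discMeasure = ∫ z, f z := fun n f hf =>
    setIntegral_eq_integral_of_forall_compl_eq_zero fun z hz =>
      hf z fun h => hz (tsupport_cutoff_subset_disc n h)
  have hparts : ∀ n {P : ℂ → ℝ} (_ : ContDiff ℝ ∞ P) (i : Fin 2),
      ∫ z, cutoff n z * pd i P z ∂discMeasure = ∫ z, 2 * m n z * (crd i z * P z) ∂discMeasure :=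
    fun n P hP i => by
      have hs := hasCompactSupport_cutoff n
      have hc := contDiff_cutoff n
      have hsd : HasCompactSupport (fun z => fderiv ℝ (cutoff n) z (dir i)) :=
        hs.fderiv_apply (𝕜 := ℝ) (dir i)
      have := integral_mul_fderiv_eq_neg_fderiv_mul_of_integrable (μ := (volume : Measure ℂ))
        (f := cutoff n) (g := P) (v := dir i)
        (((continuous_fderiv_dir hc i).mul hP.continuous).integrable_of_hasCompactSupport
          hsd.mul_right)
        ((hc.continuous.mul (continuous_fderiv_dir hP i)).integrable_of_hasCompactSupport
          hs.mul_right)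
        ((hc.continuous.mul hP.continuous).integrable_of_hasCompactSupport hs.mul_right)
        (fun z _ => hc.differentiable (by simp) z) (fun z _ => hP.differentiable (by simp) z)
      rw [← integral_neg] at this
      rw [hdisc n fun z hz => by rw [image_eq_zero_of_notMem_tsupport hz, zero_mul]]
      refine this.trans ?_
      have e : ∀ z, -(fderiv ℝ (cutoff n) z (dir i) * P z) = 2 * m n z * (crd i z * P z) :=
        fun z => by
          have := pd_cutoff n i z
          simp only [pd] at this
          rw [this]; ring
      simp_rw [e]
      refine (hdisc n fun z hz => ?_).symm
      rw [← e, show fderiv ℝ (cutoff n) z = 0 from image_eq_zero_of_notMem_tsupport fun h =>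
        hz (tsupport_fderiv_subset ℝ h)]
      simp
  -- The negative gradient of the cutoff is `2 m z` with `m ≥ 0`, so integration by parts produces
  -- the radial component of the field, which is at least `bdf · Q`. The lower bound tends to zero
  -- as `m · bdf` is bounded and eventually vanishes pointwise.
  have hle : ∀ n, ∫ z, 2 * (m n z * bdf z * Q z) ∂discMeasure ≤
      ∫ z, cutoff n z * (pd 0 P₀ z + pd 1 P₁ z) ∂discMeasure := fun n => by
    have hcc := (contDiff_cutoff n).continuous
    have e : ∫ z, cutoff n z * (pd 0 P₀ z + pd 1 P₁ z) ∂discMeasure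
        = ∫ z, 2 * m n z * (crd 0 z * P₀ z + crd 1 z * P₁ z) ∂discMeasure := by
      have i0 : Integrable (fun z => cutoff n z * pd 0 P₀ z) discMeasure :=
        integrable_of_continuous (hcc.mul (contDiff_pd h₀ 0).continuous)
      have i1 : Integrable (fun z => cutoff n z * pd 1 P₁ z) discMeasure :=
        integrable_of_continuous (hcc.mul (contDiff_pd h₁ 1).continuous)
      simp_rw [mul_add]
      rw [integral_add i0 i1, hparts n h₀ 0, hparts n h₁ 1, ← integral_add]
      · exact integrable_of_continuous ((continuous_const.mul (hcm n)).mul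
          ((crd 0).continuous.mul h₀.continuous))
      · exact integrable_of_continuous ((continuous_const.mul (hcm n)).mul
          ((crd 1).continuous.mul h₁.continuous))
    rw [e]
    refine integral_mono_ae (integrable_of_continuous (continuous_const.mul
      (((hcm n).mul contDiff_bdf.continuous).mul hQ))) (integrable_of_continuous
      ((continuous_const.mul (hcm n)).mul (((crd 0).continuous.mul h₀.continuous).add
        ((crd 1).continuous.mul h₁.continuous)))) (ae_disc fun z hz => ?_)
    have := mul_le_mul_of_nonneg_left (hb z) (hB n z hz).1
    simp only [hm]
    linarith
  have hl1 : Tendsto (fun n => ∫ z, 2 * (m n z * bdf z * Q z) ∂discMeasure) atTop (𝓝 0) := by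
    rw [show (0 : ℝ) = ∫ _, (0 : ℝ) ∂discMeasure by simp]
    refine tendsto_integral_of_dominated_convergence (fun z => 2 * (B * |Q z|))
      (fun n => (continuous_const.mul
        (((hcm n).mul contDiff_bdf.continuous).mul hQ)).aestronglyMeasurable)
      (integrable_of_continuous (continuous_const.mul (continuous_const.mul hQ.abs)))
      (fun n => ae_disc fun z hz => ?_) (ae_disc fun z hz => ?_)
    · rw [Real.norm_eq_abs, abs_mul, abs_two, abs_mul,
        abs_of_nonneg (mul_nonneg (hB n z hz).1 (bdf_pos hz).le)]
      gcongr
      exact (hB n z hz).2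
    · refine tendsto_const_nhds.congr' ?_
      filter_upwards [eventually_cutoff_slope_eq_zero hz] with n hn
      simp only [hm, hn, zero_mul, mul_zero]
  have hl2 : Tendsto (fun n => ∫ z, cutoff n z * (pd 0 P₀ z + pd 1 P₁ z) ∂discMeasure) atTop
      (𝓝 (∫ z, (pd 0 P₀ z + pd 1 P₁ z) ∂discMeasure)) := by
    refine tendsto_integral_of_dominated_convergence (fun z => |pd 0 P₀ z + pd 1 P₁ z|)
      (fun n => ((contDiff_cutoff n).continuous.mul hcd).aestronglyMeasurable)
      (integrable_of_continuous hcd.abs)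
      (fun n => ae_disc fun z hz => ?_) (ae_disc fun z hz => ?_)
    · rw [Real.norm_eq_abs, abs_mul, abs_of_nonneg (cutoff_mem n z).1]
      exact mul_le_of_le_one_left (abs_nonneg _) (cutoff_mem n z).2
    · refine tendsto_const_nhds.congr' ?_
      filter_upwards [eventually_cutoff_eq_one hz] with n hn
      rw [hn, one_mul]
  exact le_of_tendsto_of_tendsto' hl1 hl2 hle

/-- The second derivatives of a smooth function vanishing on the unit circle are controlled by
its Laplacian. -/
lemma integral_hessian_le {p u : ℂ → ℝ} (hp : ContDiff ℝ ∞ p) (hu : u = fun z => bdf z * p z) :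
    ∫ z, (∑ i, ∑ j, pd j (pd i u) z ^ 2) ∂discMeasure ≤
      ∫ z, (∑ i, pd i (pd i u) z) ^ 2 ∂discMeasure := by
  have hus : ContDiff ℝ ∞ u := hu ▸ contDiff_bdf.mul hp
  have h1 : ∀ i, ContDiff ℝ ∞ (pd i u) := contDiff_pd hus
  have h2 : ∀ i j, ContDiff ℝ ∞ (pd i (pd j u)) := fun i j => contDiff_pd (h1 j) i
  have hpi : ∀ i, ContDiff ℝ ∞ (pd i p) := contDiff_pd hp
  have hc1 : ∀ i z, pd i u z = bdf z * pd i p z + -2 * crd i z * p z := fun i z => by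
    rw [hu, pd_mul contDiff_bdf hp, pd_bdf]
  have hc2 : ∀ i j z, pd j (pd i u) z = bdf z * pd j (pd i p) z + -2 * crd j z * pd i p z +
      -2 * (crd i z * pd j p z + (if j = i then 1 else 0) * p z) := fun i j z => by
    have e : pd i u = (fun z => bdf z * pd i p z) + (-2 : ℝ) • fun z => crd i z * p z := by
      funext z; rw [hc1]; simp; ring
    have hs : ContDiff ℝ ∞ ((-2 : ℝ) • fun z => crd i z * p z) :=
      ((contDiff_crd i).mul hp).const_smul (-2 : ℝ)
    rw [e, pd_add (contDiff_bdf.mul (hpi i)) hs,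
      pd_const_smul ((contDiff_crd i).mul hp), pd_mul contDiff_bdf (hpi i),
      pd_mul (contDiff_crd i) hp, pd_bdf, pd_crd]
    simp
  -- The components of a vector field with divergence `2 det D²u = (Δu)² - |D²u|²`: the third
  -- derivatives cancel.
  have hP₀ : ContDiff ℝ ∞ fun z => pd 0 u z * pd 1 (pd 1 u) z - pd 1 u z * pd 1 (pd 0 u) z :=
    ((h1 0).mul (h2 1 1)).sub ((h1 1).mul (h2 1 0))
  have hP₁ : ContDiff ℝ ∞ fun z => pd 1 u z * pd 0 (pd 0 u) z - pd 0 u z * pd 1 (pd 0 u) z :=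
    ((h1 1).mul (h2 0 0)).sub ((h1 0).mul (h2 1 0))
  -- Modulo `bdf` the radial component of that field equals `4 |z|² p²`. This is the curvature term
  -- of the circle, with the favourable sign of a convex boundary; `R` collects the remainder.
  set R : ℂ → ℝ := fun z => crd 0 z * (pd 0 p z * pd 1 (pd 1 u) z - pd 1 p z * pd 1 (pd 0 u) z)
    + crd 1 z * (pd 1 p z * pd 0 (pd 0 u) z - pd 0 p z * pd 1 (pd 0 u) z)
    - 2 * p z * (crd 0 z * crd 0 z * pd 1 (pd 1 p) z - 2 * crd 0 z * crd 1 z * pd 1 (pd 0 p) z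
      + crd 1 z * crd 1 z * pd 0 (pd 0 p) z) with hR
  have hRc : Continuous R := by
    have a1 := fun i => (hpi i).continuous
    have a2 := fun i j => (h2 i j).continuous
    have a3 := fun i j => (contDiff_pd (hpi j) i).continuous
    have a4 := fun i => (crd i).continuous
    have a5 := hp.continuous
    exact (((a4 0).mul (((a1 0).mul (a2 1 1)).sub ((a1 1).mul (a2 1 0)))).add
      ((a4 1).mul (((a1 1).mul (a2 0 0)).sub ((a1 0).mul (a2 1 0))))).sub
      ((continuous_const.mul a5).mul (((((a4 0).mul (a4 0)).mul (a3 1 1)).sub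
        (((continuous_const.mul (a4 0)).mul (a4 1)).mul (a3 1 0))).add
        (((a4 1).mul (a4 1)).mul (a3 0 0))))
  have hdiv := integral_div_nonneg hP₀ hP₁ hRc fun z => by
    have key : crd 0 z * (pd 0 u z * pd 1 (pd 1 u) z - pd 1 u z * pd 1 (pd 0 u) z) +
        crd 1 z * (pd 1 u z * pd 0 (pd 0 u) z - pd 0 u z * pd 1 (pd 0 u) z)
        = bdf z * R z + 4 * (crd 0 z * crd 0 z + crd 1 z * crd 1 z) * p z ^ 2 := by
      have e01 : pd 0 (pd 1 p) z = pd 1 (pd 0 p) z := congrFun (pd_comm hp 0 1) z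
      simp only [hR, hc1, hc2]
      norm_num
      ring
    rw [key]
    nlinarith [mul_nonneg (add_nonneg (mul_self_nonneg (crd 0 z)) (mul_self_nonneg (crd 1 z)))
      (sq_nonneg (p z))]
  have hdet : ∀ z, pd 0 (fun z => pd 0 u z * pd 1 (pd 1 u) z - pd 1 u z * pd 1 (pd 0 u) z) z +
      pd 1 (fun z => pd 1 u z * pd 0 (pd 0 u) z - pd 0 u z * pd 1 (pd 0 u) z) z
      = (∑ i, pd i (pd i u) z) ^ 2 - ∑ i, ∑ j, pd j (pd i u) z ^ 2 := fun z => by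
    have e0 := pd_sub ((h1 0).mul (h2 1 1)) ((h1 1).mul (h2 1 0)) 0
    have e1 := pd_sub ((h1 1).mul (h2 0 0)) ((h1 0).mul (h2 1 0)) 1
    rw [pd_mul (h1 0) (h2 1 1), pd_mul (h1 1) (h2 1 0)] at e0
    rw [pd_mul (h1 1) (h2 0 0), pd_mul (h1 0) (h2 1 0)] at e1
    have c1 : pd 0 (pd 1 u) = pd 1 (pd 0 u) := pd_comm hus 0 1
    have c2 : pd 0 (pd 1 (pd 1 u)) = pd 1 (pd 1 (pd 0 u)) := by rw [pd_comm (h1 1) 0 1, c1]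
    have c3 : pd 0 (pd 1 (pd 0 u)) = pd 1 (pd 0 (pd 0 u)) := pd_comm (h1 0) 0 1
    have e0' := congrFun e0 z
    have e1' := congrFun e1 z
    simp only [Pi.sub_apply, c1, c2, c3] at e0' e1'
    simp only [Fin.sum_univ_two, c1]
    refine (congrArg₂ (· + ·) e0' e1').trans ?_
    ring
  simp_rw [hdet] at hdiv
  rw [integral_sub] at hdiv
  · linarith
  · exact integrable_of_continuous ((continuous_finsetSum _ fun i _ => (h2 i i).continuous).pow 2)
  · exact integrable_of_continuous (continuous_finsetSum _ fun i _ =>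
      continuous_finsetSum _ fun j _ => (h2 j i).continuous.pow 2)

/-! ### The Dirichlet problem for the flat Laplacian -/

/-- Smooth sections. -/
def smoothSections : Submodule ℝ (ℂ → Fiber) where
  carrier := {F | ContDiff ℝ ∞ F}
  add_mem' := fun {F G} (h : ContDiff ℝ ∞ F) (h' : ContDiff ℝ ∞ G) => h.add h'
  zero_mem' := (contDiff_const : ContDiff ℝ ∞ fun _ : ℂ => (0 : Fiber))
  smul_mem' := fun c F (h : ContDiff ℝ ∞ F) => h.const_smul c

lemma contDiff_coe (F : smoothSections) : ContDiff ℝ ∞ (F : ℂ → Fiber) := F.2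

/-- Partial derivatives of smooth sections. -/
def pdL (i : Fin 2) : smoothSections →ₗ[ℝ] smoothSections where
  toFun F := ⟨pd i F, contDiff_pd (contDiff_coe F) i⟩
  map_add' F G := Subtype.ext (pd_add (contDiff_coe F) (contDiff_coe G) i)
  map_smul' c F := Subtype.ext (pd_const_smul (contDiff_coe F) c i)

/-- Multiplication by the boundary defining function. -/
def bdfL : smoothSections →ₗ[ℝ] smoothSections where
  toFun F := ⟨fun z => bdf z • (F : ℂ → Fiber) z, contDiff_bdf.smul (contDiff_coe F)⟩
  map_add' _ _ := Subtype.ext (funext fun _ => smul_add _ _ _)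
  map_smul' c F := Subtype.ext (funext fun z => smul_comm (bdf z) c ((F : ℂ → Fiber) z))

/-- The class in `L²` of a smooth section. -/
def classL : smoothSections →ₗ[ℝ] L2Disc where
  toFun F := toL2 F (contDiff_coe F).continuous
  map_add' F G := toL2_add (contDiff_coe F).continuous (contDiff_coe G).continuous
  map_smul' c F := toL2_smul (contDiff_coe F).continuous c

/-- The second derivatives of `(1 - |z|²) p`. -/
def hessL (i j : Fin 2) : smoothSections →ₗ[ℝ] L2Disc :=
  classL ∘ₗ pdL j ∘ₗ pdL i ∘ₗ bdfL

/-- The Laplacian of `(1 - |z|²) p`. -/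
def lapL : smoothSections →ₗ[ℝ] L2Disc := ∑ i, hessL i i

lemma norm_sq_classL (F : smoothSections) :
    ‖classL F‖ ^ 2 = ∑ k, ∫ z, (F : ℂ → Fiber) z k ^ 2 ∂discMeasure := by
  have hc : ∀ k, Continuous fun z => (F : ℂ → Fiber) z k := fun k =>
    (EuclideanSpace.proj k : Fiber →L[ℝ] ℝ).continuous.comp (contDiff_coe F).continuous
  have hi : ∀ k, Integrable (fun z => (F : ℂ → Fiber) z k ^ 2) discMeasure := fun k =>
    integrable_of_continuous ((hc k).pow 2)
  rw [norm_sq_eq_integral, ← integral_finsetSum _ fun k _ => hi k]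
  refine integral_congr_ae ?_
  filter_upwards [coe_toL2 F (contDiff_coe F).continuous] with z hz
  change ‖(toL2 F (contDiff_coe F).continuous) z‖ ^ 2 = _
  rw [hz, EuclideanSpace.norm_sq_eq]
  simp

lemma pd_coord {F : ℂ → Fiber} (hF : ContDiff ℝ ∞ F) (i : Fin 2) (k : Fin 3) :
    pd i (fun z => F z k) = fun z => pd i F z k :=
  pd_clm_comp (EuclideanSpace.proj k : Fiber →L[ℝ] ℝ) hF i

lemma sum_norm_sq_hessL_le (p : smoothSections) :
    ∑ i, ∑ j, ‖hessL i j p‖ ^ 2 ≤ ‖lapL p‖ ^ 2 := by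
  set u : smoothSections := bdfL p with hu
  have hpk : ∀ k, ContDiff ℝ ∞ fun z => (p : ℂ → Fiber) z k := fun k =>
    (EuclideanSpace.proj k : Fiber →L[ℝ] ℝ).contDiff.comp (contDiff_coe p)
  have hk : ∀ k, (fun z => (u : ℂ → Fiber) z k) = fun z => bdf z * (p : ℂ → Fiber) z k := fun k => rfl
  have hd : ∀ i j k z, pd j (pd i fun z => (u : ℂ → Fiber) z k) z
      = (pdL j (pdL i u) : ℂ → Fiber) z k := fun i j k z => by
    rw [pd_coord (contDiff_coe u), pd_coord (contDiff_pd (contDiff_coe u) i)]; rfl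
  have hc : ∀ i j k, Continuous fun z => (pdL j (pdL i u) : ℂ → Fiber) z k := fun i j k =>
    (EuclideanSpace.proj k : Fiber →L[ℝ] ℝ).continuous.comp (contDiff_coe (pdL j (pdL i u))).continuous
  have h1 : ∀ i j, ‖hessL i j p‖ ^ 2
      = ∑ k, ∫ z, (pdL j (pdL i u) : ℂ → Fiber) z k ^ 2 ∂discMeasure := fun i j =>
    norm_sq_classL _
  have h2 : lapL p = classL (∑ i, pdL i (pdL i u)) := by
    rw [map_sum, lapL, LinearMap.sum_apply]; rfl
  rw [h2, norm_sq_classL]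
  simp_rw [h1]
  have e : ∑ i, ∑ j, ∑ k, ∫ z, (pdL j (pdL i u) : ℂ → Fiber) z k ^ 2 ∂discMeasure
      = ∑ k, ∑ i, ∑ j, ∫ z, (pdL j (pdL i u) : ℂ → Fiber) z k ^ 2 ∂discMeasure := by
    simp only [Fin.sum_univ_two, Fin.sum_univ_three]
    ring
  rw [e]
  refine Finset.sum_le_sum fun k _ => ?_
  have := integral_hessian_le (hpk k) (hk k)
  simp_rw [hd] at this
  have e2 : ∀ z, (∑ i, (pdL i (pdL i u) : ℂ → Fiber) z k)
      = ((∑ i, pdL i (pdL i u) : smoothSections) : ℂ → Fiber) z k := fun z => by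
    simp [Fin.sum_univ_two]
  simp_rw [e2] at this
  refine le_trans (le_of_eq ?_) this
  have hi : ∀ i j, Integrable (fun z => (pdL j (pdL i u) : ℂ → Fiber) z k ^ 2) discMeasure :=
    fun i j => integrable_of_continuous ((hc i j k).pow 2)
  rw [integral_finsetSum _ fun i _ => integrable_finsetSum _ fun j _ => hi i j]
  refine Finset.sum_congr rfl fun i _ => ?_
  rw [integral_finsetSum _ fun j _ => hi i j]

/-- The jet of `(1 - |z|²) p`. -/
def bdfJet (p : smoothSections) : Sob := jet (bdfL p) (contDiff_coe (bdfL p))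

lemma bdfJet_mem (p : smoothSections) : bdfJet p ∈ H10 := jet_bdf_smul_mem_H10 (contDiff_coe p)

lemma hasWeakDeriv_bdfJet (p : smoothSections) (i j : Fin 2) :
    HasWeakDeriv j (bdfJet p i.succ) (hessL i j p) :=
  hasWeakDeriv_toL2 (contDiff_coe (pdL i (bdfL p))) j

/-- The Dirichlet energy is `⟨F, u⟩ ≤ 2 ‖F‖ ‖u_x‖` by the Poincaré inequality. The case `F = 0` is
uniqueness for the flat problem. -/
lemma energy_bound {U : Sob} (hU : U ∈ H10) {F : L2Disc}
    (h : ∑ i : Fin 2, ⟪U i.succ, U i.succ⟫_ℝ = ⟪F, U 0⟫_ℝ) :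
    ‖U 0‖ ≤ 4 * ‖F‖ ∧ ∀ i : Fin 2, ‖U i.succ‖ ≤ 2 * ‖F‖ := by
  have h0 : ‖U 0‖ ≤ 2 * ‖U (Fin.succ 0)‖ := by
    have := poincare_of_mem_H10 hU (w := 0) (by
      filter_upwards [Lp.coeFn_zero Fiber 2 discMeasure] with z hz
      rw [hz]; simp)
    simpa using this
  simp only [real_inner_self_eq_norm_sq, Fin.sum_univ_two] at h
  have h1 := real_inner_le_norm F (U 0)
  have n0 := norm_nonneg (U (Fin.succ 0))
  have n1 := norm_nonneg (U (Fin.succ 1))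
  have nF := norm_nonneg F
  have h2 : ‖F‖ * ‖U 0‖ ≤ ‖F‖ * (2 * ‖U (Fin.succ 0)‖) := by gcongr
  have h3 : ‖U (Fin.succ 0)‖ ≤ 2 * ‖F‖ := by nlinarith
  have h4 : ‖U (Fin.succ 1)‖ ≤ 2 * ‖F‖ := by nlinarith
  refine ⟨by linarith, fun i => ?_⟩
  fin_cases i
  · exact h3
  · exact h4

lemma norm_bdfJet_le (p : smoothSections) :
    ‖bdfJet p 0‖ ≤ 4 * ‖lapL p‖ ∧ ∀ i : Fin 2, ‖bdfJet p i.succ‖ ≤ 2 * ‖lapL p‖ := by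
  have := energy_bound (bdfJet_mem p) (F := -lapL p) (by
    rw [lapL, LinearMap.sum_apply, inner_neg_left, sum_inner, ← Finset.sum_neg_distrib]
    exact Finset.sum_congr rfl fun i _ => (hasWeakDeriv_bdfJet p i i).inner_H10 (bdfJet_mem p))
  simpa only [norm_neg] using this

/-! ### Density of the Laplacians of polynomials vanishing on the boundary -/

/-- The monomial `z^a z̄^b`. -/
def mono (a b : ℕ) (z : ℂ) : ℂ := z ^ a * (starRingEnd ℂ) z ^ b

lemma contDiff_mono (a b : ℕ) : ContDiff ℝ ∞ (mono a b) :=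
  (contDiff_id.pow a).mul (Complex.conjCLE.toContinuousLinearMap.contDiff.pow b)

lemma pd_mono (a b : ℕ) (i : Fin 2) : pd i (mono a b) =
    (fun z => (a * dir i) * mono (a - 1) b z) + fun z =>
      (b * (starRingEnd ℂ) (dir i)) * mono a (b - 1) z := by
  funext z
  have h1 : HasFDerivAt (𝕜 := ℝ) (fun z : ℂ => z ^ a) _ z := (hasFDerivAt_id z).pow a
  have h2 : HasFDerivAt (𝕜 := ℝ) (fun z : ℂ => (starRingEnd ℂ) z ^ b) _ z :=
    (Complex.conjCLE.toContinuousLinearMap.hasFDerivAt (x := z)).pow b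
  have h3 : HasFDerivAt (𝕜 := ℝ) (mono a b) _ z := h1.mul h2
  rw [pd, h3.fderiv]
  simp [mono]
  ring

/-- The Laplacian is `4 ∂_z ∂_z̄`. -/
lemma lap_mono (a b : ℕ) (z : ℂ) :
    ∑ i, pd i (pd i (mono (a + 1) (b + 1))) z = 4 * (a + 1) * (b + 1) * mono a b z := by
  have hs : ∀ (c : ℂ) a b, ContDiff ℝ ∞ fun z => c * mono a b z := fun c a b =>
    contDiff_const.mul (contDiff_mono a b)
  have hc : ∀ (c : ℂ) a b i, pd i (fun z => c * mono a b z) = fun z => c * pd i (mono a b) z :=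
    fun c a b i => pd_clm_comp (ContinuousLinearMap.mul ℝ ℂ c) (contDiff_mono a b) i
  simp only [Fin.sum_univ_two, pd_mono, pd_add (hs _ _ _) (hs _ _ _), hc, Pi.add_apply]
  simp [dir]
  ring_nf
  simp
  ring

lemma lap_mono_zero (a : ℕ) (z : ℂ) : ∑ i, pd i (pd i (mono a 0)) z = 0 := by
  have hs : ∀ (c : ℂ) a b, ContDiff ℝ ∞ fun z => c * mono a b z := fun c a b =>
    contDiff_const.mul (contDiff_mono a b)
  have hc : ∀ (c : ℂ) a b i, pd i (fun z => c * mono a b z) = fun z => c * pd i (mono a b) z :=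
    fun c a b i => pd_clm_comp (ContinuousLinearMap.mul ℝ ℂ c) (contDiff_mono a b) i
  simp only [Fin.sum_univ_two, pd_mono, pd_add (hs _ _ _) (hs _ _ _), hc, Pi.add_apply]
  simp [dir]
  ring_nf
  simp

lemma coe_classL (F : smoothSections) : classL F =ᵐ[discMeasure] (F : ℂ → Fiber) :=
  coe_toL2 _ (contDiff_coe F).continuous

lemma ofReal_bdf (z : ℂ) : (bdf z : ℂ) = 1 - z * (starRingEnd ℂ) z := by
  rw [bdf_eq, Complex.mul_conj, Complex.sq_norm]; push_cast; ring

lemma bdf_mul_geom (d b : ℕ) (z : ℂ) :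
    (bdf z : ℂ) * -(mono d 0 z * ∑ k ∈ Finset.range (b + 1), mono k k z)
      = mono (d + b + 1) (b + 1) z - mono d 0 z := by
  have h : ∀ k, mono k k z = (z * (starRingEnd ℂ) z) ^ k := fun k => (mul_pow _ _ _).symm
  have hg := mul_neg_geom_sum (z * (starRingEnd ℂ) z) (b + 1)
  simp_rw [h]
  calc _ = -mono d 0 z * ((1 - z * (starRingEnd ℂ) z) *
        ∑ k ∈ Finset.range (b + 1), (z * (starRingEnd ℂ) z) ^ k) := by rw [ofReal_bdf]; ring
    _ = _ := by rw [hg]; simp only [mono]; ring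

/-- Explicit solution of the Dirichlet problem for a monomial: subtract from `z^{d+b+1} z̄^{b+1}`
the harmonic `z^d`, which has the same values on the circle, and normalize. The difference is
divisible by `1 - |z|²` through a geometric sum. The real linear `L` carries complex monomials into
the fibre. -/
lemma exists_lapL_eq_mono (d b : ℕ) (L : ℂ →L[ℝ] Fiber) : ∃ p : smoothSections,
    lapL p =ᵐ[discMeasure] fun z => L (mono (d + b) b z) := by
  set c : ℂ := (4 * ((d + b : ℕ) + 1) * (b + 1) : ℂ)⁻¹ with hc
  have hc0 : (4 * ((d + b : ℕ) + 1) * (b + 1) : ℂ) ≠ 0 := by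
    have h1 : ((d + b : ℕ) : ℂ) + 1 ≠ 0 := Nat.cast_add_one_ne_zero _
    have h2 : (b : ℂ) + 1 ≠ 0 := Nat.cast_add_one_ne_zero _
    exact mul_ne_zero (mul_ne_zero (by norm_num) h1) h2
  set L' : ℂ →L[ℝ] Fiber := L.comp (ContinuousLinearMap.mul ℝ ℂ c) with hL'
  have hps : ContDiff ℝ ∞ fun z => L' (-(mono d 0 z * ∑ k ∈ Finset.range (b + 1), mono k k z)) :=
    L'.contDiff.comp (((contDiff_mono d 0).mul (ContDiff.sum fun k _ => contDiff_mono k k)).neg)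
  set M : ℂ → ℂ := mono (d + b + 1) (b + 1) - mono d 0 with hM
  have hMs : ContDiff ℝ ∞ M := (contDiff_mono _ _).sub (contDiff_mono _ _)
  have hu : (bdfL ⟨_, hps⟩ : ℂ → Fiber) = fun z => L' (M z) := by
    funext z
    change bdf z • L' _ = _
    rw [← map_smul, Complex.real_smul, bdf_mul_geom]; rfl
  have hlap : ∀ z, ∑ i, pd i (pd i fun z => L' (M z)) z = L (mono (d + b) b z) := fun z => by
    have h1 : ∀ i, pd i (pd i fun z => L' (M z)) z = L' (pd i (pd i M) z) := fun i => by
      rw [pd_clm_comp L' hMs, pd_clm_comp L' (contDiff_pd hMs i)]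
    have h2 : ∀ i, pd i (pd i M) z
        = pd i (pd i (mono (d + b + 1) (b + 1))) z - pd i (pd i (mono d 0)) z := fun i => by
      rw [hM, pd_sub (contDiff_mono _ _) (contDiff_mono _ _),
        pd_sub (contDiff_pd (contDiff_mono _ _) i) (contDiff_pd (contDiff_mono _ _) i)]; rfl
    simp_rw [h1, ← map_sum, h2, Finset.sum_sub_distrib, lap_mono_zero, lap_mono, sub_zero]
    rw [hL']
    change L (c * _) = _
    rw [hc, inv_mul_cancel_left₀ hc0]
  refine ⟨⟨_, hps⟩, ?_⟩
  have e : lapL ⟨_, hps⟩ = classL (∑ i, pdL i (pdL i (bdfL ⟨_, hps⟩))) := by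
    rw [map_sum, lapL, LinearMap.sum_apply]; rfl
  rw [e]
  filter_upwards [coe_classL (∑ i, pdL i (pdL i (bdfL ⟨_, hps⟩)))] with z hz
  rw [hz, ← hlap z, ← hu]
  simp [Fin.sum_univ_two]
  rfl

lemma integral_inner_mono_eq_zero {v : L2Disc} (hv : ∀ p, ⟪lapL p, v⟫_ℝ = 0) (a b : ℕ)
    (L : ℂ →L[ℝ] Fiber) : ∫ z, ⟪L (mono a b z), v z⟫_ℝ ∂discMeasure = 0 := by
  have key : ∀ d b (L : ℂ →L[ℝ] Fiber),
      ∫ z, ⟪L (mono (d + b) b z), v z⟫_ℝ ∂discMeasure = 0 := fun d b L => by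
    obtain ⟨p, hp⟩ := exists_lapL_eq_mono d b L
    rw [← hv p, L2.inner_def]
    refine integral_congr_ae ?_
    filter_upwards [hp] with z hz
    rw [hz]
  rcases le_total b a with h | h
  · obtain ⟨d, rfl⟩ := Nat.exists_eq_add_of_le' h
    exact key d b L
  · obtain ⟨d, rfl⟩ := Nat.exists_eq_add_of_le' h
    -- If the power of `z̄` dominates, the conjugation is absorbed into `L`.
    have := key d a (L.comp Complex.conjCLE.toContinuousLinearMap)
    have hm : ∀ z, (starRingEnd ℂ) (mono (d + a) a z) = mono a (d + a) z := fun z => by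
      simp [mono, mul_comm]
    simp only [← hm]
    exact this

lemma integrable_inner_of_continuous {F : ℂ → Fiber} (hF : Continuous F) (v : L2Disc) :
    Integrable (fun z => ⟪F z, v z⟫_ℝ) discMeasure := by
  refine (L2.integrable_inner (toL2 F hF) v).congr ?_
  filter_upwards [coe_toL2 F hF] with z hz
  rw [hz]

/-- Uniform density of polynomials in `z` and `z̄` on the closed disc. -/
lemma exists_mem_span_mono_near {θ : ℂ → ℂ} (hθ : Continuous θ) {ε : ℝ} (hε : 0 < ε) :
    ∃ q ∈ Submodule.span ℂ (range fun n : ℕ × ℕ => mono n.1 n.2),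
      ∀ z ∈ Metric.ball (0 : ℂ) 1, ‖θ z - q z‖ ≤ ε := by
  set K : Set ℂ := Metric.closedBall 0 1
  have : CompactSpace K := isCompact_iff_compactSpace.1 (isCompact_closedBall 0 1)
  let X : C(K, ℂ) := ⟨fun z => z, continuous_subtype_val⟩
  have hsep : (StarAlgebra.adjoin ℂ {X}).SeparatesPoints := fun x y hxy =>
    ⟨X, ⟨X, StarAlgebra.subset_adjoin ℂ _ (mem_singleton _), rfl⟩,
      fun h => hxy (Subtype.ext h)⟩
  -- Stone–Weierstrass: the coordinate function alone separates points, and the star algebra it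
  -- generates is spanned by the monomials `z^a z̄^b`.
  have htop := ContinuousMap.starSubalgebra_topologicalClosure_eq_top_of_separatesPoints _ hsep
  let f : C(K, ℂ) := ⟨fun z => θ z, hθ.comp continuous_subtype_val⟩
  have hf : f ∈ closure ((StarAlgebra.adjoin ℂ {X} : StarSubalgebra ℂ C(K, ℂ)) : Set C(K, ℂ)) := by
    rw [← StarSubalgebra.topologicalClosure_coe, htop]; trivial
  obtain ⟨g, hg, hfg⟩ := Metric.mem_closure_iff.1 hf ε hε
  have hmon : ∀ m ∈ Submonoid.closure ({X} ∪ star {X} : Set C(K, ℂ)), ∃ n : ℕ × ℕ,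
      ∀ z : K, m z = mono n.1 n.2 z := fun m hm => by
    induction hm using Submonoid.closure_induction with
    | mem x hx =>
      rcases hx with hx | hx
      · refine ⟨(1, 0), fun z => ?_⟩
        rw [mem_singleton_iff.1 hx]; simp [mono, X]
      · refine ⟨(0, 1), fun z => ?_⟩
        have hx' : star x = X := hx
        rw [← star_star x, hx']; simp [mono, X]
    | one => exact ⟨(0, 0), fun z => by simp [mono]⟩
    | mul x y _ _ hx hy =>
      obtain ⟨n, hn⟩ := hx
      obtain ⟨m, hm⟩ := hy
      refine ⟨(n.1 + m.1, n.2 + m.2), fun z => ?_⟩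
      rw [ContinuousMap.mul_apply, hn, hm]; simp only [mono, pow_add]; ring
  have hspan : g ∈ Submodule.span ℂ
      (Submonoid.closure ({X} ∪ star {X} : Set C(K, ℂ)) : Set C(K, ℂ)) := by
    rw [← Algebra.adjoin_eq_span]; exact hg
  have hex : ∃ q ∈ Submodule.span ℂ (range fun n : ℕ × ℕ => mono n.1 n.2), ∀ z : K, g z = q z := by
    clear hfg hg
    induction hspan using Submodule.span_induction with
    | mem x hx =>
      obtain ⟨n, hn⟩ := hmon x hx
      exact ⟨_, Submodule.subset_span ⟨n, rfl⟩, hn⟩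
    | zero => exact ⟨0, Submodule.zero_mem _, fun z => rfl⟩
    | add x y _ _ hx hy =>
      obtain ⟨q, hq, hq'⟩ := hx
      obtain ⟨r, hr, hr'⟩ := hy
      exact ⟨q + r, Submodule.add_mem _ hq hr, fun z => by
        rw [ContinuousMap.add_apply, hq', hr', Pi.add_apply]⟩
    | smul c x _ hx =>
      obtain ⟨q, hq, hq'⟩ := hx
      exact ⟨c • q, Submodule.smul_mem _ c hq, fun z => by
        rw [ContinuousMap.smul_apply, hq', Pi.smul_apply]⟩
  obtain ⟨q, hq, hgq⟩ := hex
  refine ⟨q, hq, fun z hz => ?_⟩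
  have hzK : z ∈ K := Metric.ball_subset_closedBall hz
  have h1 := ContinuousMap.dist_apply_le_dist (f := f) (g := g) ⟨z, hzK⟩
  rw [hgq ⟨z, hzK⟩, dist_eq_norm] at h1
  exact h1.trans hfg.le

lemma integral_inner_continuous_eq_zero {v : L2Disc} (hv : ∀ p, ⟪lapL p, v⟫_ℝ = 0) {θ : ℂ → ℂ}
    (hθ : Continuous θ) (L : ℂ →L[ℝ] Fiber) : ∫ z, ⟪L (θ z), v z⟫_ℝ ∂discMeasure = 0 := by
  have hq : ∀ q ∈ Submodule.span ℂ (range fun n : ℕ × ℕ => mono n.1 n.2), Continuous q ∧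
      ∀ L : ℂ →L[ℝ] Fiber, ∫ z, ⟪L (q z), v z⟫_ℝ ∂discMeasure = 0 := fun q hq => by
    induction hq using Submodule.span_induction with
    | mem x hx =>
      obtain ⟨n, rfl⟩ := hx
      exact ⟨(contDiff_mono _ _).continuous, fun L => integral_inner_mono_eq_zero hv _ _ L⟩
    | zero => exact ⟨continuous_const, fun L => by simp⟩
    | add x y _ _ hx hy =>
      refine ⟨hx.1.add hy.1, fun L => ?_⟩
      simp only [Pi.add_apply, map_add, inner_add_left]
      rw [integral_add (integrable_inner_of_continuous (F := fun z => L (x z)) (L.continuous.comp hx.1) v)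
        (integrable_inner_of_continuous (F := fun z => L (y z)) (L.continuous.comp hy.1) v), hx.2, hy.2, add_zero]
    | smul c x _ hx =>
      exact ⟨hx.1.const_smul c, fun L => hx.2 (L.comp (ContinuousLinearMap.mul ℝ ℂ c))⟩
  have hvi : Integrable (fun z => ‖v z‖) discMeasure :=
    ((Lp.memLp v).integrable one_le_two).norm
  have hbound : ∀ ε : ℝ, 0 < ε → |∫ z, ⟪L (θ z), v z⟫_ℝ ∂discMeasure|
      ≤ ε * (‖L‖ * ∫ z, ‖v z‖ ∂discMeasure) := fun ε hε => by
    obtain ⟨q, hqs, hqe⟩ := exists_mem_span_mono_near hθ hε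
    obtain ⟨hqc, hq0⟩ := hq q hqs
    have e : ∫ z, ⟪L (θ z), v z⟫_ℝ ∂discMeasure
        = ∫ z, ⟪L (θ z - q z), v z⟫_ℝ ∂discMeasure := by
      simp only [map_sub, inner_sub_left]
      rw [integral_sub (integrable_inner_of_continuous (F := fun z => L (θ z)) (L.continuous.comp hθ) v)
        (integrable_inner_of_continuous (F := fun z => L (q z)) (L.continuous.comp hqc) v), hq0, sub_zero]
    rw [e, ← Real.norm_eq_abs, ← mul_assoc, ← integral_const_mul]
    refine norm_integral_le_of_norm_le (hvi.const_mul _) (ae_disc fun z hz => ?_)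
    refine (norm_inner_le_norm _ _).trans ?_
    rw [mul_comm ε]
    gcongr
    exact (L.le_opNorm _).trans (by gcongr; exact hqe z hz)
  refine abs_eq_zero.1 (le_antisymm (le_of_forall_pos_le_add fun δ hδ => ?_) (abs_nonneg _))
  set A := ‖L‖ * ∫ z, ‖v z‖ ∂discMeasure
  have hA : 0 ≤ A := mul_nonneg (norm_nonneg _) (integral_nonneg fun z => norm_nonneg _)
  have h1 := hbound (δ / (A + 1)) (by positivity)
  have h2 : δ / (A + 1) * A ≤ δ := by
    rw [div_mul_eq_mul_div, div_le_iff₀ (by positivity)]; nlinarith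
  linarith

lemma eq_zero_of_orthogonal_lapL {v : L2Disc} (hv : ∀ p, ⟪lapL p, v⟫_ℝ = 0) : v = 0 := by
  refine eq_zero_of_forall_inner_test fun χ => ?_
  rw [testJet_apply, jet_zero, L2.inner_def]
  have hc : ∀ k, Continuous fun z => (χ z k : ℂ) := fun k =>
    Complex.continuous_ofReal.comp ((EuclideanSpace.proj k : Fiber →L[ℝ] ℝ).continuous.comp
      (contDiff_test χ).continuous)
  have h1 := fun k => integral_inner_continuous_eq_zero hv (hc k)
    (Complex.reCLM.smulRight (EuclideanSpace.single k (1 : ℝ) : Fiber))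
  have h2 : ∑ k, ∫ z, ⟪(Complex.reCLM.smulRight (EuclideanSpace.single k (1 : ℝ) : Fiber))
      (χ z k : ℂ), v z⟫_ℝ ∂discMeasure = 0 := Finset.sum_eq_zero fun k _ => h1 k
  rw [← integral_finsetSum _ fun k _ => integrable_inner_of_continuous
    (F := fun z => (Complex.reCLM.smulRight (EuclideanSpace.single k (1 : ℝ) : Fiber)) (χ z k : ℂ))
    ((Complex.reCLM.smulRight (EuclideanSpace.single k (1 : ℝ) : Fiber)).continuous.comp (hc k)) v]
    at h2
  rw [← h2]
  refine integral_congr_ae ?_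
  filter_upwards [coe_toL2 χ (contDiff_test χ).continuous] with z hz
  rw [hz, ← sum_inner]
  congr 1
  ext k
  simp [Fin.sum_univ_three]
  fin_cases k <;> simp

lemma dense_range_lapL : (LinearMap.range lapL).topologicalClosure = ⊤ := by
  rw [Submodule.topologicalClosure_eq_top_iff, Submodule.eq_bot_iff]
  intro v hv
  exact eq_zero_of_orthogonal_lapL fun p => hv _ (LinearMap.mem_range_self _ p)

/-- A linear map bounded relative to the Laplacian sends sequences with convergent Laplacians to
Cauchy sequences; applied to the section, its gradient and its Hessian. -/
lemma exists_tendsto_of_norm_le {A : smoothSections →ₗ[ℝ] L2Disc} {C : ℝ}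
    (hA : ∀ p, ‖A p‖ ≤ C * ‖lapL p‖) {p : ℕ → smoothSections} {F : L2Disc}
    (hp : Tendsto (fun n => lapL (p n)) atTop (𝓝 F)) :
    ∃ w, Tendsto (fun n => A (p n)) atTop (𝓝 w) := by
  refine cauchySeq_tendsto_of_complete (cauchySeq_iff_tendsto_dist_atTop_0.2 ?_)
  have h1 := (cauchySeq_iff_tendsto_dist_atTop_0.1 hp.cauchySeq).const_mul C
  rw [mul_zero] at h1
  refine squeeze_zero (fun _ => dist_nonneg) (fun n => ?_) h1
  rw [dist_eq_norm, dist_eq_norm, ← map_sub, ← map_sub]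
  exact hA _

lemma norm_hessL_le (i j : Fin 2) (p : smoothSections) : ‖hessL i j p‖ ≤ 1 * ‖lapL p‖ := by
  rw [one_mul]
  refine pow_le_pow_iff_left₀ (norm_nonneg _) (norm_nonneg _) two_ne_zero |>.1 ?_
  refine le_trans ?_ (sum_norm_sq_hessL_le p)
  refine le_trans ?_ (Finset.single_le_sum (f := fun i => ∑ j, ‖hessL i j p‖ ^ 2)
    (fun i _ => Finset.sum_nonneg fun j _ => sq_nonneg _) (Finset.mem_univ i))
  exact Finset.single_le_sum (f := fun j => ‖hessL i j p‖ ^ 2)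
    (fun j _ => sq_nonneg _) (Finset.mem_univ j)

lemma exists_tendsto_bdfJet {p : ℕ → smoothSections} {F : L2Disc}
    (hp : Tendsto (fun n => lapL (p n)) atTop (𝓝 F)) :
    ∃ U : Sob, Tendsto (fun n => bdfJet (p n)) atTop (𝓝 U) := by
  obtain ⟨u, hu⟩ := exists_tendsto_of_norm_le (A := classL ∘ₗ bdfL) (C := 4)
    (fun p => (norm_bdfJet_le p).1) hp
  have hG : ∀ i : Fin 2, ∃ w, Tendsto (fun n => (classL ∘ₗ pdL i ∘ₗ bdfL) (p n)) atTop (𝓝 w) :=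
    fun i => exists_tendsto_of_norm_le (A := classL ∘ₗ pdL i ∘ₗ bdfL) (C := 2)
      (fun p => (norm_bdfJet_le p).2 i) hp
  choose g hg using hG
  exact ⟨WithLp.toLp 2 (Fin.cons u g : Fin 3 → L2Disc), tendsto_sob hu hg⟩

/-- Solvability of the Dirichlet problem in `H² ∩ H¹₀` with the sharp bound of the Hessian. -/
lemma exists_dirichlet_solution (F : L2Disc) : ∃ U ∈ H10, ∃ H : Fin 2 → Fin 2 → L2Disc,
    (∀ i j, HasWeakDeriv j (U i.succ) (H i j)) ∧ F = -∑ i, H i i ∧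
      ∑ i, ∑ j, ‖H i j‖ ^ 2 ≤ ‖F‖ ^ 2 := by
  have hF : -F ∈ closure (LinearMap.range lapL : Set L2Disc) := by
    rw [← Submodule.topologicalClosure_coe, dense_range_lapL]; trivial
  obtain ⟨x, hx, hlim⟩ := mem_closure_iff_seq_limit.1 hF
  choose p hp using hx
  replace hlim : Tendsto (fun n => lapL (p n)) atTop (𝓝 (-F)) := by simpa only [hp] using hlim
  have hH : ∀ i j, ∃ w, Tendsto (fun n => hessL i j (p n)) atTop (𝓝 w) := fun i j =>
    exists_tendsto_of_norm_le (norm_hessL_le i j) hlim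
  choose H hH using hH
  obtain ⟨U, hU⟩ := exists_tendsto_bdfJet hlim
  have hg : ∀ i : Fin 2, Tendsto (fun n => bdfJet (p n) i.succ) atTop (𝓝 (U i.succ)) := fun i =>
    ((continuous_coord i.succ).tendsto U).comp hU
  have hsum : Tendsto (fun n => lapL (p n)) atTop (𝓝 (∑ i, H i i)) := by
    have := tendsto_finsetSum Finset.univ fun i (_ : i ∈ Finset.univ) => hH i i
    simpa only [lapL, LinearMap.sum_apply] using this
  have hFH : F = -∑ i, H i i := by
    rw [← tendsto_nhds_unique hlim hsum, neg_neg]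
  refine ⟨U, isClosed_H10.mem_of_tendsto hU (Eventually.of_forall fun n => bdfJet_mem _), H,
    fun i j => HasWeakDeriv.of_tendsto (fun n => hasWeakDeriv_bdfJet (p n) i j) (hg i) (hH i j),
    hFH, ?_⟩
  have h1 : Tendsto (fun n => ∑ i, ∑ j, ‖hessL i j (p n)‖ ^ 2) atTop
      (𝓝 (∑ i, ∑ j, ‖H i j‖ ^ 2)) :=
    tendsto_finsetSum _ fun i _ => tendsto_finsetSum _ fun j _ => (hH i j).norm.pow 2
  have h2 := hlim.norm.pow 2
  rw [norm_neg] at h2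
  exact le_of_tendsto_of_tendsto' h1 h2 fun n => sum_norm_sq_hessL_le _

/-! ### First order perturbations of the Dirichlet Laplacian -/

/-- Bounded skew-symmetric potentials `A i` with derivatives `B i`, of a connection on `L²(D)`, and
a nonnegative bounded potential `N`. -/
structure IsPotential (A B : Fin 2 → L2Disc →L[ℝ] L2Disc) (N : L2Disc →L[ℝ] L2Disc) : Prop where
  hasWeakDeriv : ∀ i u g, HasWeakDeriv i u g → HasWeakDeriv i (A i u) (B i u + A i g)
  skew : ∀ i u, ∀ᵐ z ∂discMeasure, ⟪u z, A i u z⟫_ℝ = 0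
  nonneg : ∀ u, 0 ≤ ⟪N u, u⟫_ℝ

/-- `p = ∂_i u + A_i u`, weakly. -/
def CovDeriv (A : Fin 2 → L2Disc →L[ℝ] L2Disc) (i : Fin 2) (u p : L2Disc) : Prop :=
  ∃ g, HasWeakDeriv i u g ∧ p = g + A i u

/-- `v = -∑ (∂_i + A_i)² u + N u`, weakly. -/
def PerturbedLaplacian (A : Fin 2 → L2Disc →L[ℝ] L2Disc) (N : L2Disc →L[ℝ] L2Disc)
    (u v : L2Disc) : Prop :=
  ∃ p q : Fin 2 → L2Disc,
    (∀ i, CovDeriv A i u (p i) ∧ CovDeriv A i (p i) (q i)) ∧ v = -∑ i, q i + N u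

lemma CovDeriv.unique {A : Fin 2 → L2Disc →L[ℝ] L2Disc} {i : Fin 2} {u p p' : L2Disc}
    (h : CovDeriv A i u p) (h' : CovDeriv A i u p') : p = p' := by
  obtain ⟨g, hg, rfl⟩ := h
  obtain ⟨g', hg', rfl⟩ := h'
  rw [hg.unique hg']

lemma PerturbedLaplacian.unique {A : Fin 2 → L2Disc →L[ℝ] L2Disc} {N : L2Disc →L[ℝ] L2Disc}
    {u v v' : L2Disc} (h : PerturbedLaplacian A N u v) (h' : PerturbedLaplacian A N u v') :
    v = v' := by
  obtain ⟨p, q, hpq, rfl⟩ := h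
  obtain ⟨p', q', hpq', rfl⟩ := h'
  obtain rfl : p = p' := funext fun i => (hpq i).1.unique (hpq' i).1
  obtain rfl : q = q' := funext fun i => (hpq i).2.unique (hpq' i).2
  rfl

/-- Restriction of the coordinates of a jet to `H¹₀`. -/
def coordH10 (k : Fin 3) : H10 →L[ℝ] L2Disc := (PiLp.proj 2 _ k).comp H10.subtypeL

lemma coordH10_apply (k : Fin 3) (U : H10) : coordH10 k U = (U : Sob) k := rfl

/-- The covariant derivative on `H¹₀`. -/
def covH10 (A : Fin 2 → L2Disc →L[ℝ] L2Disc) (i : Fin 2) : H10 →L[ℝ] L2Disc :=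
  coordH10 i.succ + (A i).comp (coordH10 0)

lemma covH10_apply (A : Fin 2 → L2Disc →L[ℝ] L2Disc) (i : Fin 2) (U : H10) :
    covH10 A i U = (U : Sob) i.succ + A i ((U : Sob) 0) := rfl

/-- The energy form of the perturbed Laplacian. -/
def energyForm (A : Fin 2 → L2Disc →L[ℝ] L2Disc) (N : L2Disc →L[ℝ] L2Disc) :
    H10 →L[ℝ] H10 →L[ℝ] ℝ :=
  ∑ i, (isBoundedBilinearMap_inner (𝕜 := ℝ)).toContinuousLinearMap.bilinearComp
      (covH10 A i) (covH10 A i) +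
    (isBoundedBilinearMap_inner (𝕜 := ℝ)).toContinuousLinearMap.bilinearComp
      (N.comp (coordH10 0)) (coordH10 0)

lemma energyForm_apply (A : Fin 2 → L2Disc →L[ℝ] L2Disc) (N : L2Disc →L[ℝ] L2Disc) (U W : H10) :
    energyForm A N U W
      = ∑ i, ⟪covH10 A i U, covH10 A i W⟫_ℝ + ⟪N ((U : Sob) 0), (W : Sob) 0⟫_ℝ := by
  simp [energyForm, Fin.sum_univ_two, coordH10_apply]

namespace IsPotential

variable {A B : Fin 2 → L2Disc →L[ℝ] L2Disc} {N : L2Disc →L[ℝ] L2Disc}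

lemma inner_self (h : IsPotential A B N) (i : Fin 2) (u : L2Disc) : ⟪u, A i u⟫_ℝ = 0 := by
  rw [L2.inner_def]
  exact integral_eq_zero_of_ae (h.skew i u)

lemma inner_left (h : IsPotential A B N) (i : Fin 2) (u v : L2Disc) :
    ⟪A i u, v⟫_ℝ = -⟪u, A i v⟫_ℝ := by
  have h1 := h.inner_self i (u + v)
  rw [map_add, inner_add_left, inner_add_right, inner_add_right, h.inner_self, h.inner_self] at h1
  rw [real_inner_comm]
  linarith

/-- The constant does not depend on the potentials; this is the source of the uniformity in `t`. -/
lemma norm_coord_le (h : IsPotential A B N) (U : H10) :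
    ‖(U : Sob) 0‖ ≤ 2 * ‖covH10 A 0 U‖ :=
  poincare_of_mem_H10 U.2 (h.skew 0 _)

/-- The coercivity constant depends on `‖A i‖`, hence later on `t`. It serves only the existence and
uniqueness of weak solutions; uniform bounds come from `energy_le`. -/
lemma isCoercive (h : IsPotential A B N) : IsCoercive (energyForm A N) := by
  set k := ‖A 0‖ + ‖A 1‖ with hk
  have hk0 : 0 ≤ k := by positivity
  have hA : ∀ i, ‖A i‖ ≤ k := fun i => by
    fin_cases i
    · exact le_add_of_nonneg_right (norm_nonneg (A 1))
    · exact le_add_of_nonneg_left (norm_nonneg (A 0))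
  refine ⟨(8 + 16 * k ^ 2)⁻¹, by positivity, fun U => ?_⟩
  have h0 := h.norm_coord_le U
  have h1 : ∀ i : Fin 2, ‖(U : Sob) i.succ‖ ≤ ‖covH10 A i U‖ + k * ‖(U : Sob) 0‖ := fun i => by
    have e : (U : Sob) i.succ = covH10 A i U - A i ((U : Sob) 0) := by rw [covH10_apply]; abel
    rw [e]
    refine (norm_sub_le _ _).trans ?_
    gcongr
    exact (A i).le_of_opNorm_le (hA i) _
  have hn : ‖U‖ ^ 2 = ‖(U : Sob) 0‖ ^ 2 + ∑ i : Fin 2, ‖(U : Sob) i.succ‖ ^ 2 := by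
    rw [Submodule.coe_norm, PiLp.norm_sq_eq_of_L2, Fin.sum_univ_succ]
  rw [mul_assoc, inv_mul_le_iff₀ (by positivity), ← sq, hn, energyForm_apply]
  simp only [real_inner_self_eq_norm_sq, Fin.sum_univ_two]
  have h2 := h.nonneg ((U : Sob) 0)
  set c0 := ‖covH10 A 0 U‖
  set c1 := ‖covH10 A 1 U‖
  have n0 : 0 ≤ ‖(U : Sob) 0‖ := norm_nonneg _
  have sq1 : ‖(U : Sob) 0‖ ^ 2 ≤ 4 * c0 ^ 2 := by
    calc _ ≤ (2 * c0) ^ 2 := by gcongr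
      _ = _ := by ring
  have sq2 : ∀ i : Fin 2, ‖(U : Sob) i.succ‖ ^ 2
      ≤ 2 * ‖covH10 A i U‖ ^ 2 + 8 * k ^ 2 * c0 ^ 2 := fun i => by
    calc _ ≤ (‖covH10 A i U‖ + k * ‖(U : Sob) 0‖) ^ 2 := by gcongr; exact h1 i
      _ ≤ 2 * ‖covH10 A i U‖ ^ 2 + 2 * (k ^ 2 * ‖(U : Sob) 0‖ ^ 2) := by
        nlinarith [sq_nonneg (‖covH10 A i U‖ - k * ‖(U : Sob) 0‖)]
      _ ≤ 2 * ‖covH10 A i U‖ ^ 2 + 2 * (k ^ 2 * (4 * c0 ^ 2)) := by gcongr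
      _ = _ := by ring
  have s0 := sq2 0
  have s1 := sq2 1
  have hc : 0 ≤ k ^ 2 * c1 ^ 2 := by positivity
  have hN : 0 ≤ (8 + 16 * k ^ 2) * ⟪N ((U : Sob) 0), (U : Sob) 0⟫_ℝ := by positivity
  have hc1 : 0 ≤ c1 ^ 2 := by positivity
  have hc0 : 0 ≤ c0 ^ 2 := by positivity
  nlinarith

/-- The weak solution of the perturbed Dirichlet problem. -/
def weakSolution (h : IsPotential A B N) : L2Disc →L[ℝ] H10 :=
  (h.isCoercive.continuousLinearEquivOfBilin.symm : H10 →L[ℝ] H10).comp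
    (ContinuousLinearMap.adjoint (coordH10 0))

lemma energyForm_weakSolution (h : IsPotential A B N) (v : L2Disc) (W : H10) :
    energyForm A N (h.weakSolution v) W = ⟪v, (W : Sob) 0⟫_ℝ := by
  rw [← h.isCoercive.continuousLinearEquivOfBilin_apply, weakSolution,
    ContinuousLinearMap.comp_apply, ContinuousLinearEquiv.coe_coe,
    ContinuousLinearEquiv.apply_symm_apply, ContinuousLinearMap.adjoint_inner_left, coordH10_apply]

lemma eq_weakSolution (h : IsPotential A B N) {U : H10} {v : L2Disc}
    (hU : ∀ W, energyForm A N U W = ⟪v, (W : Sob) 0⟫_ℝ) : U = h.weakSolution v := by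
  apply h.isCoercive.continuousLinearEquivOfBilin.injective
  refine ext_inner_right ℝ fun W => ?_
  rw [h.isCoercive.continuousLinearEquivOfBilin_apply,
    h.isCoercive.continuousLinearEquivOfBilin_apply, hU, h.energyForm_weakSolution]

/-- The inverse of the perturbed Laplacian. -/
def green (h : IsPotential A B N) : L2Disc →L[ℝ] L2Disc := (coordH10 0).comp h.weakSolution

lemma green_apply (h : IsPotential A B N) (v : L2Disc) :
    h.green v = (h.weakSolution v : Sob) 0 := rfl

/-- Test the equation with its solution: the covariant energy is at most `⟨v, u⟩ ≤ 2 ‖v‖ ‖∇_x u‖`,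
as `N ≥ 0`. -/
lemma energy_le (h : IsPotential A B N) (v : L2Disc) :
    ‖h.green v‖ ≤ 4 * ‖v‖ ∧ ∀ i, ‖covH10 A i (h.weakSolution v)‖ ≤ 2 * ‖v‖ := by
  have h1 := h.energyForm_weakSolution v (h.weakSolution v)
  rw [energyForm_apply] at h1
  simp only [real_inner_self_eq_norm_sq, Fin.sum_univ_two, ← green_apply] at h1
  have h0 := h.norm_coord_le (h.weakSolution v)
  rw [← green_apply] at h0
  have h2 := h.nonneg (h.green v)
  have h3 := real_inner_le_norm v (h.green v)
  have n0 := norm_nonneg (covH10 A 0 (h.weakSolution v))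
  have n1 := norm_nonneg (covH10 A 1 (h.weakSolution v))
  have nF := norm_nonneg v
  have h4 : ‖v‖ * ‖h.green v‖ ≤ ‖v‖ * (2 * ‖covH10 A 0 (h.weakSolution v)‖) := by gcongr
  have h5 : ‖covH10 A 0 (h.weakSolution v)‖ ≤ 2 * ‖v‖ := by nlinarith
  have h6 : ‖covH10 A 1 (h.weakSolution v)‖ ≤ 2 * ‖v‖ := by nlinarith
  refine ⟨by linarith, fun i => ?_⟩
  fin_cases i
  · exact h5
  · exact h6

lemma norm_green_le (h : IsPotential A B N) : ‖h.green‖ ≤ 4 :=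
  h.green.opNorm_le_bound (by norm_num) fun v => (h.energy_le v).1

/-! ### Second order regularity and the `H²` bound -/

/-- The right hand side of the flat Laplace equation solved by `green v`. -/
def flatSource (h : IsPotential A B N) (v : L2Disc) : L2Disc :=
  v - N (h.green v) + ∑ i, (B i (h.green v) + (2 : ℝ) • A i ((h.weakSolution v : Sob) i.succ)
    + A i (A i (h.green v)))

/-- Expand the covariant energy. Skewness moves `A i` off the test section, and the product rule for
`A i u` converts the remaining derivative of the test section; one `A i u_i` comes from each, whence
the factor `2`. -/
lemma sum_inner_weakSolution (h : IsPotential A B N) (v : L2Disc) (W : H10) :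
    ∑ i : Fin 2, ⟪(h.weakSolution v : Sob) i.succ, (W : Sob) i.succ⟫_ℝ
      = ⟪h.flatSource v, (W : Sob) 0⟫_ℝ := by
  have h1 := h.energyForm_weakSolution v W
  rw [energyForm_apply, ← green_apply] at h1
  have h2 : ∀ i : Fin 2, ⟪covH10 A i (h.weakSolution v), covH10 A i W⟫_ℝ
      = ⟪(h.weakSolution v : Sob) i.succ, (W : Sob) i.succ⟫_ℝ
        - ⟪B i (h.green v) + (2 : ℝ) • A i ((h.weakSolution v : Sob) i.succ)
          + A i (A i (h.green v)), (W : Sob) 0⟫_ℝ := fun i => by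
    have e1 := (h.hasWeakDeriv i _ _ (hasWeakDeriv_of_mem_H10 (h.weakSolution v).2 i)).inner_H10 W.2
    have e2 := h.inner_left i ((h.weakSolution v : Sob) i.succ) ((W : Sob) 0)
    have e3 := h.inner_left i (A i (h.green v)) ((W : Sob) 0)
    rw [covH10_apply, covH10_apply, ← green_apply]
    rw [← green_apply] at e1
    simp only [inner_add_left, inner_add_right, real_inner_smul_left] at e1 ⊢
    linarith
  simp_rw [h2, Finset.sum_sub_distrib] at h1
  rw [flatSource, inner_add_left, inner_sub_left, sum_inner]
  linarith

/-- Regularity without difference quotients: the flat Dirichlet problem with source `flatSource v`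
has a solution with second derivatives, and its difference to the weak solution has zero energy. -/
lemma exists_hessian (h : IsPotential A B N) (v : L2Disc) : ∃ H : Fin 2 → Fin 2 → L2Disc,
    (∀ i j, HasWeakDeriv j ((h.weakSolution v : Sob) i.succ) (H i j)) ∧
      h.flatSource v = -∑ i, H i i ∧ ∑ i, ∑ j, ‖H i j‖ ^ 2 ≤ ‖h.flatSource v‖ ^ 2 := by
  obtain ⟨U, hU, H, hH, hF, hb⟩ := exists_dirichlet_solution (h.flatSource v)
  have key : (h.weakSolution v : Sob) - U = 0 := by
    have hD : (h.weakSolution v : Sob) - U ∈ H10 := H10.sub_mem (h.weakSolution v).2 hU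
    have e : ∑ i : Fin 2, ⟪((h.weakSolution v : Sob) - U) i.succ,
        ((h.weakSolution v : Sob) - U) i.succ⟫_ℝ
          = ⟪(0 : L2Disc), ((h.weakSolution v : Sob) - U) 0⟫_ℝ := by
      have e1 := h.sum_inner_weakSolution v ⟨_, hD⟩
      have e2 : ∑ i : Fin 2, ⟪U i.succ, ((h.weakSolution v : Sob) - U) i.succ⟫_ℝ
          = ⟪h.flatSource v, ((h.weakSolution v : Sob) - U) 0⟫_ℝ := by
        rw [hF, inner_neg_left, sum_inner, ← Finset.sum_neg_distrib]
        exact Finset.sum_congr rfl fun i _ => (hH i i).inner_H10 hD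
      have e3 : ∀ i : Fin 2, ((h.weakSolution v : Sob) - U) i.succ
          = (h.weakSolution v : Sob) i.succ - U i.succ := fun i => rfl
      rw [inner_zero_left]
      conv_lhs => enter [2, i]; rw [e3 i, inner_sub_left, ← e3 i]
      rw [Finset.sum_sub_distrib, e2]
      linarith
    obtain ⟨b0, b1⟩ := energy_bound hD e
    rw [norm_zero, mul_zero] at b0
    refine sob_ext (norm_le_zero_iff.1 b0) fun i => norm_le_zero_iff.1 ?_
    have := b1 i
    rwa [norm_zero, mul_zero] at this
  rw [sub_eq_zero.1 key]
  exact ⟨H, hH, hF, hb⟩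

lemma exists_perturbedLaplacian (h : IsPotential A B N) {u : L2Disc} {g : Fin 2 → L2Disc}
    {H : Fin 2 → L2Disc} (hg : ∀ i, HasWeakDeriv i u (g i)) (hH : ∀ i, HasWeakDeriv i (g i) (H i)) :
    PerturbedLaplacian A N u
      (-∑ i, (H i + (B i u + A i (g i)) + A i (g i + A i u)) + N u) :=
  ⟨fun i => g i + A i u, fun i => H i + (B i u + A i (g i)) + A i (g i + A i u), fun i =>
    ⟨⟨g i, hg i, rfl⟩, ⟨_, (hH i).add (h.hasWeakDeriv i _ _ (hg i)), rfl⟩⟩, rfl⟩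

lemma existsUnique_perturbedLaplacian (h : IsPotential A B N) {u : L2Disc} (hu : MemH2 u) :
    ∃! v, PerturbedLaplacian A N u v :=
  ⟨_, h.exists_perturbedLaplacian (fun i => hu.1.hasWeakDeriv i)
    fun i => (hu.2 i).hasWeakDeriv i, fun _ h' => h'.unique (h.exists_perturbedLaplacian
      (fun i => hu.1.hasWeakDeriv i) fun i => (hu.2 i).hasWeakDeriv i)⟩

lemma perturbedLaplacian_green (h : IsPotential A B N) (v : L2Disc) :
    PerturbedLaplacian A N (h.green v) v := by
  obtain ⟨H, hH, hF, -⟩ := h.exists_hessian v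
  have := h.exists_perturbedLaplacian (u := h.green v)
    (fun i => hasWeakDeriv_of_mem_H10 (h.weakSolution v).2 i) fun i => hH i i
  convert this using 1
  rw [flatSource] at hF
  simp only [Fin.sum_univ_two, two_smul, map_add] at hF ⊢
  rw [← sub_eq_zero] at hF ⊢
  rw [← hF]
  abel

lemma memDirichletDomain_green (h : IsPotential A B N) (v : L2Disc) :
    MemDirichletDomain (h.green v) := by
  obtain ⟨H, hH, -⟩ := h.exists_hessian v
  have hU := (h.weakSolution v).2
  refine ⟨⟨memH1_of_mem_H10 hU, fun i j => ?_⟩, memH10_of_mem_H10 hU⟩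
  rw [green_apply, weakDeriv_of_mem_H10 hU]
  exact ⟨_, hH i j⟩

/-- Integration by parts shows that `u` solves the weak problem, whose solution is unique. -/
lemma green_eq (h : IsPotential A B N) {u v : L2Disc} (hu : MemH10 u)
    (huv : PerturbedLaplacian A N u v) : h.green v = u := by
  obtain ⟨p, q, hpq, rfl⟩ := huv
  have := h.eq_weakSolution (U := ⟨_, hu.weakJet_mem⟩) (v := -∑ i, q i + N u) fun W => by
    rw [energyForm_apply, inner_add_left, inner_neg_left, sum_inner, ← Finset.sum_neg_distrib]
    congr 1
    refine Finset.sum_congr rfl fun i _ => ?_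
    have hp : covH10 A i ⟨_, hu.weakJet_mem⟩ = p i := by
      refine CovDeriv.unique ⟨_, hu.1.hasWeakDeriv i, ?_⟩ (hpq i).1
      rfl
    obtain ⟨g, hg, hq⟩ := (hpq i).2
    rw [hp, hq, covH10_apply, inner_add_left, inner_add_right, hg.inner_H10 W.2, h.inner_left]
    ring
  rw [green_apply, ← this]
  rfl

lemma norm_weakSolution_succ_le (h : IsPotential A B N) {k : ℝ}
    (hA : ∀ i u, ‖A i u‖ ≤ k * ‖u‖) (hk0 : 0 ≤ k) (v : L2Disc) (i : Fin 2) :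
    ‖(h.weakSolution v : Sob) i.succ‖ ≤ (2 + 4 * k) * ‖v‖ := by
  obtain ⟨h0, hc⟩ := h.energy_le v
  have e : (h.weakSolution v : Sob) i.succ
      = covH10 A i (h.weakSolution v) - A i (h.green v) := by
    rw [covH10_apply, ← green_apply]; abel
  rw [e]
  refine (norm_sub_le _ _).trans ?_
  have : ‖A i (h.green v)‖ ≤ k * (4 * ‖v‖) := (hA i _).trans (by gcongr)
  linarith [hc i]

lemma norm_flatSource_le (h : IsPotential A B N) {k m n : ℝ} (hk0 : 0 ≤ k) (hm0 : 0 ≤ m)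
    (hn0 : 0 ≤ n) (hA : ∀ i u, ‖A i u‖ ≤ k * ‖u‖) (hB : ∀ i u, ‖B i u‖ ≤ m * ‖u‖)
    (hN : ∀ u, ‖N u‖ ≤ n * ‖u‖) (v : L2Disc) :
    ‖h.flatSource v‖ ≤ (1 + 4 * n + 8 * m + 8 * k + 24 * k ^ 2) * ‖v‖ := by
  have h0 := (h.energy_le v).1
  have h1 := h.norm_weakSolution_succ_le hA hk0 v
  have hs : ∀ i, ‖B i (h.green v) + (2 : ℝ) • A i ((h.weakSolution v : Sob) i.succ)
      + A i (A i (h.green v))‖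
        ≤ m * (4 * ‖v‖) + 2 * (k * ((2 + 4 * k) * ‖v‖)) + k * (k * (4 * ‖v‖)) := fun i => by
    refine (norm_add₃_le).trans (add_le_add_three ?_ ?_ ?_)
    · exact (hB i _).trans (by gcongr)
    · rw [norm_smul, Real.norm_two]
      gcongr
      exact (hA i _).trans (by gcongr; exact h1 i)
    · exact (hA i _).trans (by gcongr; exact (hA i _).trans (by gcongr))
  rw [flatSource, Fin.sum_univ_two]
  refine (norm_add_le _ _).trans ((add_le_add (norm_sub_le _ _)
    ((norm_add_le _ _).trans (add_le_add (hs 0) (hs 1)))).trans ?_)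
  have : ‖N (h.green v)‖ ≤ n * (4 * ‖v‖) := (hN _).trans (by gcongr)
  linarith

lemma h2Norm_green_le (h : IsPotential A B N) {k m n : ℝ} (hk0 : 0 ≤ k) (hm0 : 0 ≤ m) (hn0 : 0 ≤ n)
    (hA : ∀ i u, ‖A i u‖ ≤ k * ‖u‖) (hB : ∀ i u, ‖B i u‖ ≤ m * ‖u‖) (hN : ∀ u, ‖N u‖ ≤ n * ‖u‖)
    (v : L2Disc) : h2Norm (h.green v) ≤ (9 + 16 * k + 24 * k ^ 2 + 8 * m + 4 * n) * ‖v‖ := by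
  obtain ⟨H, hH, -, hb⟩ := h.exists_hessian v
  have h0 := (h.energy_le v).1
  have h1 := h.norm_weakSolution_succ_le hA hk0 v
  have hF := h.norm_flatSource_le hk0 hm0 hn0 hA hB hN v
  have hw : ∀ i : Fin 2, weakDeriv i (h.green v) = (h.weakSolution v : Sob) i.succ := fun i => by
    rw [green_apply, weakDeriv_of_mem_H10 (h.weakSolution v).2]
  have hww : ∀ i j : Fin 2, weakDeriv j ((h.weakSolution v : Sob) i.succ) = H i j := fun i j =>
    (hH i j).weakDeriv_eq
  have e : (9 + 16 * k + 24 * k ^ 2 + 8 * m + 4 * n) * ‖v‖ = 4 * ‖v‖ + 2 * ((2 + 4 * k) * ‖v‖)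
      + (1 + 4 * n + 8 * m + 8 * k + 24 * k ^ 2) * ‖v‖ := by ring
  have p1 : 0 ≤ 4 * ‖v‖ := by positivity
  have p2 : 0 ≤ (2 + 4 * k) * ‖v‖ := by positivity
  have p3 : 0 ≤ (1 + 4 * n + 8 * m + 8 * k + 24 * k ^ 2) * ‖v‖ := by positivity
  rw [e, h2Norm]
  simp only [hw, hww]
  generalize 4 * ‖v‖ = a at *
  generalize (2 + 4 * k) * ‖v‖ = b at *
  generalize (1 + 4 * n + 8 * m + 8 * k + 24 * k ^ 2) * ‖v‖ = c at *
  -- The square of the norm is at most `a² + 2b² + c²`, which is below `(a + 2b + c)²`.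
  refine Real.sqrt_le_iff.2 ⟨by positivity, ?_⟩
  have q1 : ‖h.green v‖ ^ 2 ≤ a ^ 2 := pow_le_pow_left₀ (norm_nonneg _) h0 2
  have q2 : ∑ i : Fin 2, ‖(h.weakSolution v : Sob) i.succ‖ ^ 2 ≤ 2 * b ^ 2 := by
    rw [Fin.sum_univ_two, two_mul]
    exact add_le_add (pow_le_pow_left₀ (norm_nonneg _) (h1 0) 2)
      (pow_le_pow_left₀ (norm_nonneg _) (h1 1) 2)
  have q3 := hb.trans (pow_le_pow_left₀ (norm_nonneg _) hF 2)
  linarith [mul_nonneg p1 p2, mul_nonneg p1 p3, mul_nonneg p2 p3, sq_nonneg b,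
    show (a + 2 * b + c) ^ 2 = a ^ 2 + 2 * b ^ 2 + c ^ 2 + 2 * b ^ 2 + 4 * (a * b) + 2 * (a * c)
      + 4 * (b * c) by ring]

end IsPotential

/-! ### The coefficients of the fiducial connection -/

section ProfileBounds

variable {y p : ℝ → ℝ}

/-- Bootstrapping: the first order system gains one derivative at each turn. -/
lemma IsProfileOn.contDiff (h : IsProfileOn univ y p) : ContDiff ℝ ∞ y ∧ ContDiff ℝ ∞ p := by
  have hy : Differentiable ℝ y := fun s => (h.hasDerivAt s trivial).differentiableAt
  have hp : Differentiable ℝ p := fun s => (h.hasDerivAt_slope s trivial).differentiableAt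
  have hy' : deriv y = p := funext fun s => (h.hasDerivAt s trivial).deriv
  have hp' : deriv p = fun s => 1 / 2 * Real.exp (2 * s) * Real.sinh (2 * y s) :=
    funext fun s => (h.hasDerivAt_slope s trivial).deriv
  have key : ∀ n : ℕ, ContDiff ℝ n y ∧ ContDiff ℝ n p := fun n => by
    induction n with
    | zero => exact ⟨contDiff_zero.2 hy.continuous, contDiff_zero.2 hp.continuous⟩
    | succ n ih =>
      rw [Nat.cast_succ, contDiff_succ_iff_deriv, contDiff_succ_iff_deriv, hy', hp']
      refine ⟨⟨hy, by simp, ih.2⟩, hp, by simp, ?_⟩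
      exact (contDiff_const.mul (Real.contDiff_exp.comp (contDiff_const.mul contDiff_id))).mul
        (Real.contDiff_sinh.comp (contDiff_const.mul ih.1))
  exact ⟨contDiff_infty.2 fun n => (key n).1, contDiff_infty.2 fun n => (key n).2⟩

lemma IsProfileOn.apply_le_one_third (h : IsProfileOn univ y p) {s : ℝ} (hs : 1 ≤ s) :
    y s ≤ Real.exp (2 - 2 * s) / 3 ∧ y s ≤ 1 / 3 := by
  have h1 := (h.mono (subset_univ (Icc (s - 1) (s - 1 + 1)))).apply_add_one_le
  rw [sub_add_cancel, show -2 * (s - 1) = 2 - 2 * s by ring] at h1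
  refine ⟨h1, h1.trans ?_⟩
  have : Real.exp (2 - 2 * s) ≤ 1 := Real.exp_le_one_iff.2 (by linarith)
  linarith

lemma sinh_le_mul_exp (x : ℝ) : Real.sinh x ≤ x * Real.exp x := by
  have h1 : 1 - 2 * x ≤ Real.exp (-(2 * x)) := by linarith [Real.add_one_le_exp (-(2 * x))]
  have h2 : Real.exp (-x) = Real.exp x * Real.exp (-(2 * x)) := by
    rw [← Real.exp_add]; congr 1; ring
  rw [Real.sinh_eq, h2]
  nlinarith [Real.exp_pos x]

lemma IsProfileOn.deriv_slope_nonneg (h : IsProfileOn univ y p) (s : ℝ) :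
    0 ≤ 1 / 2 * Real.exp (2 * s) * Real.sinh (2 * y s) := by
  have := Real.sinh_nonneg_iff.2 (mul_nonneg zero_le_two (h.nonneg s trivial))
  positivity

/-- For `s ≤ 1` this is the linear bound on `y`. For `s ≥ 1` the decay of `y` like `e^{-2s}` keeps
`e^{2s} sinh (2y)` bounded. -/
lemma IsProfileOn.deriv_slope_le (h : IsProfileOn univ y p) (s : ℝ) :
    1 / 2 * Real.exp (2 * s) * Real.sinh (2 * y s) ≤ Real.exp 3 * Real.exp (4 / 3 * s) := by
  rcases le_total s 1 with hs | hs
  · have h1 := (h.mono (subset_univ _)).apply_le hs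
    calc 1 / 2 * Real.exp (2 * s) * Real.sinh (2 * y s)
        ≤ 1 / 2 * Real.exp (2 * s) * (Real.exp (2 * y s) / 2) := by
          gcongr; exact sinh_le_exp _
      _ ≤ Real.exp (2 * s) * Real.exp (2 * y s) := by
          nlinarith [Real.exp_pos (2 * s), Real.exp_pos (2 * y s),
            mul_pos (Real.exp_pos (2 * s)) (Real.exp_pos (2 * y s))]
      _ ≤ Real.exp 3 * Real.exp (4 / 3 * s) := by
          rw [← Real.exp_add, ← Real.exp_add]
          exact Real.exp_le_exp.2 (by linarith)
  · obtain ⟨h1, h2⟩ := h.apply_le_one_third hs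
    have h0 := h.nonneg s trivial
    calc 1 / 2 * Real.exp (2 * s) * Real.sinh (2 * y s)
        ≤ 1 / 2 * Real.exp (2 * s) * (2 * y s * Real.exp (2 * y s)) := by
          gcongr; exact sinh_le_mul_exp _
      _ = Real.exp (2 * s) * Real.exp (2 * y s) * y s := by ring
      _ ≤ Real.exp (2 * s) * Real.exp 1 * (Real.exp (2 - 2 * s) / 3) := by
          gcongr; linarith
      _ ≤ Real.exp (2 * s) * Real.exp 1 * Real.exp (2 - 2 * s) := by
          gcongr; linarith [Real.exp_pos (2 - 2 * s)]
      _ ≤ Real.exp 3 * Real.exp (4 / 3 * s) := by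
          rw [← Real.exp_add, ← Real.exp_add, ← Real.exp_add]
          exact Real.exp_le_exp.2 (by linarith)

/-- The function `f_t` in the logarithmic variable. -/
def connProfile (p : ℝ → ℝ) (s : ℝ) : ℝ := 1 / 8 + 3 / 8 * p s

lemma IsProfileOn.connProfile_nonneg (h : IsProfileOn univ y p) (s : ℝ) : 0 ≤ connProfile p s := by
  have := h.slope_ge s trivial
  rw [connProfile]; linarith

lemma IsProfileOn.connProfile_le_one (h : IsProfileOn univ y p) (s : ℝ) : connProfile p s ≤ 1 := by
  have := h.slope_nonpos s trivial
  rw [connProfile]; linarith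

/-- The value `1/8 - (3/8)(1/3)` is zero: the leading singularity of the profile cancels the
constant in `f_t`. As `e^{4s/3}` is proportional to `r²`, this means `f_t = O(r²)`. -/
lemma IsProfileOn.connProfile_le (h : IsProfileOn univ y p)
    (hp : ∀ s ≤ 1, p s ≤ -(1 / 3) + Real.exp 2 * Real.exp (4 / 3 * s)) (s : ℝ) :
    connProfile p s ≤ Real.exp 3 * Real.exp (4 / 3 * s) := by
  rcases le_total s 1 with hs | hs
  · have h1 := hp s hs
    have h2 : Real.exp 2 * Real.exp (4 / 3 * s) ≤ Real.exp 3 * Real.exp (4 / 3 * s) := by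
      gcongr; norm_num
    have h3 : 0 < Real.exp 2 * Real.exp (4 / 3 * s) := by positivity
    rw [connProfile]; linarith
  · refine (h.connProfile_le_one s).trans ?_
    rw [← Real.exp_add]
    exact Real.one_le_exp (by linarith)

end ProfileBounds

/-- The logarithm of `(8/3) t r^{3/2}`. -/
def logRadius (t : ℝ) (z : ℂ) : ℝ := Real.log (8 / 3 * t) + 3 / 4 * Real.log (‖z‖ ^ 2)

/-- The scale `((8/3) t)^{2/3}`. -/
def scale (t : ℝ) : ℝ := Real.exp (2 / 3 * Real.log (8 / 3 * t))

lemma scale_pos (t : ℝ) : 0 < scale t := Real.exp_pos _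

lemma exp_logRadius (t : ℝ) {z : ℂ} (hz : z ≠ 0) :
    Real.exp (2 / 3 * logRadius t z) = scale t * ‖z‖ := by
  have hz' : 0 < ‖z‖ := norm_pos_iff.2 hz
  rw [logRadius, Real.log_pow, scale]
  nth_rw 2 [← Real.exp_log hz']
  rw [← Real.exp_add]
  congr 1
  push_cast
  ring

lemma exp_logRadius_sq (t : ℝ) {z : ℂ} (hz : z ≠ 0) :
    Real.exp (4 / 3 * logRadius t z) = scale t ^ 2 * ‖z‖ ^ 2 := by
  rw [← mul_pow, ← exp_logRadius t hz, ← Real.exp_nat_mul]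
  congr 1
  push_cast
  ring

lemma hasFDerivAt_norm_sq (z : ℂ) :
    HasFDerivAt (fun z : ℂ => ‖z‖ ^ 2) ((2 : ℝ) • innerSL ℝ z : ℂ →L[ℝ] ℝ) z := by
  have := (hasStrictFDerivAt_norm_sq z).hasFDerivAt
  rw [two_smul] at this ⊢
  exact this

lemma hasFDerivAt_logRadius (t : ℝ) {z : ℂ} (hz : z ≠ 0) :
    HasFDerivAt (logRadius t)
      ((3 / 4 : ℝ) • ((‖z‖ ^ 2)⁻¹ • ((2 : ℝ) • innerSL ℝ z : ℂ →L[ℝ] ℝ))) z := by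
  exact (((hasFDerivAt_norm_sq z).log (pow_ne_zero 2 (norm_ne_zero_iff.2 hz))).const_mul (3 / 4 : ℝ)).const_add _

lemma contDiffAt_logRadius (t : ℝ) {z : ℂ} (hz : z ≠ 0) : ContDiffAt ℝ ∞ (logRadius t) z :=
  contDiffAt_const.add (contDiffAt_const.mul
    ((contDiff_norm_sq ℝ).contDiffAt.log (pow_ne_zero 2 (norm_ne_zero_iff.2 hz))))

/-- The components of the rotation field. -/
def rotL : Fin 2 → ℂ →L[ℝ] ℝ := ![-Complex.imCLM, Complex.reCLM]

lemma abs_rotL_le (i : Fin 2) (z : ℂ) : |rotL i z| ≤ ‖z‖ := by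
  fin_cases i
  · simpa [rotL] using Complex.abs_im_le_norm z
  · simpa [rotL] using Complex.abs_re_le_norm z

/-- The coefficients `a_i` such that `[A_i, ·]` is `a_i` times a rotation of the fibre. -/
def connCoeff (p : ℝ → ℝ) (t : ℝ) (i : Fin 2) (z : ℂ) : ℝ :=
  4 * (rotL i z * connProfile p (logRadius t z) * (‖z‖ ^ 2)⁻¹)

section ConnCoeff

variable {y p : ℝ → ℝ} {t : ℝ}

lemma IsProfileOn.abs_connCoeff_le (h : IsProfileOn univ y p) (i : Fin 2) (z : ℂ) :
    |connCoeff p t i z| ≤ 4 * (‖z‖ * connProfile p (logRadius t z) * (‖z‖ ^ 2)⁻¹) := by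
  rw [connCoeff, abs_mul, abs_mul, abs_mul, abs_of_nonneg (h.connProfile_nonneg _),
    abs_of_pos (four_pos : (0 : ℝ) < 4), abs_of_nonneg (by positivity : 0 ≤ (‖z‖ ^ 2)⁻¹)]
  have := h.connProfile_nonneg (logRadius t z)
  gcongr
  exact abs_rotL_le i z

/-- Multiplying `f ≤ 1` by `f ≤ e³ scale² r²` and taking the root gives `f ≤ e³ scale · r`. The
single power of `scale` matters: the bound enters squared in the `H²` estimate, where the conic
bound of order `scale²` would give `t^{8/3}`. -/
lemma IsProfileOn.abs_connCoeff_le_scale (h : IsProfileOn univ y p)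
    (hp : ∀ s ≤ 1, p s ≤ -(1 / 3) + Real.exp 2 * Real.exp (4 / 3 * s)) (i : Fin 2) (z : ℂ) :
    |connCoeff p t i z| ≤ 4 * (Real.exp 3 * scale t) := by
  have hs := scale_pos t
  rcases eq_or_ne z 0 with rfl | hz
  · simp only [connCoeff, map_zero, zero_mul, mul_zero, abs_zero]; positivity
  have hr : 0 < ‖z‖ := norm_pos_iff.2 hz
  refine (h.abs_connCoeff_le i z).trans ?_
  have h0 := h.connProfile_nonneg (logRadius t z)
  have h1 := h.connProfile_le_one (logRadius t z)
  have h2 := h.connProfile_le hp (logRadius t z)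
  rw [exp_logRadius_sq t hz] at h2
  have hE : 1 ≤ Real.exp 3 := Real.one_le_exp (by norm_num)
  have h3 : connProfile p (logRadius t z) ≤ Real.exp 3 * scale t * ‖z‖ := by
    refine (pow_le_pow_iff_left₀ h0 (by positivity) two_ne_zero).1 ?_
    calc connProfile p (logRadius t z) ^ 2 ≤ 1 * (Real.exp 3 * (scale t ^ 2 * ‖z‖ ^ 2)) := by
          rw [sq]; gcongr
      _ ≤ Real.exp 3 * (Real.exp 3 * (scale t ^ 2 * ‖z‖ ^ 2)) := by gcongr
      _ = _ := by ring
  calc _ ≤ 4 * (‖z‖ * (Real.exp 3 * scale t * ‖z‖) * (‖z‖ ^ 2)⁻¹) := by gcongr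
    _ = _ := by field_simp

/-- Since `f = O(r²)` and `p' = O(r²)`, the coefficient `4 rot_i f / r²` is `O(r)` with bounded
gradient. Collecting constants gives `57/4`, rounded up to `15`. -/
lemma IsProfileOn.isConicField_connCoeff (h : IsProfileOn univ y p)
    (hp : ∀ s ≤ 1, p s ≤ -(1 / 3) + Real.exp 2 * Real.exp (4 / 3 * s)) (t : ℝ) (i : Fin 2) :
    IsConicField (connCoeff p t i) (15 * (Real.exp 3 * scale t ^ 2)) := by
  set E := Real.exp 3 * scale t ^ 2 with hE
  have hE0 : 0 ≤ E := by positivity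
  have hq : ∀ z ≠ 0, connProfile p (logRadius t z) ≤ E * ‖z‖ ^ 2 := fun z hz => by
    have := h.connProfile_le hp (logRadius t z)
    rwa [exp_logRadius_sq t hz, ← mul_assoc] at this
  refine ⟨fun z hz => ?_, fun z => ?_, fun j z hz => ?_⟩
  · have h1 : ContDiffAt ℝ ∞ (fun z => p (logRadius t z)) z :=
      h.contDiff.2.contDiffAt.comp z (contDiffAt_logRadius t hz)
    exact contDiffAt_const.mul (((rotL i).contDiff.contDiffAt.mul
      (contDiffAt_const.add (contDiffAt_const.mul h1))).mul
        ((contDiff_norm_sq ℝ).contDiffAt.inv (pow_ne_zero 2 (norm_ne_zero_iff.2 hz))))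
  · rcases eq_or_ne z 0 with rfl | hz
    · simp [connCoeff]
    have hr : 0 < ‖z‖ := norm_pos_iff.2 hz
    refine (h.abs_connCoeff_le i z).trans ?_
    calc _ ≤ 4 * (‖z‖ * (E * ‖z‖ ^ 2) * (‖z‖ ^ 2)⁻¹) := by gcongr; exact hq z hz
      _ = 4 * E * ‖z‖ := by field_simp
      _ ≤ 15 * E * ‖z‖ := by gcongr; norm_num
  · have hr : 0 < ‖z‖ := norm_pos_iff.2 hz
    have hn : ‖z‖ ^ 2 ≠ 0 := by positivity
    have h2 := (hasDerivAt_inv hn).comp_hasFDerivAt z (hasFDerivAt_norm_sq z)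
    have h3 := ((h.hasDerivAt_slope (logRadius t z) trivial).comp_hasFDerivAt z
      (hasFDerivAt_logRadius t hz)).const_mul (3 / 8 : ℝ) |>.const_add (1 / 8 : ℝ)
    have h4 := (((rotL i).hasFDerivAt (x := z)).mul h3).mul h2 |>.const_mul (4 : ℝ)
    have h5 : HasFDerivAt (connCoeff p t i) _ z := h4
    have hP0 := h.deriv_slope_nonneg (logRadius t z)
    have hP := h.deriv_slope_le (logRadius t z)
    have hq0 := h.connProfile_nonneg (logRadius t z)
    have hq1 := hq z hz
    rw [exp_logRadius_sq t hz, ← mul_assoc] at hP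
    set c := ⟪z, dir j⟫_ℝ with hc
    set P := 1 / 2 * Real.exp (2 * logRadius t z) * Real.sinh (2 * y (logRadius t z)) with hPd
    set m := (‖z‖ ^ 2)⁻¹ with hm
    have hm0 : 0 ≤ m := by positivity
    -- The factor `9/16` is `3/8` from `f`, times `3/4` and `2` from the derivative of `logRadius`.
    have e : fderiv ℝ (connCoeff p t i) z (dir j) =
        4 * (rotL i (dir j) * connProfile p (logRadius t z) * m
          + rotL i z * (9 / 16 * P * c * m) * m
          + -(rotL i z * connProfile p (logRadius t z) * (2 * c * (m * m)))) := by
      rw [h5.fderiv]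
      simp [connProfile, ← hc]
      rw [← inv_pow, ← hm]
      ring
    rw [e]
    generalize connProfile p (logRadius t z) = q at *
    have b1 : |rotL i (dir j)| ≤ 1 := (abs_rotL_le i _).trans (norm_dir j).le
    have b2 : |rotL i z| ≤ ‖z‖ := abs_rotL_le i z
    have b3 : |c| ≤ ‖z‖ := 
      (abs_real_inner_le_norm z (dir j)).trans (by rw [norm_dir, mul_one])
    have t1 : |rotL i (dir j) * q * m| ≤ 1 * q * m := by
      rw [abs_mul, abs_mul, abs_of_nonneg hm0, abs_of_nonneg hq0]; gcongr
    have t2 : |rotL i z * (9 / 16 * P * c * m) * m| ≤ ‖z‖ * (9 / 16 * P * ‖z‖ * m) * m := by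
      simp only [abs_mul, abs_of_nonneg hm0, abs_of_nonneg hP0]
      rw [abs_of_pos (by norm_num : (0 : ℝ) < 9 / 16)]
      gcongr
    have t3 : |-(rotL i z * q * (2 * c * (m * m)))| ≤ ‖z‖ * q * (2 * ‖z‖ * (m * m)) := by
      simp only [abs_neg, abs_mul, abs_of_nonneg hm0, abs_of_nonneg hq0, abs_two]
      gcongr
    have hnm : ‖z‖ ^ 2 * m = 1 := mul_inv_cancel₀ hn
    calc _ ≤ 4 * (1 * q * m + ‖z‖ * (9 / 16 * P * ‖z‖ * m) * m
          + ‖z‖ * q * (2 * ‖z‖ * (m * m))) := by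
          rw [abs_mul, abs_of_pos (four_pos : (0 : ℝ) < 4)]
          exact mul_le_mul_of_nonneg_left ((abs_add_three _ _ _).trans
            (add_le_add_three t1 t2 t3)) four_pos.le
      _ = (4 * q + 9 / 4 * P * (‖z‖ ^ 2 * m) + 8 * q * (‖z‖ ^ 2 * m)) * m := by ring
      _ = (12 * q + 9 / 4 * P) * m := by rw [hnm]; ring
      _ ≤ (12 * (E * ‖z‖ ^ 2) + 9 / 4 * (E * ‖z‖ ^ 2)) * m := by gcongr
      _ = 57 / 4 * E * (‖z‖ ^ 2 * m) := by ring
      _ ≤ 15 * E := by rw [hnm]; linarith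

end ConnCoeff

/-! ### The fiducial pair in the trivialization -/

lemma toMat_eq (a : Fiber) : toMat a =
    !![-(a 0 : ℂ), -(a 2 : ℂ) + a 1 * Complex.I; -(a 2 : ℂ) - a 1 * Complex.I, (a 0 : ℂ)] := by
  ext i j
  fin_cases i <;> fin_cases j <;> simp [toMat, Complex.ext_iff]

lemma toMat_injective : Function.Injective toMat := fun a b h => by
  rw [toMat_eq, toMat_eq] at h
  have h0 := congrFun (congrFun h 1) 1
  have h1 := congrFun (congrFun h 0) 1
  simp [Complex.ext_iff] at h0 h1
  ext k
  fin_cases k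
  · exact h0
  · exact h1.2
  · exact h1.1

lemma toMat_add (a b : Fiber) : toMat (a + b) = toMat a + toMat b := by
  simp only [toMat_eq]
  ext i j
  fin_cases i <;> fin_cases j <;> simp <;> ring

lemma toMat_smul (c : ℝ) (a : Fiber) : toMat (c • a) = (c : ℂ) • toMat a := by
  simp only [toMat_eq]
  ext i j
  fin_cases i <;> fin_cases j <;> simp <;> ring

/-- The rotation of the fibre in the off-diagonal directions. -/
def fiberRot : Fiber →L[ℝ] Fiber :=
  LinearMap.toContinuousLinearMap
    { toFun := fun a => !₂[0, -a 2, a 1]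
      map_add' := fun a b => by ext k; fin_cases k <;> simp; ring
      map_smul' := fun c a => by ext k; fin_cases k <;> simp }

lemma fiberRot_apply (a : Fiber) : fiberRot a = !₂[0, -a 2, a 1] := rfl

lemma inner_fiberRot (a : Fiber) : ⟪a, fiberRot a⟫_ℝ = 0 := by
  simp [fiberRot_apply, PiLp.inner_apply, Fin.sum_univ_three]
  ring

/-- Bracketing with `diag(1, -1)` multiplies the off-diagonal entries by `±2`, which explains `c /
2`. -/
lemma lie_diag_toMat (c : ℝ) (a : Fiber) :
    ⁅((c / 2 : ℝ) * Complex.I : ℂ) • !![(1 : ℂ), 0; 0, -1], toMat a⁆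
      = toMat (c • fiberRot a) := by
  rw [Ring.lie_def, toMat_eq, toMat_eq, fiberRot_apply]
  ext i j
  fin_cases i <;> fin_cases j <;>
    simp [Complex.ext_iff] <;> (try constructor) <;> ring

/-- The diagonal part of the Higgs potential. -/
def fiberDiag : Fiber →L[ℝ] Fiber :=
  LinearMap.toContinuousLinearMap
    { toFun := fun a => !₂[8 * a 0, 4 * a 1, 4 * a 2]
      map_add' := fun a b => by ext k; fin_cases k <;> simp <;> ring
      map_smul' := fun c a => by ext k; fin_cases k <;> simp <;> ring }

/-- The part of the Higgs potential proportional to `Re z`. -/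
def fiberRe : Fiber →L[ℝ] Fiber :=
  LinearMap.toContinuousLinearMap
    { toFun := fun a => !₂[0, 8 * a 1, -8 * a 2]
      map_add' := fun a b => by ext k; fin_cases k <;> simp <;> ring
      map_smul' := fun c a => by ext k; fin_cases k <;> simp <;> ring }

/-- The part of the Higgs potential proportional to `Im z`. -/
def fiberIm : Fiber →L[ℝ] Fiber :=
  LinearMap.toContinuousLinearMap
    { toFun := fun a => !₂[0, -8 * a 2, -8 * a 1]
      map_add' := fun a b => by ext k; fin_cases k <;> simp <;> ring
      map_smul' := fun c a => by ext k; fin_cases k <;> simp <;> ring }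

/-- The Higgs potential of a coefficient with off-diagonal entries `α`, `β`, in terms of
`S = α² + |β|²` and `w = α β`. -/
def fiberHiggs (S : ℝ) (w : ℂ) : Fiber →L[ℝ] Fiber :=
  S • fiberDiag + w.re • fiberRe + w.im • fiberIm

lemma fiberHiggs_apply (S : ℝ) (w : ℂ) (a : Fiber) : fiberHiggs S w a =
    !₂[8 * S * a 0, 4 * S * a 1 + 8 * w.re * a 1 - 8 * w.im * a 2,
      4 * S * a 2 - 8 * w.re * a 2 - 8 * w.im * a 1] := by
  have h : fiberHiggs S w a = S • !₂[8 * a 0, 4 * a 1, 4 * a 2]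
      + w.re • !₂[0, 8 * a 1, -8 * a 2] + w.im • !₂[0, -8 * a 2, -8 * a 1] := rfl
  rw [h]
  ext k
  fin_cases k <;> simp <;> ring

/-- Only `S` and `w` enter. For the fiducial field `e^{h}` and `e^{-h}` cancel in `w`, which is then
simply `z`. -/
lemma higgsPotential_toMat (α : ℝ) (β : ℂ) (a : Fiber) :
    higgsPotential !![0, (α : ℂ); β, 0] (toMat a)
      = toMat (fiberHiggs (α ^ 2 + ‖β‖ ^ 2) (α * β) a) := by
  have hc : Matrix.conjTranspose !![0, (α : ℂ); β, 0] = !![0, (starRingEnd ℂ) β; (α : ℂ), 0] := by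
    ext i j
    fin_cases i <;> fin_cases j <;> simp
  rw [higgsPotential, hc, toMat_eq, toMat_eq, fiberHiggs_apply, ← Complex.normSq_eq_norm_sq,
    Complex.normSq_apply]
  simp only [Ring.lie_def, Matrix.mul_fin_two]
  ext i j
  fin_cases i <;> fin_cases j <;> simp [Complex.ext_iff, sq] <;> (try constructor) <;> ring

/-- With `ζ = a₁ + i a₂` the form is `8 S a₀² + 4 S |ζ|² + 8 Re (w ζ²)`. -/
lemma inner_fiberHiggs_nonneg {S : ℝ} {w : ℂ} (h : 2 * ‖w‖ ≤ S) (a : Fiber) :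
    0 ≤ ⟪fiberHiggs S w a, a⟫_ℝ := by
  have h1 : |(w * (a 1 + a 2 * Complex.I) ^ 2).re| ≤ ‖w‖ * (a 1 ^ 2 + a 2 ^ 2) := by
    refine (Complex.abs_re_le_norm _).trans_eq ?_
    rw [norm_mul, norm_pow, ← Complex.normSq_eq_norm_sq, Complex.normSq_apply]
    simp; left; ring
  have h2 : (w * (a 1 + a 2 * Complex.I) ^ 2).re
      = w.re * (a 1 ^ 2 - a 2 ^ 2) - w.im * (2 * a 1 * a 2) := by
    have e1 : ((a 1 + a 2 * Complex.I : ℂ) ^ 2).re = a 1 ^ 2 - a 2 ^ 2 := by simp [sq]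
    have e2 : ((a 1 + a 2 * Complex.I : ℂ) ^ 2).im = 2 * a 1 * a 2 := by simp [sq]; ring
    rw [Complex.mul_re, e1, e2]
  have h3 : ⟪fiberHiggs S w a, a⟫_ℝ = 8 * S * a 0 ^ 2 + 4 * S * (a 1 ^ 2 + a 2 ^ 2)
      + 8 * (w * (a 1 + a 2 * Complex.I) ^ 2).re := by
    rw [h2, fiberHiggs_apply]
    simp [PiLp.inner_apply, Fin.sum_univ_three]
    ring
  have h4 := (abs_le.1 h1).1
  have h5 : 2 * ‖w‖ * (a 1 ^ 2 + a 2 ^ 2) ≤ S * (a 1 ^ 2 + a 2 ^ 2) := by gcongr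
  have h6 : 0 ≤ S * a 0 ^ 2 := mul_nonneg ((by positivity : 0 ≤ 2 * ‖w‖).trans h) (sq_nonneg _)
  rw [h3]
  linarith

/-- A bound for the operators that make up the Higgs potential. -/
def fiberBound : ℝ := ‖fiberDiag‖ + ‖fiberRe‖ + ‖fiberIm‖

lemma norm_fiberHiggs_le {S : ℝ} {w : ℂ} (hS : 0 ≤ S) (hw : ‖w‖ ≤ 1) :
    ‖fiberHiggs S w‖ ≤ fiberBound * (S + 1) := by
  have h1 : |w.re| ≤ S + 1 := (Complex.abs_re_le_norm w).trans (by linarith)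
  have h2 : |w.im| ≤ S + 1 := (Complex.abs_im_le_norm w).trans (by linarith)
  have h3 : |S| ≤ S + 1 := by rw [abs_of_nonneg hS]; linarith
  refine norm_add₃_le.trans ?_
  rw [norm_smul, norm_smul, norm_smul, fiberBound, add_mul, add_mul, mul_comm ‖fiberDiag‖,
    mul_comm ‖fiberRe‖, mul_comm ‖fiberIm‖]
  simp only [Real.norm_eq_abs]
  gcongr

/-- The square of the norm of the fiducial Higgs field. -/
def higgsSize (y : ℝ → ℝ) (t : ℝ) (z : ℂ) : ℝ :=
  ‖z‖ * Real.exp (2 * y (logRadius t z)) + ‖z‖ * Real.exp (-(2 * y (logRadius t z)))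

lemma two_mul_norm_le_higgsSize (y : ℝ → ℝ) (t : ℝ) (z : ℂ) : 2 * ‖z‖ ≤ higgsSize y t z := by
  rw [higgsSize, ← mul_add, mul_comm 2]
  gcongr
  have := Real.add_one_le_exp (2 * y (logRadius t z))
  have := Real.add_one_le_exp (-(2 * y (logRadius t z)))
  linarith

lemma measurable_higgsSize {y : ℝ → ℝ} (hy : Measurable y) (t : ℝ) :
    Measurable (higgsSize y t) := by
  have h : Measurable (logRadius t) := by unfold logRadius; fun_prop
  unfold higgsSize
  fun_prop

section Fiducial

variable {y p : ℝ → ℝ} {t : ℝ}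

/-- Near the origin `e^{2y}` is at most `e² / (scale · r)`, so the factor `r` removes the
singularity; elsewhere `y ≤ 1/3`. -/
lemma IsProfileOn.higgsSize_le (h : IsProfileOn univ y p) {z : ℂ} (hz : z ≠ 0) (hz1 : ‖z‖ ≤ 1) :
    higgsSize y t z ≤ Real.exp 2 * ((scale t)⁻¹ + 1) + 1 := by
  have hr : 0 < ‖z‖ := norm_pos_iff.2 hz
  have hs := scale_pos t
  refine add_le_add ?_ ?_
  · rcases le_total (logRadius t z) 1 with h1 | h1
    · have h2 := (h.mono (subset_univ _)).apply_le h1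
      calc ‖z‖ * Real.exp (2 * y (logRadius t z))
          ≤ ‖z‖ * (Real.exp 2 * (Real.exp (2 / 3 * logRadius t z))⁻¹) := by
            rw [← Real.exp_neg, ← Real.exp_add]
            gcongr
            linarith
        _ = Real.exp 2 * (scale t)⁻¹ := by
            rw [exp_logRadius t hz]; field_simp
        _ ≤ _ := by gcongr; linarith
    · have h2 := (h.apply_le_one_third h1).2
      calc ‖z‖ * Real.exp (2 * y (logRadius t z)) ≤ 1 * Real.exp 2 := by gcongr; linarith
        _ = Real.exp 2 * (0 + 1) := by ring
        _ ≤ _ := by gcongr; positivity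
  · refine mul_le_one₀ hz1 (Real.exp_pos _).le (Real.exp_le_one_iff.2 ?_)
    have := h.nonneg (logRadius t z) trivial
    linarith

lemma log_radius_eq (ht : 0 < t) {r : ℝ} (hr : 0 < r) :
    Real.log (8 / 3 * t * r ^ (3 / 2 : ℝ)) = Real.log (8 / 3 * t) + 3 / 2 * Real.log r := by
  rw [Real.log_mul (by positivity) (by positivity), Real.log_rpow hr]

lemma logRadius_eq (t : ℝ) (z : ℂ) :
    logRadius t z = Real.log (8 / 3 * t) + 3 / 2 * Real.log ‖z‖ := by
  rw [logRadius, Real.log_pow]; push_cast; ring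

lemma hFid_log (y : ℝ → ℝ) (ht : 0 < t) {z : ℂ} (hz : z ≠ 0) :
    hFid (fun ρ => y (Real.log ρ)) t ‖z‖ = y (logRadius t z) := by
  rw [hFid, log_radius_eq ht (norm_pos_iff.2 hz), logRadius_eq]

lemma IsProfileOn.fFid_log (h : IsProfileOn univ y p) (ht : 0 < t) {z : ℂ} (hz : z ≠ 0) :
    fFid (fun ρ => y (Real.log ρ)) t ‖z‖ = connProfile p (logRadius t z) := by
  have hr : 0 < ‖z‖ := norm_pos_iff.2 hz
  have h1 : HasDerivAt (fun r => y (Real.log (8 / 3 * t) + 3 / 2 * Real.log r))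
      (p (Real.log (8 / 3 * t) + 3 / 2 * Real.log ‖z‖) * (3 / 2 * ‖z‖⁻¹)) ‖z‖ :=
    (h.hasDerivAt _ trivial).comp ‖z‖ (((Real.hasDerivAt_log hr.ne').const_mul _).const_add _)
  have h2 : hFid (fun ρ => y (Real.log ρ)) t
      =ᶠ[𝓝 ‖z‖] fun r => y (Real.log (8 / 3 * t) + 3 / 2 * Real.log r) := by
    filter_upwards [lt_mem_nhds hr] with r hr'
    rw [hFid, log_radius_eq ht hr']
  rw [fFid, (h1.congr_of_eventuallyEq h2).deriv, ← logRadius_eq, connProfile]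
  field_simp
  ring

/-- The form `dz/z - dz̄/z̄` is `2i dθ`, and `dθ` has components `rotL i z / |z|²`. -/
lemma IsProfileOn.connFid_log (h : IsProfileOn univ y p) (ht : 0 < t) {z : ℂ} (hz : z ≠ 0)
    (i : Fin 2) : connFid (fun ρ => y (Real.log ρ)) t z (dir i)
      = ((connCoeff p t i z / 2 : ℝ) * Complex.I : ℂ) • !![(1 : ℂ), 0; 0, -1] := by
  have hz' : (starRingEnd ℂ) z ≠ 0 := (map_ne_zero _).2 hz
  have hn : ((‖z‖ : ℂ) ^ 2) = z * (starRingEnd ℂ) z := by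
    rw [Complex.mul_conj, Complex.normSq_eq_norm_sq]; push_cast; ring
  rw [connFid, h.fFid_log ht hz, connCoeff]
  congr 1
  push_cast
  rw [hn]
  have key : dir i * (starRingEnd ℂ) z - (starRingEnd ℂ) (dir i) * z
      = 2 * (rotL i z) * Complex.I := by
    fin_cases i <;> simp [dir, rotL, Complex.ext_iff] <;> ring
  have e : dir i / z - star (dir i) / star z
      = (dir i * (starRingEnd ℂ) z - (starRingEnd ℂ) (dir i) * z) * (z * (starRingEnd ℂ) z)⁻¹ := by
    change dir i / z - (starRingEnd ℂ) (dir i) / (starRingEnd ℂ) z = _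
    field_simp
  rw [e, key]
  ring

lemma higgsPotential_fid (y : ℝ → ℝ) (ht : 0 < t) {z : ℂ} (hz : z ≠ 0) (a : Fiber) :
    higgsPotential (higgsFid (fun ρ => y (Real.log ρ)) t z) (toMat a)
      = toMat (fiberHiggs (higgsSize y t z) z a) := by
  have hr : 0 < ‖z‖ := norm_pos_iff.2 hz
  have h1 := higgsPotential_toMat (Real.sqrt ‖z‖ * Real.exp (y (logRadius t z)))
    ((Real.sqrt ‖z‖ : ℂ) * (z / ‖z‖) * (Real.exp (-y (logRadius t z)) : ℂ)) a
  have h2 : ‖(Real.sqrt ‖z‖ : ℂ) * (z / ‖z‖) * (Real.exp (-y (logRadius t z)) : ℂ)‖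
      = Real.sqrt ‖z‖ * Real.exp (-y (logRadius t z)) := by
    rw [norm_mul, norm_mul, norm_div, Complex.norm_real, Complex.norm_real, Complex.norm_real,
      norm_norm, div_self hr.ne', Real.norm_of_nonneg (Real.sqrt_nonneg _),
      Real.norm_of_nonneg (Real.exp_pos _).le, mul_one]
  have h3 : ((Real.sqrt ‖z‖ * Real.exp (y (logRadius t z)) : ℝ) : ℂ)
      * ((Real.sqrt ‖z‖ : ℂ) * (z / ‖z‖) * (Real.exp (-y (logRadius t z)) : ℂ)) = z := by
    have e1 : (Real.exp (y (logRadius t z)) : ℂ) * Real.exp (-y (logRadius t z)) = 1 := by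
      rw [← Complex.ofReal_mul, ← Real.exp_add, add_neg_cancel, Real.exp_zero, Complex.ofReal_one]
    have e2 : (Real.sqrt ‖z‖ : ℂ) * Real.sqrt ‖z‖ = ‖z‖ := by
      rw [← Complex.ofReal_mul, Real.mul_self_sqrt hr.le]
    have hrc : (‖z‖ : ℂ) ≠ 0 := Complex.ofReal_ne_zero.2 hr.ne'
    rw [Complex.ofReal_mul]
    calc _ = ((Real.sqrt ‖z‖ : ℂ) * Real.sqrt ‖z‖) * (z / ‖z‖) * ((Real.exp (y (logRadius t z)) : ℂ)
          * Real.exp (-y (logRadius t z))) := by ring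
      _ = z := by rw [e1, e2]; field_simp
  have h4 : (Real.sqrt ‖z‖ * Real.exp (y (logRadius t z))) ^ 2
      + (Real.sqrt ‖z‖ * Real.exp (-y (logRadius t z))) ^ 2 = higgsSize y t z := by
    rw [higgsSize, mul_pow, mul_pow, Real.sq_sqrt hr.le, ← Real.exp_nat_mul, ← Real.exp_nat_mul]
    push_cast
    rw [mul_neg]
  rw [h2, h3, h4, Complex.ofReal_mul] at h1
  rw [higgsFid, hFid_log y ht hz, h1]

end Fiducial

/-! ### The linearization at the fiducial pair -/

/-- The bounded operators given by the components of the connection. -/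
def connOp (p : ℝ → ℝ) (t : ℝ) (i : Fin 2) : L2Disc →L[ℝ] L2Disc :=
  mulOp fun z => connCoeff p t i z • fiberRot

/-- The bounded operators given by the diagonal derivatives of the connection. -/
def connDerivOp (p : ℝ → ℝ) (t : ℝ) (i : Fin 2) : L2Disc →L[ℝ] L2Disc :=
  mulOp fun z => fderiv ℝ (connCoeff p t i) z (dir i) • fiberRot

/-- The bounded operator given by the Higgs potential. -/
def higgsOp (y : ℝ → ℝ) (t : ℝ) : L2Disc →L[ℝ] L2Disc :=
  t ^ 2 • mulOp fun z => fiberHiggs (higgsSize y t z) z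

section Linearization

variable {y p : ℝ → ℝ} {t : ℝ}

lemma IsProfileOn.norm_fiberHiggs_le (h : IsProfileOn univ y p) (t : ℝ) :
    ∀ᵐ z ∂discMeasure, ‖fiberHiggs (higgsSize y t z) z‖
      ≤ fiberBound * (Real.exp 2 * ((scale t)⁻¹ + 1) + 2) :=
  ae_disc_ne_zero fun z hz hz0 => by
    have h1 : ‖z‖ ≤ 1 := by simpa using (Metric.mem_ball.1 hz).le
    have h2 := two_mul_norm_le_higgsSize y t z
    refine (Hitchin.norm_fiberHiggs_le (by linarith [norm_nonneg z]) h1).trans ?_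
    have h3 : higgsSize y t z ≤ _ := h.higgsSize_le hz0 h1
    have h4 : 0 ≤ fiberBound := by unfold fiberBound; positivity
    exact mul_le_mul_of_nonneg_left (by linarith) h4

lemma IsProfileOn.memLp_fiberHiggs (h : IsProfileOn univ y p) (t : ℝ) :
    MemLp (fun z => fiberHiggs (higgsSize y t z) z) ∞ discMeasure := by
  have hm : Measurable (higgsSize y t) := measurable_higgsSize h.contDiff.1.continuous.measurable t
  refine memLp_top_of_bound ?_ _ (h.norm_fiberHiggs_le t)
  unfold fiberHiggs
  exact ((hm.aestronglyMeasurable.smul aestronglyMeasurable_const).add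
    (Complex.continuous_re.aestronglyMeasurable.smul aestronglyMeasurable_const)).add
    (Complex.continuous_im.aestronglyMeasurable.smul aestronglyMeasurable_const)

lemma IsProfileOn.isPotential (h : IsProfileOn univ y p)
    (hp : ∀ s ≤ 1, p s ≤ -(1 / 3) + Real.exp 2 * Real.exp (4 / 3 * s)) (t : ℝ) :
    IsPotential (connOp p t) (connDerivOp p t) (higgsOp y t) where
  hasWeakDeriv i _ _ hu := hu.smul_conic (h.isConicField_connCoeff hp t i) fiberRot
  skew i u := by
    filter_upwards [coe_mulOp ((h.isConicField_connCoeff hp t i).memLp fiberRot).1 u] with z hz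
    rw [connOp, hz, smul_apply, real_inner_smul_right, inner_fiberRot, mul_zero]
  nonneg u := by
    rw [higgsOp, smul_apply, real_inner_smul_left, L2.inner_def]
    refine mul_nonneg (sq_nonneg t) (integral_nonneg_of_ae ?_)
    filter_upwards [coe_mulOp (h.memLp_fiberHiggs t) u] with z hz
    rw [hz]
    exact inner_fiberHiggs_nonneg (two_mul_norm_le_higgsSize y t z) _

lemma IsProfileOn.hasCovDeriv_iff (h : IsProfileOn univ y p)
    (hp : ∀ s ≤ 1, p s ≤ -(1 / 3) + Real.exp 2 * Real.exp (4 / 3 * s)) (ht : 0 < t) {i : Fin 2}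
    {u v : L2Disc} : HasCovDeriv (fun ρ => y (Real.log ρ)) t i u v ↔ CovDeriv (connOp p t) i u v := by
  refine exists_congr fun g => and_congr_right fun _ => ?_
  have hc := coe_mulOp ((h.isConicField_connCoeff hp t i).memLp fiberRot).1 u
  have hz0 : ∀ᵐ z ∂discMeasure, z ≠ 0 := ae_disc_ne_zero fun z _ hz => hz
  have hmat : ∀ z : ℂ, z ≠ 0 → ⁅connFid (fun ρ => y (Real.log ρ)) t z (dir i), toMat (u z)⁆
      = toMat (connCoeff p t i z • fiberRot (u z)) := fun z hz => by
    rw [h.connFid_log ht hz, lie_diag_toMat]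
  constructor
  · intro hv
    refine Lp.ext ?_
    filter_upwards [hv, hc, hz0, Lp.coeFn_add g (connOp p t i u)] with z h1 h2 h3 h4
    rw [h4, Pi.add_apply, connOp, h2]
    apply toMat_injective
    rw [h1, hmat z h3, toMat_add]; rfl
  · rintro rfl
    filter_upwards [hc, hz0, Lp.coeFn_add g (connOp p t i u)] with z h2 h3 h4
    rw [h4, Pi.add_apply, connOp, h2, hmat z h3, toMat_add]; rfl

lemma IsProfileOn.hasLinearization_iff (h : IsProfileOn univ y p)
    (hp : ∀ s ≤ 1, p s ≤ -(1 / 3) + Real.exp 2 * Real.exp (4 / 3 * s)) (ht : 0 < t)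
    {u v : L2Disc} : HasLinearization (fun ρ => y (Real.log ρ)) t u v
      ↔ PerturbedLaplacian (connOp p t) (higgsOp y t) u v := by
  have hz0 : ∀ᵐ z ∂discMeasure, z ≠ 0 := ae_disc_ne_zero fun z _ hz => hz
  have hc := coe_mulOp (h.memLp_fiberHiggs t) u
  have hN : ∀ w : L2Disc, (∀ᵐ z ∂discMeasure, toMat (v z) = toMat (w z) + ((t ^ 2 : ℝ) : ℂ) •
      higgsPotential (higgsFid (fun ρ => y (Real.log ρ)) t z) (toMat (u z)))
        ↔ v = w + higgsOp y t u := fun w => by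
    have hz : ∀ᵐ z ∂discMeasure, toMat ((w + higgsOp y t u : L2Disc) z)
        = toMat (w z) + ((t ^ 2 : ℝ) : ℂ) •
          higgsPotential (higgsFid (fun ρ => y (Real.log ρ)) t z) (toMat (u z)) := by
      filter_upwards [hz0, hc, Lp.coeFn_add w (higgsOp y t u),
        Lp.coeFn_smul (t ^ 2) (mulOp (fun z => fiberHiggs (higgsSize y t z) z) u)] with z h1 h2 h3 h4
      rw [h3, Pi.add_apply, toMat_add, higgsPotential_fid y ht h1, ← toMat_smul, ← h2, higgsOp,
        smul_apply, h4, Pi.smul_apply]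
    constructor
    · intro hv
      refine Lp.ext ?_
      filter_upwards [hv, hz] with z h1 h2
      exact toMat_injective (h1.trans h2.symm)
    · rintro rfl
      exact hz
  simp only [HasLinearization, HasConnLaplacian, hN, h.hasCovDeriv_iff hp ht]
  constructor
  · rintro ⟨w, ⟨p, q, hpq, rfl⟩, rfl⟩
    exact ⟨p, q, hpq, rfl⟩
  · rintro ⟨p, q, hpq, rfl⟩
    exact ⟨_, ⟨p, q, hpq, rfl⟩, rfl⟩

lemma IsProfileOn.isDirichletInverse (h : IsProfileOn univ y p)
    (hp : ∀ s ≤ 1, p s ≤ -(1 / 3) + Real.exp 2 * Real.exp (4 / 3 * s)) (ht : 0 < t) :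
    IsDirichletInverse (fun ρ => y (Real.log ρ)) t (h.isPotential hp t).green where
  defined u hu := by
    simp only [h.hasLinearization_iff hp ht]
    exact (h.isPotential hp t).existsUnique_perturbedLaplacian hu.1
  mem := (h.isPotential hp t).memDirichletDomain_green
  right_inv v := (h.hasLinearization_iff hp ht).2 ((h.isPotential hp t).perturbedLaplacian_green v)
  left_inv _ _ hu huv := (h.isPotential hp t).green_eq hu.2 ((h.hasLinearization_iff hp ht).1 huv)

/-- The constant in the `H²` bound. -/
def greenConst : ℝ :=
  9 + 16 * (32 * Real.exp 3 * ‖fiberRot‖) + 24 * (32 * Real.exp 3 * ‖fiberRot‖) ^ 2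
    + 8 * (120 * Real.exp 3 * ‖fiberRot‖) + 4 * (fiberBound * (Real.exp 2 * 2 + 2))

lemma one_le_scale (ht : 1 ≤ t) : 1 ≤ scale t :=
  Real.one_le_exp (mul_nonneg (by norm_num) (Real.log_nonneg (by linarith)))

lemma scale_sq_le (ht : 1 ≤ t) : scale t ^ 2 ≤ 8 * t ^ 2 := by
  have h0 : 0 < 8 / 3 * t := by linarith
  have h1 : 0 ≤ Real.log (8 / 3 * t) := Real.log_nonneg (by linarith)
  calc scale t ^ 2 ≤ (8 / 3 * t) ^ 2 := by
        refine pow_le_pow_left₀ (scale_pos t).le ?_ 2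
        refine le_of_le_of_eq ?_ (Real.exp_log h0)
        exact Real.exp_le_exp.2 (by linarith)
    _ ≤ _ := by nlinarith [sq_nonneg t]

/-- The connection is of size `scale`, its derivatives of size `scale²`, the potential of size `t²`.
As `scale² ≤ 8 t²` for `t ≥ 1`, every term of `h2Norm_green_le` is at most a constant times `t²`. -/
lemma IsProfileOn.h2Norm_le (h : IsProfileOn univ y p)
    (hp : ∀ s ≤ 1, p s ≤ -(1 / 3) + Real.exp 2 * Real.exp (4 / 3 * s)) (ht : 1 ≤ t) (v : L2Disc) :
    h2Norm ((h.isPotential hp t).green v) ≤ greenConst * t ^ 2 * ‖v‖ := by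
  have hs := one_le_scale ht
  have hs2 := scale_sq_le ht
  have ht2 : 1 ≤ t ^ 2 := one_le_pow₀ ht
  have hb : 0 ≤ fiberBound := by unfold fiberBound; positivity
  have hA : ∀ i u, ‖connOp p t i u‖ ≤ 4 * (Real.exp 3 * scale t) * ‖fiberRot‖ * ‖u‖ := fun i u =>
    norm_mulOp_le (by positivity) (ae_of_all _ fun z => by
      rw [norm_smul, Real.norm_eq_abs]
      gcongr
      exact h.abs_connCoeff_le_scale hp i z) u
  have hB : ∀ i u, ‖connDerivOp p t i u‖ ≤ 15 * (Real.exp 3 * scale t ^ 2) * ‖fiberRot‖ * ‖u‖ :=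
    fun i u => norm_mulOp_le (by positivity) (ae_disc_ne_zero fun z _ hz => by
      rw [norm_smul, Real.norm_eq_abs]
      gcongr
      exact (h.isConicField_connCoeff hp t i).abs_fderiv_le i z hz) u
  have hN : ∀ u, ‖higgsOp y t u‖
      ≤ t ^ 2 * (fiberBound * (Real.exp 2 * ((scale t)⁻¹ + 1) + 2)) * ‖u‖ := fun u => by
    rw [higgsOp, smul_apply, norm_smul, Real.norm_of_nonneg (sq_nonneg t), mul_assoc]
    gcongr
    have := inv_nonneg.2 (scale_pos t).le
    exact norm_mulOp_le (by positivity) (h.norm_fiberHiggs_le t) u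
  have hi : (scale t)⁻¹ ≤ 1 := inv_le_one_of_one_le₀ hs
  have hi0 := inv_nonneg.2 (scale_pos t).le
  refine ((h.isPotential hp t).h2Norm_green_le (by positivity) (by positivity) (by positivity)
    hA hB hN v).trans (mul_le_mul_of_nonneg_right ?_ (norm_nonneg v))
  have k1 : 4 * (Real.exp 3 * scale t) * ‖fiberRot‖ ≤ 32 * Real.exp 3 * ‖fiberRot‖ * t ^ 2 := by
    have : scale t ≤ 8 * t ^ 2 := by nlinarith
    calc _ ≤ 4 * (Real.exp 3 * (8 * t ^ 2)) * ‖fiberRot‖ := by gcongr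
      _ = _ := by ring
  have k2 : (4 * (Real.exp 3 * scale t) * ‖fiberRot‖) ^ 2
      ≤ (32 * Real.exp 3 * ‖fiberRot‖) ^ 2 * t ^ 2 := by
    calc _ = (4 * Real.exp 3 * ‖fiberRot‖) ^ 2 * scale t ^ 2 := by ring
      _ ≤ (4 * Real.exp 3 * ‖fiberRot‖) ^ 2 * (8 * t ^ 2) := by gcongr
      _ = 8 * (4 * Real.exp 3 * ‖fiberRot‖) ^ 2 * t ^ 2 := by ring
      _ ≤ 64 * (4 * Real.exp 3 * ‖fiberRot‖) ^ 2 * t ^ 2 := by gcongr; norm_num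
      _ = _ := by ring
  have k3 : 15 * (Real.exp 3 * scale t ^ 2) * ‖fiberRot‖
      ≤ 120 * Real.exp 3 * ‖fiberRot‖ * t ^ 2 := by
    calc _ ≤ 15 * (Real.exp 3 * (8 * t ^ 2)) * ‖fiberRot‖ := by gcongr
      _ = _ := by ring
  have k4 : t ^ 2 * (fiberBound * (Real.exp 2 * ((scale t)⁻¹ + 1) + 2))
      ≤ fiberBound * (Real.exp 2 * 2 + 2) * t ^ 2 := by
    calc _ ≤ t ^ 2 * (fiberBound * (Real.exp 2 * (1 + 1) + 2)) := by gcongr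
      _ = _ := by ring
  unfold greenConst
  linarith

end Linearization

end Hitchin

end

theorem mainTheorem9 :
    ∃ ψ : ℝ → ℝ, Hitchin.IsPainleveProfile ψ ∧
      (∀ χ : ℝ → ℝ, Hitchin.IsPainleveProfile χ → Set.EqOn χ ψ (Set.Ioi 0)) ∧
      ∃ C : ℝ, 0 < C ∧ ∀ t : ℝ, 0 < t →
        ∃ G : Hitchin.L2Disc →L[ℝ] Hitchin.L2Disc, Hitchin.IsDirichletInverse ψ t G ∧
          ‖G‖ ≤ C ∧
          (1 ≤ t → ∀ v : Hitchin.L2Disc, Hitchin.h2Norm (G v) ≤ C * t ^ 2 * ‖v‖) := by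
  obtain ⟨y, p, h, hp⟩ := Hitchin.exists_profileOn_univ
  have hψ := h.isPainleveProfile hp
  refine ⟨fun ρ => y (Real.log ρ), hψ, fun χ hχ => hψ.eqOn hχ, max 4 Hitchin.greenConst,
    lt_max_of_lt_left four_pos, fun t ht => ⟨(h.isPotential hp t).green,
      h.isDirichletInverse hp ht, (h.isPotential hp t).norm_green_le.trans (le_max_left _ _),
      fun ht1 v => (h.h2Norm_le hp ht1 v).trans ?_⟩⟩
  gcongr
  exact le_max_right _ _
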